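/- **Setting.** Let $\lambda$ be the security parameter. $\mathsf{Setup}(1^\lambda)$ returns parameters $(k,w,\delta,s,|\mathsf{seed}|)$ bounded by a polynomial in $\lambda$, with $k,s\ge 1$ and $w\le 2k$. For $\bm a\in\mathbb F_2^k$ let $\bm H=[\bm I_k\ \bm A]$ be the systematic quasi-cyclic $k\times 2k$ parity-check matrix with $\bm A$ the circulant matrix of $\bm a$; let $\mathsf{rot}_r$ be the cyclic shift by $r$ positions (in each block of length $k$), $\pi[\cdot]$ the action of $\pi\in S_{2k}$ on the coordinates of $\mathbb F_2^{2k}$, and $|\cdot|$ the Hamming weight. "$\bm a\leftarrow_\theta S$" means that $\bm a$ is computed from the seed $\theta$ by a deterministic polynomial-time algorithm; it is understood that permutations $\pi\in S_{2k}$ and vectors $\bm v\in\mathbb F_2^{2k}$ sampled from a uniformly random seed are computationally indistinguishable from uniformly random ones. $\mathsf{Com}(m;\rho)$ is a polynomial-time commitment scheme whose (possibly empty) string $\rho$ of coins is uniform and is revealed to open the commitment. It is *hiding* if for all probabilistic polynomial-time (PPT) adversaries (with auxiliary input of polynomial size) and every pair of messages $(m_0,m_1)$ (depending on $\lambda$,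 of the same, polynomially bounded, length), $|\Pr[b=b']-\frac12|$ is negligible, where $b$ is a uniform bit and $b'$ is the answer of the adversary to a commitment to $m_b$. $\mathsf{Compress}$ is any deterministic polynomial-time algorithm. "Computationally indistinguishable" is meant for PPT distinguishers with auxiliary input of polynomial size. **Keys.** $\phi_1,\phi_2\in\{0,1\}^{|\mathsf{seed}|}$ are uniform, $\bm H\leftarrow_{\phi_2}$ quasi-cyclic matrices, $(\bm x^1,\dots,\bm x^s)\leftarrow_{\phi_1}\{\bm x\in\mathbb F_2^{2k}:|\bm x|=w\}^s$, $\bm y^i=\bm H\bm x^i$; $\mathsf{sk}=\phi_1$ and $\mathsf{pk}=(\phi_2,\bm y^1,\dots,\bm y^s)$. **Optimized quasi-cyclic Stern protocol.** (1) For $i=1,\dots,\delta$ the prover draws uniform seeds $\theta_i,\xi_i$, sets $\pi_i\leftarrow_{\theta_i}S_{2k}$, $\bm v_i\leftarrow_{\xi_i}\mathbb F_2^{2k}$, $\bm u_i=\pi_i^{-1}[\bm v_i]$, $c_{i,1}=\mathsf{Com}(\pi_i\|\bm H\bm u_i)$, $c_{i,2}=\mathsf{Com}(\pi_i[\bm u_i])$,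 and sends $\mathsf{Cmt}_1=\mathsf{Com}(c_{1,1}\|c_{1,2}\|\cdots\|c_{\delta,1}\|c_{\delta,2})$. (2) The verifier sends $\mathsf{Ch}_1=((s_i,r_i))_i$, uniform with $s_i$ one of the $s$ indices and $r_i\in[0,k-1]$. (3) With $\bm x_i'=\mathsf{rot}_{r_i}(\bm x^{s_i})$ and $c_{i,3}=\mathsf{Com}(\pi_i[\bm u_i+\bm x_i'])$ the prover sends $\mathsf{Cmt}_2=\mathsf{Com}(c_{1,3}\|\cdots\|c_{\delta,3})$. (4) The verifier sends uniform bits $\mathsf{Ch}_2=(b_1,\dots,b_\delta)$. (5) The prover sends $\mathsf{Rsp}=\mathsf{Compress}(d_1,\dots,d_\delta)$, where $d_i=(\theta_i,\bm u_i+\bm x_i',c_{i,2})$ if $b_i=0$ and $d_i=(\xi_i,\pi_i[\bm x_i'],c_{i,1})$ if $b_i=1$, each $d_i$ together with the coins of the two commitments of iteration $i$ that the verifier recomputes, and the input of $\mathsf{Compress}$ together with the coins of $\mathsf{Cmt}_1,\mathsf{Cmt}_2$. The transcript is $(\mathsf{Cmt}_1,\mathsf{Ch}_1,\mathsf{Cmt}_2,\mathsf{Ch}_2,\mathsf{Rsp})$.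 **Theorem (Honest-Verifier Zero-Knowledge).** If the commitment scheme is hiding, then the optimized quasi-cyclic Stern protocol is honest-verifier zero-knowledge: there is a PPT simulator which, on input $1^\lambda$, the parameters $\mathsf{param}$ and the public key $\mathsf{pk}$ only, outputs transcripts that are computationally indistinguishable from those of honest executions between the prover with input $(\mathsf{param},\mathsf{sk},\mathsf{pk})$ and the verifier with input $(\mathsf{param},\mathsf{pk})$, for all $\mathsf{param}$ returned by $\mathsf{Setup}(1^\lambda)$ and all $(\mathsf{sk},\mathsf{pk})$ returned by key generation. -/

import Mathlib

namespace QCStern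

/-! ### Data, probabilistic programs and their running time -/

/-- The data on which programs work: finite binary trees. -/
inductive Val : Type where
  | nil : Val
  | node : Val → Val → Val

namespace Val

/-- The size of a datum: its number of nodes (leaves included). -/
def size : Val → ℕ
  | nil => 1
  | node a b => 1 + a.size + b.size

/-- First component. -/
def hd : Val → Val
  | nil => nil
  | node a _ => a

/-- Second component. -/
def tl : Val → Val
  | nil => nil
  | node _ b => b

/-- The list that a datum represents (`nil` is the empty list, `node` is cons). -/
def toList : Val → List Val
  | nil => []
  | node a b => a :: b.toList

/-- Truth value of a datum: `nil` is false, everything else is true. -/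
def isTrue : Val → Bool
  | nil => false
  | node _ _ => true

end Val

/-- Encoding of a bit. -/
def encBool : Bool → Val
  | false => .nil
  | true => .node .nil .nil

/-- Encoding of a list. -/
def encList {α : Type} (e : α → Val) : List α → Val
  | [] => .nil
  | a :: l => .node (e a) (encList e l)

/-- Unary encoding of a natural number, so that `encNat l` is the usual `1^l`. -/
def encNat : ℕ → Val
  | 0 => .nil
  | n + 1 => .node .nil (encNat n)

/-- Encoding of a bit string. -/
def encBits (l : List Bool) : Val := encList encBool l

/-- Encoding of a finite sequence. -/
def encSeq {α : Type} {n : ℕ} (e : α → Val) (f : Fin n → α) : Val := encList e (List.ofFn f)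

/-- Probabilistic while-programs (in point-free form) on binary trees. -/
inductive Prog : Type where
  /-- return the input -/
  | ident : Prog
  /-- return `nil` -/
  | empty : Prog
  /-- first component of the input -/
  | hd : Prog
  /-- second component of the input -/
  | tl : Prog
  /-- return an element of the input list chosen uniformly at random (so that a fair coin is a
  uniform choice from a list of length two) -/
  | pick : Prog
  /-- run both programs on the input and return the pair of the results -/
  | pair : Prog → Prog → Prog
  /-- run the first program, then the second one on its result -/
  | seq : Prog → Prog → Prog
  /-- branch on the result of the first program -/
  | cond : Prog → Prog → Prog → Prog
  /-- `loop c b`: while the program `c` returns true on the current datum, apply `b` to it -/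
  | loop : Prog → Prog → Prog

/-- The distribution of outcomes of a run: `some (v, t)` is "result `v` after `t` time units",
`none` is "no result, as some loop was cut off". -/
abbrev Outcome : Type := PMF (Option (Val × ℕ))

/-- Add `n` time units to a run. -/
noncomputable def Outcome.charge (n : ℕ) (r : Outcome) : Outcome :=
  PMF.map (Option.map fun p => (p.1, n + p.2)) r

/-- Continue a run, adding up the times. -/
noncomputable def Outcome.andThen (r : Outcome) (f : Val → Outcome) : Outcome :=
  PMF.bind r fun o =>
    match o with
    | none => PMF.pure none
    | some (v, t) => Outcome.charge t (f v)

/-- The outcome with result `v` after `t` time units. -/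
noncomputable def Outcome.ret (v : Val) (t : ℕ) : Outcome := PMF.pure (some (v, t))

/-- A while loop with test `c` and body `b`, cut off when `d` tests have not ended it.
A test costs the size of the current datum in addition to the time of `c`. -/
noncomputable def whileLoop (c b : Val → Outcome) : ℕ → Val → Outcome
  | 0, _ => PMF.pure none
  | d + 1, v => Outcome.charge v.size <| Outcome.andThen (c v) fun a =>
      if a.isTrue then Outcome.andThen (b v) (whileLoop c b d) else Outcome.ret v 0

/-- A uniformly random element of the list represented by a datum (`nil` for the empty list). -/
noncomputable def pickElem : Val → PMF Val
  | .nil => PMF.pure .nil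
  | .node a b =>
      PMF.map (fun i : Fin (b.toList.length + 1) => (a :: b.toList).get i)
        (PMF.uniformOfFintype (Fin (b.toList.length + 1)))

/-- `p.exec d v` is the run of the program `p` on the input `v`, where every loop is cut off after
`d` iterations. Each elementary operation costs the size of the datum it is applied to, so that
the size of a result is at most proportional to the time spent. -/
noncomputable def Prog.exec (d : ℕ) : Prog → Val → Outcome
  | .ident, v => Outcome.ret v v.size
  | .empty, v => Outcome.ret .nil v.size
  | .hd, v => Outcome.ret v.hd v.size
  | .tl, v => Outcome.ret v.tl v.size
  | .pick, v => PMF.map (fun a => some (a, v.size)) (pickElem v)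
  | .pair f g, v => Outcome.charge v.size <| Outcome.andThen (Prog.exec d f v) fun a =>
      Outcome.andThen (Prog.exec d g v) fun b => Outcome.ret (.node a b) 0
  | .seq f g, v => Outcome.andThen (Prog.exec d f v) (Prog.exec d g)
  | .cond c f g, v => Outcome.charge v.size <| Outcome.andThen (Prog.exec d c v) fun a =>
      if a.isTrue then Prog.exec d f v else Prog.exec d g v
  | .loop c b, v => whileLoop (Prog.exec d c) (Prog.exec d b) d v

/-- A probabilistic polynomial time (PPT) algorithm: a program that, on every input and for all
random choices, halts within a number of time units that is polynomial in the size of the input.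
(A loop of `m` iterations takes more than `m` time units, so cutting loops off after `bound`
iterations is no restriction.) -/
structure PPT where
  /-- the program -/
  prog : Prog
  /-- the time bound -/
  bound : Polynomial ℕ
  /-- the program respects the time bound -/
  halts : ∀ v : Val, ∀ o ∈ (prog.exec (bound.eval v.size) v).support,
    ∃ (w : Val) (t : ℕ), o = some (w, t) ∧ t ≤ bound.eval v.size

/-- The output distribution of a PPT algorithm. -/
noncomputable def PPT.eval (A : PPT) (v : Val) : PMF Val :=
  PMF.map (fun o => (o.map Prod.fst).getD .nil) (A.prog.exec (A.bound.eval v.size) v)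

/-- The distribution of the bit that a PPT algorithm answers. -/
noncomputable def PPT.guess (A : PPT) (v : Val) : PMF Bool := PMF.map Val.isTrue (A.eval v)

/-- The function `f` is computed by a deterministic polynomial time algorithm, with respect to the
encodings `ein` and `eout`. -/
def PolyTime {α β : Type} (ein : α → Val) (eout : β → Val) (f : α → β) : Prop :=
  ∃ A : PPT, ∀ a : α, A.eval (ein a) = PMF.pure (eout (f a))

/-! ### Asymptotics and indistinguishability -/

/-- `f` is bounded by a polynomial. -/
def PolyBounded (f : ℕ → ℕ) : Prop := ∃ q : Polynomial ℕ, ∀ l, f l ≤ q.eval l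

/-- `f` is negligible: it tends to zero faster than the inverse of every polynomial. -/
def Negligible (f : ℕ → ℝ) : Prop :=
  Asymptotics.SuperpolynomialDecay Filter.atTop (fun l : ℕ => (l : ℝ)) f

/-- The probability that `D` answers 1 on a sample of `X`, given `1^l` and the auxiliary
input `z`. -/
noncomputable def acceptProb (D : PPT) (l : ℕ) (z : Val) (X : PMF Val) : ℝ :=
  ((PMF.bind X fun x => D.guess (.node (encNat l) (.node z x))) true).toReal

/-- Computational indistinguishability of two ensembles: every PPT distinguisher, with any
auxiliary input of polynomial size, has a negligible advantage. -/
def CompIndist (X Y : ℕ → PMF Val) : Prop :=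
  ∀ (D : PPT) (z : ℕ → Val), PolyBounded (fun l => (z l).size) →
    Negligible fun l => |acceptProb D l (z l) (X l) - acceptProb D l (z l) (Y l)|

/-! ### Commitment schemes -/

/-- Bit strings of length `n`. -/
abbrev Bits (n : ℕ) : Type := Fin n → Bool

/-- The encoding of a bit string of fixed length. -/
def encFixed {n : ℕ} (b : Bits n) : Val := encSeq encBool b

/-- A commitment scheme. `commit l m ρ` is the commitment to the message `m` at the security
parameter `l` with the random coins `ρ`. A commitment `c` is opened to `m` by revealing the coins
`ρ` (if there are any), and the opening is accepted if and only if `c = commit l m ρ`. -/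
structure CommitmentScheme where
  /-- the number of random coins -/
  coinLen : ℕ → ℕ
  /-- the commitment function -/
  commit : (l : ℕ) → List Bool → Bits (coinLen l) → List Bool
  /-- the number of coins is efficiently computable -/
  coinLen_polyTime : PolyTime encNat encNat coinLen
  /-- commitments are efficiently computable -/
  commit_polyTime :
    PolyTime (fun a : Σ l : ℕ, List Bool × Bits (coinLen l) =>
        .node (encNat a.1) (.node (encBits a.2.1) (encFixed a.2.2)))
      encBits (fun a => commit a.1 a.2.1 a.2.2)

/-- The random coins of one commitment. -/
abbrev CommitmentScheme.Coins (COM : CommitmentScheme) (l : ℕ) : Type := Bits (COM.coinLen l)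

/-- The hiding experiment: a random bit `b` is drawn, the adversary gets `1^l`, its auxiliary
input and a commitment to `m_b`, and answers `b'`. The outcome is whether `b = b'`. -/
noncomputable def CommitmentScheme.hidingExperiment (COM : CommitmentScheme) (A : PPT) (l : ℕ)
    (z : Val) (m₀ m₁ : List Bool) : PMF Bool := do
  let b ← PMF.uniformOfFintype Bool
  let ρ ← PMF.uniformOfFintype (COM.Coins l)
  let c := COM.commit l (if b then m₁ else m₀) ρ
  let b' ← A.guess (.node (encNat l) (.node z (encBits c)))
  return (b == b')

/-- The advantage in the hiding experiment. -/
noncomputable def CommitmentScheme.hidingAdvantage (COM : CommitmentScheme) (A : PPT) (l : ℕ)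
    (z : Val) (m₀ m₁ : List Bool) : ℝ :=
  |(COM.hidingExperiment A l z m₀ m₁ true).toReal - 1 / 2|

/-- Computationally hiding: for every PPT adversary, with any auxiliary input of polynomial size,
and every pair of messages of the same, polynomially bounded, length, the advantage is
negligible. -/
def CommitmentScheme.Hiding (COM : CommitmentScheme) : Prop :=
  ∀ (A : PPT) (z : ℕ → Val) (m₀ m₁ : ℕ → List Bool),
    PolyBounded (fun l => (z l).size) → PolyBounded (fun l => (m₀ l).length) →
    (∀ l, (m₀ l).length = (m₁ l).length) →
    Negligible fun l => COM.hidingAdvantage A l (z l) (m₀ l) (m₁ l)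

/-! ### Parameters, vectors, permutations and quasi-cyclic codes -/

/-- The parameters: block length `k`, weight `w`, number of iterations `δ`, number `s` of syndromes
in the public key, and length `seedLen` of the seeds. -/
structure Params where
  k : ℕ
  w : ℕ
  δ : ℕ
  s : ℕ
  seedLen : ℕ
  k_pos : 0 < k
  s_pos : 0 < s
  w_le : w ≤ 2 * k

instance (P : Params) : NeZero P.k := ⟨P.k_pos.ne'⟩

instance (P : Params) : NeZero P.s := ⟨P.s_pos.ne'⟩

/-- Encoding of the parameters. -/
def encParams (P : Params) : Val :=
  encList encNat [P.k, P.w, P.δ, P.s, P.seedLen]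

/-- Index set of the `2k` coordinates: two blocks of length `k`. -/
abbrev Pos (k : ℕ) : Type := Fin k ⊕ Fin k

/-- The space `F_2^k`. -/
abbrev Vec (k : ℕ) : Type := Fin k → ZMod 2

/-- The space `F_2^{2k}`. -/
abbrev Vec₂ (k : ℕ) : Type := Pos k → ZMod 2

/-- The cyclic shift of a vector by `r` positions. -/
def rot {k : ℕ} (r : Fin k) (y : Vec k) : Vec k := fun j => y (j - r)

/-- The cyclic shift by `r` positions in each of the two blocks. -/
def rot₂ {k : ℕ} (r : Fin k) (x : Vec₂ k) : Vec₂ k :=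
  Sum.elim (rot r fun j => x (.inl j)) (rot r fun j => x (.inr j))

/-- The action `π[x]` of a permutation on the coordinates of a vector. -/
def permute {k : ℕ} (π : Equiv.Perm (Pos k)) (x : Vec₂ k) : Vec₂ k := fun i => x (π.symm i)

/-- The systematic quasi-cyclic parity check matrix `[I_k A]`, with `A` the circulant matrix of
`a`. A uniform matrix of this shape is given by a uniform `a`. -/
def qcMatrix {k : ℕ} (a : Vec k) : Matrix (Fin k) (Pos k) (ZMod 2) :=
  Matrix.fromCols 1 (Matrix.circulant a)

/-- The vectors of weight `w` in `F_2^{2k}`. -/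
abbrev WeightVec (P : Params) : Type := {x : Vec₂ P.k // hammingNorm x = P.w}

/-- The bits of a vector. -/
def vecBits {k : ℕ} (y : Vec k) : List Bool := List.ofFn fun i => decide (y i = 1)

/-- The bits of a vector with two blocks. -/
def vecBits₂ {k : ℕ} (x : Vec₂ k) : List Bool :=
  vecBits (fun i => x (.inl i)) ++ vecBits (fun i => x (.inr i))

/-- The bits of a permutation: the rows of its permutation matrix, so that the row of `i` is the
indicator of `π⁻¹ i`. -/
def permBits {k : ℕ} (π : Equiv.Perm (Pos k)) : List Bool :=
  let row : Pos k → List Bool := fun i =>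
    (List.ofFn fun j => decide (π (.inl j) = i)) ++ (List.ofFn fun j => decide (π (.inr j) = i))
  (List.ofFn fun i => row (.inl i)).flatten ++ (List.ofFn fun i => row (.inr i)).flatten

/-! ### Sampling from seeds -/

/-- Seeds. -/
abbrev Seed (P : Params) : Type := Bits P.seedLen

/-- Encoding of security parameter, parameters and seed. -/
def encSeedInput (a : Σ _ : ℕ, Σ P : Params, Seed P) : Val :=
  .node (encNat a.1) (.node (encParams a.2.1) (encFixed a.2.2))

/-- Deterministic polynomial time algorithms that sample from a seed: a permutation, a vector
of `F_2^{2k}`, a quasi-cyclic matrix (given by its circulant block), and `s` vectors of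
weight `w`. -/
structure SeedSampler where
  perm : (l : ℕ) → (P : Params) → Seed P → Equiv.Perm (Pos P.k)
  vec : (l : ℕ) → (P : Params) → Seed P → Vec₂ P.k
  block : (l : ℕ) → (P : Params) → Seed P → Vec P.k
  secrets : (l : ℕ) → (P : Params) → Seed P → Fin P.s → WeightVec P
  perm_polyTime : ∃ A : PPT, ∀ l P θ,
    A.eval (encSeedInput ⟨l, P, θ⟩) = PMF.pure (encBits (permBits (perm l P θ)))
  vec_polyTime : ∃ A : PPT, ∀ l P θ,
    A.eval (encSeedInput ⟨l, P, θ⟩) = PMF.pure (encBits (vecBits₂ (vec l P θ)))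
  block_polyTime : ∃ A : PPT, ∀ l P θ,
    A.eval (encSeedInput ⟨l, P, θ⟩) = PMF.pure (encBits (vecBits (block l P θ)))
  secrets_polyTime : ∃ A : PPT, ∀ l P θ,
    A.eval (encSeedInput ⟨l, P, θ⟩) =
      PMF.pure (encSeq (fun x : WeightVec P => encBits (vecBits₂ x.1)) (secrets l P θ))

/-- A setup algorithm draws parameters for a given security parameter. -/
abbrev Setup : Type := ℕ → PMF Params

/-- The parameters returned by `Setup(1^l)` are bounded by a polynomial in `l`
(the weight is at most `2k`). -/
def Setup.PolyBounded (setup : Setup) : Prop :=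
  ∃ q : Polynomial ℕ, ∀ l, ∀ P ∈ (setup l).support,
    P.k ≤ q.eval l ∧ P.δ ≤ q.eval l ∧ P.s ≤ q.eval l ∧ P.seedLen ≤ q.eval l

/-- Sampling a permutation or a vector from a uniformly random seed is computationally
indistinguishable from sampling it uniformly at random. -/
def SeedSampler.Pseudorandom (E : SeedSampler) (setup : Setup) : Prop :=
  ∀ par : ℕ → Params, (∀ l, par l ∈ (setup l).support) →
    CompIndist
      (fun l => PMF.map (fun θ => encBits (permBits (E.perm l (par l) θ)))
        (PMF.uniformOfFintype (Seed (par l))))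
      (fun l => PMF.map (fun π => encBits (permBits π))
        (PMF.uniformOfFintype (Equiv.Perm (Pos (par l).k)))) ∧
    CompIndist
      (fun l => PMF.map (fun ξ => encBits (vecBits₂ (E.vec l (par l) ξ)))
        (PMF.uniformOfFintype (Seed (par l))))
      (fun l => PMF.map (fun v => encBits (vecBits₂ v))
        (PMF.uniformOfFintype (Vec₂ (par l).k)))

/-! ### The protocol -/

/-- Secret keys: the seed of the secret vectors. -/
abbrev SecretKey (P : Params) : Type := Seed P

/-- Public keys: the seed of the parity check matrix and the `s` syndromes. -/
abbrev PublicKey (P : Params) : Type := Seed P × (Fin P.s → Vec P.k)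

/-- Encoding of a public key. -/
def encPublicKey {P : Params} (pk : PublicKey P) : Val :=
  .node (encFixed pk.1) (encSeq (fun y => encBits (vecBits y)) pk.2)

/-- Key generation. -/
noncomputable def keyGen (E : SeedSampler) (l : ℕ) (P : Params) :
    PMF (SecretKey P × PublicKey P) := do
  let φ₁ ← PMF.uniformOfFintype (Seed P)
  let φ₂ ← PMF.uniformOfFintype (Seed P)
  let H := qcMatrix (E.block l P φ₂)
  let y : Fin P.s → Vec P.k := fun i => H.mulVec (E.secrets l P φ₁ i).1
  return (φ₁, (φ₂, y))

/-- The first challenges `(s_i, r_i)`. -/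
abbrev Challenge₁ (P : Params) : Type := Fin P.δ → Fin P.s × Fin P.k

/-- The second challenges `b_i`. -/
abbrev Challenge₂ (P : Params) : Type := Bits P.δ

/-- The response `d_i` to one iteration: a seed, a vector and the commitment that the verifier
cannot recompute, together with the coins of the two commitments that the verifier recomputes. -/
structure Response (COM : CommitmentScheme) (l : ℕ) (P : Params) where
  seed : Seed P
  word : Vec₂ P.k
  com : List Bool
  coinsA : COM.Coins l
  coinsB : COM.Coins l

/-- Encoding of a response. -/
def encResponse {COM : CommitmentScheme} {l : ℕ} {P : Params} (d : Response COM l P) : Val :=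
  .node (encFixed d.seed) (.node (encBits (vecBits₂ d.word)) (.node (encBits d.com)
    (.node (encFixed d.coinsA) (encFixed d.coinsB))))

/-- All that the prover reveals in its last message, before compression: the coins of the
commitments `Cmt_1` and `Cmt_2`, and the responses `d_1, …, d_δ`. -/
structure Opening (COM : CommitmentScheme) (l : ℕ) (P : Params) where
  coins₁ : COM.Coins l
  coins₂ : COM.Coins l
  d : Fin P.δ → Response COM l P

/-- Encoding of the prover's last message. -/
def encOpening {COM : CommitmentScheme} {l : ℕ} {P : Params} (o : Opening COM l P) : Val :=
  .node (encFixed o.coins₁) (.node (encFixed o.coins₂) (encSeq encResponse o.d))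

/-- A compression algorithm for the last message of the prover: any deterministic polynomial time
algorithm. It may use the parameters and the second challenge, which the verifier knows. -/
structure Compressor (COM : CommitmentScheme) where
  compress : (l : ℕ) → (P : Params) → Challenge₂ P → Opening COM l P → Val
  compress_polyTime : ∃ A : PPT, ∀ l P b o,
    A.eval (.node (encNat l) (.node (encParams P) (.node (encFixed b) (encOpening o)))) =
      PMF.pure (compress l P b o)

/-- Transcripts `(Cmt_1, Ch_1, Cmt_2, Ch_2, Rsp)`. -/
structure Transcript (P : Params) where
  cmt₁ : List Bool
  ch₁ : Challenge₁ P
  cmt₂ : List Bool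
  ch₂ : Challenge₂ P
  rsp : Val

/-- Encoding of a transcript. -/
def encTranscript {P : Params} (t : Transcript P) : Val :=
  .node (encBits t.cmt₁) (.node
    (encSeq (fun c : Fin P.s × Fin P.k => .node (encNat c.1) (encNat c.2)) t.ch₁)
    (.node (encBits t.cmt₂) (.node (encFixed t.ch₂) t.rsp)))

/-- The distribution of the transcripts of honest executions between the prover with input
`(param, sk, pk)` and the verifier with input `(param, pk)`. -/
noncomputable def honestTranscript (COM : CommitmentScheme) (E : SeedSampler) (Z : Compressor COM)
    (l : ℕ) (P : Params) (sk : SecretKey P) (pk : PublicKey P) : PMF (Transcript P) := do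
  let H := qcMatrix (E.block l P pk.1)
  let x : Fin P.s → WeightVec P := E.secrets l P sk
  -- prover, first message
  let θ ← PMF.uniformOfFintype (Fin P.δ → Seed P)
  let ξ ← PMF.uniformOfFintype (Fin P.δ → Seed P)
  let ρ₁ ← PMF.uniformOfFintype (Fin P.δ → COM.Coins l)
  let ρ₂ ← PMF.uniformOfFintype (Fin P.δ → COM.Coins l)
  let R₁ ← PMF.uniformOfFintype (COM.Coins l)
  let π : Fin P.δ → Equiv.Perm (Pos P.k) := fun i => E.perm l P (θ i)
  let v : Fin P.δ → Vec₂ P.k := fun i => E.vec l P (ξ i)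
  let u : Fin P.δ → Vec₂ P.k := fun i => permute (π i).symm (v i)
  let c₁ := fun i => COM.commit l (permBits (π i) ++ vecBits (H.mulVec (u i))) (ρ₁ i)
  let c₂ := fun i => COM.commit l (vecBits₂ (permute (π i) (u i))) (ρ₂ i)
  let cmt₁ := COM.commit l (List.ofFn fun i => c₁ i ++ c₂ i).flatten R₁
  -- verifier, first challenge
  let ch₁ ← PMF.uniformOfFintype (Challenge₁ P)
  -- prover, second message
  let ρ₃ ← PMF.uniformOfFintype (Fin P.δ → COM.Coins l)
  let R₂ ← PMF.uniformOfFintype (COM.Coins l)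
  let xr : Fin P.δ → Vec₂ P.k := fun i => rot₂ (ch₁ i).2 (x (ch₁ i).1).1
  let c₃ := fun i => COM.commit l (vecBits₂ (permute (π i) (u i + xr i))) (ρ₃ i)
  let cmt₂ := COM.commit l (List.ofFn c₃).flatten R₂
  -- verifier, second challenge
  let ch₂ ← PMF.uniformOfFintype (Challenge₂ P)
  -- prover, last message
  let d : Fin P.δ → Response COM l P := fun i =>
    if ch₂ i = false then ⟨θ i, u i + xr i, c₂ i, ρ₁ i, ρ₃ i⟩
    else ⟨ξ i, permute (π i) (xr i), c₁ i, ρ₂ i, ρ₃ i⟩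
  return ⟨cmt₁, ch₁, cmt₂, ch₂, Z.compress l P ch₂ ⟨R₁, R₂, d⟩⟩

/-- Honest-verifier zero-knowledge: there is a PPT simulator that, given the security parameter,
the parameters and the public key, outputs transcripts that are computationally indistinguishable
from those of honest executions, for all parameters returned by the setup and all keys returned by
the key generation. -/
def HonestVerifierZK (setup : Setup) (COM : CommitmentScheme) (E : SeedSampler)
    (Z : Compressor COM) : Prop :=
  ∃ S : PPT, ∀ par : ℕ → Params, (∀ l, par l ∈ (setup l).support) →
    ∀ key : (l : ℕ) → SecretKey (par l) × PublicKey (par l),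
      (∀ l, key l ∈ (keyGen E l (par l)).support) →
      CompIndist
        (fun l => PMF.map encTranscript
          (honestTranscript COM E Z l (par l) (key l).1 (key l).2))
        (fun l => S.eval
          (.node (encNat l) (.node (encParams (par l)) (encPublicKey (key l).2))))

end QCStern

/-!
A transcript is the same polynomial time function of `δ` independent iterations in the real and in
the simulated execution, so by a hybrid argument it suffices to compare a single iteration. The
simulator guesses the challenge bit `b` and uses an arbitrary vector `z` of the right weight in
place of the secret `x'`. Nothing but hiding is needed for the commitment that the answer to `b`
leaves unopened: its message may be replaced by any other message of the same length.

If `b = 0`, the vector `v` may be taken uniform instead of pseudorandom; then `u = π⁻¹[v]` and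
`u + x'` are uniform as well, so that the revealed `u + x'` is independent of `x'`. If `b = 1`, the
permutation `π` may be taken uniform, and then the distribution of the revealed `π[x']` depends on
the weight of `x'` only.
-/

namespace QCStern

theorem pmf_bind_congr {α β : Type*} {μ : PMF α} {f g : α → PMF β}
    (h : ∀ a ∈ μ.support, f a = g a) : μ.bind f = μ.bind g := by
  rw [← PMF.bindOnSupport_eq_bind, ← PMF.bindOnSupport_eq_bind]
  exact congrArg _ (funext₂ h)

theorem polynomial_eval_mono (q : Polynomial ℕ) : Monotone fun n => q.eval n := fun a b h => by
  simp only [Polynomial.eval_eq_sum]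
  exact Finset.sum_le_sum fun i _ => Nat.mul_le_mul_left _ (Nat.pow_le_pow_left h i)

namespace Val

theorem one_le_size (v : Val) : 1 ≤ v.size := by
  cases v <;> simp only [size] <;> omega

theorem size_hd_le (v : Val) : v.hd.size ≤ v.size := by
  cases v <;> simp only [size, hd] <;> omega

theorem size_tl_le (v : Val) : v.tl.size ≤ v.size := by
  cases v <;> simp only [size, tl] <;> omega

theorem size_le_of_mem_toList {v x : Val} (h : x ∈ v.toList) : x.size ≤ v.size := by
  induction v with
  | nil => simp [toList] at h
  | node a b _ ih =>
    simp only [size]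
    rcases List.mem_cons.1 h with rfl | h
    · omega
    · have := ih h; omega

theorem length_toList_le (v : Val) : v.toList.length ≤ v.size := by
  induction v with
  | nil => simp [toList]
  | node _ b _ ih => simp only [toList, size, List.length_cons]; omega

end Val

theorem size_le_of_mem_support_pickElem {v x : Val} (h : x ∈ (pickElem v).support) :
    x.size ≤ v.size := by
  cases v with
  | nil => rw [(PMF.mem_support_pure_iff _ _).1 h]
  | node a b =>
    obtain ⟨i, -, rfl⟩ := (PMF.mem_support_map_iff _ _ _).1 h
    exact Val.size_le_of_mem_toList (v := .node a b) (List.get_mem _ _)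

namespace Outcome

variable {r : Outcome} {f g : Val → Outcome} {v w : Val} {n t T T' : ℕ}

theorem some_mem_support_charge :
    some (w, t) ∈ (r.charge n).support ↔ ∃ t', some (w, t') ∈ r.support ∧ t = n + t' := by
  simp only [charge, PMF.mem_support_map_iff]
  constructor
  · rintro ⟨_ | ⟨w, t'⟩, h, h'⟩ <;> cases h'
    exact ⟨t', h, rfl⟩
  · rintro ⟨t', h, rfl⟩
    exact ⟨_, h, rfl⟩

theorem none_mem_support_charge : none ∈ (r.charge n).support ↔ none ∈ r.support := by
  simp [charge]

theorem some_mem_support_andThen :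
    some (w, t) ∈ (r.andThen f).support ↔ ∃ v t₁ t₂, some (v, t₁) ∈ r.support ∧
      some (w, t₂) ∈ (f v).support ∧ t = t₁ + t₂ := by
  simp only [andThen, PMF.mem_support_bind_iff]
  constructor
  · rintro ⟨_ | ⟨v, t₁⟩, h, h'⟩
    · simp at h'
    · obtain ⟨t₂, h₂, rfl⟩ := some_mem_support_charge.1 h'
      exact ⟨v, t₁, t₂, h, h₂, rfl⟩
  · rintro ⟨v, t₁, t₂, h₁, h₂, rfl⟩
    exact ⟨_, h₁, some_mem_support_charge.2 ⟨t₂, h₂, rfl⟩⟩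

theorem none_mem_support_andThen :
    none ∈ (r.andThen f).support ↔ none ∈ r.support ∨
      ∃ v t, some (v, t) ∈ r.support ∧ none ∈ (f v).support := by
  simp only [andThen, PMF.mem_support_bind_iff]
  constructor
  · rintro ⟨_ | ⟨v, t₁⟩, h, h'⟩
    · exact .inl h
    · exact .inr ⟨v, t₁, h, none_mem_support_charge.1 h'⟩
  · rintro (h | ⟨v, t, h, h'⟩)
    · exact ⟨none, h, by simp⟩
    · exact ⟨_, h, none_mem_support_charge.2 h'⟩

theorem some_mem_support_ret : some (w, t) ∈ (ret v n).support ↔ w = v ∧ t = n := by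
  simp [ret]

theorem andThen_congr (h : ∀ v t, some (v, t) ∈ r.support → f v = g v) :
    r.andThen f = r.andThen g := by
  refine pmf_bind_congr ?_
  rintro (_ | ⟨v, t⟩) hv
  · rfl
  · simp only [h v t hv]

theorem map_fst_charge :
    (r.charge n).map (Option.map Prod.fst) = r.map (Option.map Prod.fst) := by
  rw [charge, PMF.map_comp]
  exact congrArg (PMF.map · r) (funext fun o => by cases o <;> rfl)

/-- The outcome `r` is never cut off, its result has distribution `μ`, and it takes at most `T`
time units. Programs are analysed by composing such triples. -/
structure Yields (r : Outcome) (μ : PMF Val) (T : ℕ) : Prop where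
  result : r.map (Option.map Prod.fst) = μ.map some
  time_le : ∀ w t, some (w, t) ∈ r.support → t ≤ T

namespace Yields

variable {μ : PMF Val} {κ : Val → PMF Val}

theorem mono (h : r.Yields μ T) (hT : T ≤ T') : r.Yields μ T' :=
  ⟨h.result, fun w t hw => (h.time_le w t hw).trans hT⟩

theorem none_notMem_support (h : r.Yields μ T) : none ∉ r.support := fun hn => by
  have : none ∈ (r.map (Option.map Prod.fst)).support :=
    (PMF.mem_support_map_iff _ _ _).2 ⟨none, hn, rfl⟩
  simp [h.result] at this

theorem mem_support_iff (h : r.Yields μ T) :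
    w ∈ μ.support ↔ ∃ t, some (w, t) ∈ r.support := by
  have : some w ∈ (μ.map some).support ↔ some w ∈ (r.map (Option.map Prod.fst)).support := by
    rw [h.result]
  simpa [PMF.mem_support_map_iff] using this

theorem ret (v : Val) (n : ℕ) : (ret v n).Yields (PMF.pure v) n where
  result := by simp [Outcome.ret, PMF.pure_map]
  time_le _ _ h := (some_mem_support_ret.1 h).2.le

theorem charge (n : ℕ) (h : r.Yields μ T) : (r.charge n).Yields μ (n + T) where
  result := map_fst_charge.trans h.result
  time_le w t hw := by
    obtain ⟨t', h', rfl⟩ := some_mem_support_charge.1 hw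
    exact Nat.add_le_add_left (h.time_le w t' h') n

theorem andThen (h : r.Yields μ T) (hf : ∀ v ∈ μ.support, (f v).Yields (κ v) T') :
    (r.andThen f).Yields (μ.bind κ) (T + T') where
  result := by
    have h_cases : (r.andThen f).map (Option.map Prod.fst) = (r.map (Option.map Prod.fst)).bind
        fun o => o.elim (PMF.pure none) fun v => (f v).map (Option.map Prod.fst) := by
      rw [Outcome.andThen, PMF.map_bind, PMF.bind_map]
      refine congrArg _ (funext fun o => ?_)
      rcases o with _ | ⟨v, t⟩
      · exact PMF.pure_map _ _
      · exact map_fst_charge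
    rw [h_cases, h.result, PMF.bind_map, PMF.map_bind]
    exact pmf_bind_congr fun v hv => (hf v hv).result
  time_le w t hw := by
    obtain ⟨v, t₁, t₂, h₁, h₂, rfl⟩ := some_mem_support_andThen.1 hw
    exact add_le_add (h.time_le v t₁ h₁) ((hf v (h.mem_support_iff.2 ⟨t₁, h₁⟩)).time_le w t₂ h₂)

end Yields

end Outcome

theorem whileLoop_size_le {c b : Val → Outcome} (n : ℕ) {v w : Val} {t : ℕ}
    (h : some (w, t) ∈ (whileLoop c b n v).support) : w.size ≤ t := by
  induction n generalizing v t with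
  | zero => simp [whileLoop] at h
  | succ n ih =>
    obtain ⟨t', h', rfl⟩ := Outcome.some_mem_support_charge.1 h
    obtain ⟨a, t₁, t₂, h₁, h₂, rfl⟩ := Outcome.some_mem_support_andThen.1 h'
    split at h₂
    · obtain ⟨u, t₃, t₄, -, h₄, rfl⟩ := Outcome.some_mem_support_andThen.1 h₂
      have := ih h₄
      omega
    · obtain ⟨rfl, rfl⟩ := Outcome.some_mem_support_ret.1 h₂
      omega

theorem Prog.size_le_time (d : ℕ) (p : Prog) {v w : Val} {t : ℕ}
    (h : some (w, t) ∈ (p.exec d v).support) : w.size ≤ t := by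
  induction p generalizing v w t with
  | ident | empty | hd | tl =>
    obtain ⟨rfl, rfl⟩ := Outcome.some_mem_support_ret.1 h
    first | exact le_rfl | exact v.one_le_size | exact v.size_hd_le | exact v.size_tl_le
  | pick =>
    obtain ⟨a, ha, h⟩ := (PMF.mem_support_map_iff _ _ _).1 h
    cases h
    exact size_le_of_mem_support_pickElem ha
  | pair f g hf hg =>
    obtain ⟨t', h', rfl⟩ := Outcome.some_mem_support_charge.1 h
    obtain ⟨a, t₁, t₂, h₁, h₂, rfl⟩ := Outcome.some_mem_support_andThen.1 h'
    obtain ⟨b, t₃, t₄, h₃, h₄, rfl⟩ := Outcome.some_mem_support_andThen.1 h₂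
    obtain ⟨rfl, rfl⟩ := Outcome.some_mem_support_ret.1 h₄
    have := hf h₁
    have := hg h₃
    have := v.one_le_size
    simp only [Val.size]
    omega
  | seq f g _ hg =>
    obtain ⟨a, t₁, t₂, -, h₂, rfl⟩ := Outcome.some_mem_support_andThen.1 h
    exact (hg h₂).trans (Nat.le_add_left t₂ t₁)
  | cond c f g _ hf hg =>
    obtain ⟨t', h', rfl⟩ := Outcome.some_mem_support_charge.1 h
    obtain ⟨a, t₁, t₂, -, h₂, rfl⟩ := Outcome.some_mem_support_andThen.1 h'
    split at h₂
    · have := hf h₂; omega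
    · have := hg h₂; omega
  | loop c b => exact whileLoop_size_le d h

theorem whileLoop_eq_of_le {c c' b b' : Val → Outcome}
    (hc : ∀ v, none ∉ (c v).support → c' v = c v) (hb : ∀ v, none ∉ (b v).support → b' v = b v)
    {n n' : ℕ} (hn : n ≤ n') {v : Val} (h : none ∉ (whileLoop c b n v).support) :
    whileLoop c' b' n' v = whileLoop c b n v := by
  induction n generalizing n' v with
  | zero => simp [whileLoop] at h
  | succ n ih =>
    obtain ⟨n', rfl⟩ : ∃ m, n' = m + 1 := ⟨n' - 1, by omega⟩
    simp only [whileLoop, Outcome.none_mem_support_charge, Outcome.none_mem_support_andThen,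
      not_or, not_exists, not_and] at h ⊢
    rw [hc v h.1]
    refine congrArg _ (Outcome.andThen_congr fun a t ha => ?_)
    have h_rest := h.2 a t ha
    split at h_rest
    · simp only [Outcome.none_mem_support_andThen, not_or, not_exists, not_and] at h_rest
      rw [if_pos ‹_›, if_pos ‹_›, hb v h_rest.1]
      exact Outcome.andThen_congr fun w s hw =>
        ih (Nat.le_of_succ_le_succ hn) (h_rest.2 w s hw)
    · rw [if_neg ‹_›, if_neg ‹_›]

theorem Prog.exec_eq_of_le {d d' : ℕ} (hd : d ≤ d') (p : Prog) {v : Val}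
    (h : none ∉ (p.exec d v).support) : p.exec d' v = p.exec d v := by
  induction p generalizing v with
  | ident | empty | hd | tl | pick => rfl
  | pair f g hf hg =>
    simp only [Prog.exec, Outcome.none_mem_support_charge, Outcome.none_mem_support_andThen,
      not_or, not_exists, not_and] at h ⊢
    rw [hf h.1]
    exact congrArg _ (Outcome.andThen_congr fun a t ha => by rw [hg (h.2 a t ha).1])
  | seq f g hf hg =>
    simp only [Prog.exec, Outcome.none_mem_support_andThen, not_or, not_exists, not_and] at h ⊢
    rw [hf h.1]
    exact Outcome.andThen_congr fun a t ha => hg (h.2 a t ha)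
  | cond c f g hc hf hg =>
    simp only [Prog.exec, Outcome.none_mem_support_charge, Outcome.none_mem_support_andThen,
      not_or, not_exists, not_and] at h ⊢
    rw [hc h.1]
    refine congrArg _ (Outcome.andThen_congr fun a t ha => ?_)
    have h_branch := h.2 a t ha
    split at h_branch
    · rw [if_pos ‹_›, if_pos ‹_›, hf h_branch]
    · rw [if_neg ‹_›, if_neg ‹_›, hg h_branch]
  | loop c b hc hb => exact whileLoop_eq_of_le (fun _ => hc) (fun _ => hb) hd h

/-- The program `p` on the input `v` halts within time `T`, with a result of distribution `μ`,
whenever its loops are cut off after at least `T` iterations. -/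
def Runs (p : Prog) (v : Val) (μ : PMF Val) (T : ℕ) : Prop :=
  ∀ d, T ≤ d → (p.exec d v).Yields μ T

namespace Runs

variable {p f g c : Prog} {v w : Val} {μ ν τ : PMF Val} {κ : Val → PMF Val} {T T₁ T₂ T₃ : ℕ}

theorem mono (h : Runs p v μ T) (hT : T ≤ T₁) : Runs p v μ T₁ :=
  fun d hd => (h d (hT.trans hd)).mono hT

theorem size_le (h : Runs p v μ T) (hw : w ∈ μ.support) : w.size ≤ T := by
  obtain ⟨t, ht⟩ := (h T le_rfl).mem_support_iff.1 hw
  exact (p.size_le_time T ht).trans ((h T le_rfl).time_le w t ht)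

theorem ident (v : Val) : Runs .ident v (PMF.pure v) v.size := fun _ _ => .ret _ _

theorem empty (v : Val) : Runs .empty v (PMF.pure .nil) v.size := fun _ _ => .ret _ _

theorem hd (v : Val) : Runs .hd v (PMF.pure v.hd) v.size := fun _ _ => .ret _ _

theorem tl (v : Val) : Runs .tl v (PMF.pure v.tl) v.size := fun _ _ => .ret _ _

theorem pick (v : Val) : Runs .pick v (pickElem v) v.size := fun d _ => by
  refine ⟨by simp only [Prog.exec, PMF.map_comp]; rfl, fun w t hw => ?_⟩
  obtain ⟨a, -, h⟩ := (PMF.mem_support_map_iff _ _ _).1 hw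
  cases h
  exact le_rfl

theorem pair (hf : Runs f v μ T₁) (hg : Runs g v ν T₂) :
    Runs (.pair f g) v (μ.bind fun a => ν.bind fun b => PMF.pure (.node a b))
      (v.size + (T₁ + (T₂ + 0))) := fun d hd =>
  ((hf d (by omega)).andThen fun _ _ => (hg d (by omega)).andThen fun _ _ => .ret _ 0).charge _

theorem seq (hf : Runs f v μ T₁) (hg : ∀ w ∈ μ.support, Runs g w (κ w) T₂) :
    Runs (.seq f g) v (μ.bind κ) (T₁ + T₂) := fun d hd =>
  (hf d (by omega)).andThen fun w hw => hg w hw d (by omega)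

theorem seq_pure (hf : Runs f v (PMF.pure w) T₁) (hg : Runs g w ν T₂) :
    Runs (.seq f g) v ν (T₁ + T₂) := by
  rw [← PMF.pure_bind w fun _ => ν]
  exact hf.seq fun x hx => (PMF.mem_support_pure_iff _ _).1 hx ▸ hg

theorem cond (hc : Runs c v τ T₁) (hf : Runs f v μ T₂) (hg : Runs g v ν T₃) :
    Runs (.cond c f g) v (τ.bind fun a => if a.isTrue then μ else ν)
      (v.size + (T₁ + max T₂ T₃)) := fun d hd => by
  refine ((hc d (by omega)).andThen fun a _ => ?_).charge _
  split
  · exact (hf d (by omega)).mono (le_max_left _ _)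
  · exact (hg d (by omega)).mono (le_max_right _ _)

end Runs

/-- The analogue of `Runs` for a loop, with independent cut-offs for the loop and for its parts,
so that it can be proved by induction on the number of iterations. -/
def LoopRuns (c b : Prog) (v : Val) (μ : PMF Val) (T : ℕ) : Prop :=
  ∀ d n, T ≤ d → T ≤ n → (whileLoop (c.exec d) (b.exec d) n v).Yields μ T

namespace LoopRuns

variable {c b : Prog} {v a : Val} {μ : PMF Val} {κ : Val → PMF Val} {T T₁ T₂ T₃ : ℕ}

theorem runs (h : LoopRuns c b v μ T) : Runs (.loop c b) v μ T := fun d hd => h d d hd hd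

theorem mono (h : LoopRuns c b v μ T) (hT : T ≤ T₁) : LoopRuns c b v μ T₁ :=
  fun d n hd hn => (h d n (hT.trans hd) (hT.trans hn)).mono hT

theorem test (hc : Runs c v (PMF.pure a) T₁)
    (ht : a.isTrue = true → ∀ d n, T₂ ≤ d → T₂ ≤ n →
      ((b.exec d v).andThen (whileLoop (c.exec d) (b.exec d) n)).Yields μ T₂)
    (hf : a.isTrue = false → μ = PMF.pure v) :
    LoopRuns c b v μ (v.size + (T₁ + T₂)) := fun d n hd hn => by
  have := v.one_le_size
  obtain ⟨n, rfl⟩ : ∃ m, n = m + 1 := ⟨n - 1, by omega⟩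
  rw [whileLoop, ← PMF.pure_bind a fun _ => μ]
  refine ((hc d (by omega)).andThen fun x hx => ?_).charge _
  obtain rfl := (PMF.mem_support_pure_iff _ _).1 hx
  cases h : x.isTrue with
  | false => simpa [hf h] using (Outcome.Yields.ret v 0).mono (Nat.zero_le T₂)
  | true => simpa using ht h d n (by omega) (by omega)

theorem halt (hc : Runs c v (PMF.pure a) T) (ha : a.isTrue = false) :
    LoopRuns c b v (PMF.pure v) (v.size + (T + 0)) :=
  test hc (fun h => by simp [ha] at h) fun _ => rfl

theorem step (hc : Runs c v (PMF.pure a) T₁) (ha : a.isTrue = true) (hb : Runs b v μ T₂)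
    (hl : ∀ w ∈ μ.support, LoopRuns c b w (κ w) T₃) :
    LoopRuns c b v (μ.bind κ) (v.size + (T₁ + (T₂ + T₃))) :=
  test hc (fun _ d n hd hn => (hb d (by omega)).andThen fun w hw =>
    hl w hw d n (by omega) (by omega)) fun h => by simp [ha] at h

end LoopRuns

/-- The random function `f` on data is computed in polynomial time. Unlike for `PPT`, the result
has to be described, so that such functions can be composed. -/
def IsPPT (f : Val → PMF Val) : Prop :=
  ∃ (p : Prog) (q : Polynomial ℕ), ∀ v, Runs p v (f v) (q.eval v.size)

/-- The function `f` on data is computed in polynomial time. -/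
@[fun_prop]
def IsPT (f : Val → Val) : Prop := IsPPT fun v => PMF.pure (f v)

theorem PPT.runs (A : PPT) (v : Val) : Runs A.prog v (A.eval v) (A.bound.eval v.size) := by
  have hn : none ∉ (A.prog.exec (A.bound.eval v.size) v).support := fun h => by
    obtain ⟨w, t, h, -⟩ := A.halts v _ h
    simp at h
  refine fun d hd => ⟨?_, fun w t h => ?_⟩ <;> rw [Prog.exec_eq_of_le hd _ hn] at *
  · rw [PPT.eval, PMF.map_comp, ← PMF.bind_pure_comp, ← PMF.bind_pure_comp]
    refine pmf_bind_congr ?_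
    rintro (_ | ⟨w, t⟩) h
    · exact absurd h hn
    · rfl
  · obtain ⟨w', t', h, ht⟩ := A.halts v _ h
    cases h
    exact ht

theorem PPT.isPPT (A : PPT) : IsPPT A.eval := ⟨A.prog, A.bound, A.runs⟩

theorem IsPPT.exists_ppt {f : Val → PMF Val} (hf : IsPPT f) : ∃ A : PPT, A.eval = f := by
  obtain ⟨p, q, h⟩ := hf
  refine ⟨⟨p, q, fun v o ho => ?_⟩, funext fun v => ?_⟩
  · cases o with
    | none => exact absurd ho (h v _ le_rfl).none_notMem_support
    | some o => exact ⟨o.1, o.2, rfl, (h v _ le_rfl).time_le _ _ ho⟩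
  · calc PMF.map (fun o => (o.map Prod.fst).getD .nil) (p.exec (q.eval v.size) v)
        = ((p.exec (q.eval v.size) v).map (Option.map Prod.fst)).map (·.getD .nil) :=
          (PMF.map_comp (Option.map Prod.fst) _ fun o : Option Val => o.getD .nil).symm
      _ = f v := by
          rw [(h v _ le_rfl).result, PMF.map_comp]
          exact PMF.map_id _

theorem IsPPT.exists_size_le {f : Val → PMF Val} (hf : IsPPT f) :
    ∃ q : Polynomial ℕ, ∀ v, ∀ w ∈ (f v).support, w.size ≤ q.eval v.size := by
  obtain ⟨p, q, h⟩ := hf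
  exact ⟨q, fun v w hw => (h v).size_le hw⟩

theorem IsPT.exists_size_le {f : Val → Val} (hf : IsPT f) :
    ∃ q : Polynomial ℕ, ∀ v, (f v).size ≤ q.eval v.size := by
  obtain ⟨q, h⟩ := IsPPT.exists_size_le hf
  exact ⟨q, fun v => h v _ (by simp)⟩

namespace IsPPT

variable {f g : Val → PMF Val} {c h : Val → Val}

theorem comp (hf : IsPPT f) (hh : IsPT h) : IsPPT fun v => f (h v) := by
  obtain ⟨p, q, hp⟩ := hf
  obtain ⟨p', q', hp'⟩ := hh
  refine ⟨.seq p' p, q' + q.comp q', fun v => ?_⟩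
  have h_size : (h v).size ≤ q'.eval v.size := (hp' v).size_le (by simp)
  simpa using (hp' v).seq_pure ((hp (h v)).mono (polynomial_eval_mono q h_size))

theorem bind {κ : Val → Val → PMF Val} (hf : IsPPT f) (hκ : IsPPT fun e => κ e.tl e.hd) :
    IsPPT fun v => (f v).bind (κ v) := by
  obtain ⟨p, q, hp⟩ := hf
  obtain ⟨p', q', hp'⟩ := hκ
  let q₁ : Polynomial ℕ := .X + (q + (.X + 0))
  refine ⟨.seq (.pair p .ident) p', q₁ + q'.comp q₁, fun v => ?_⟩
  have h_pair := (hp v).pair (Runs.ident v)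
  have := h_pair.seq fun w hw => (hp' w).mono (polynomial_eval_mono q' (h_pair.size_le hw))
  simpa [q₁, PMF.pure_bind, PMF.bind_bind, Val.hd, Val.tl] using this

theorem ite (hc : IsPT c) (hf : IsPPT f) (hg : IsPPT g) :
    IsPPT fun v => if (c v).isTrue then f v else g v := by
  obtain ⟨p, q, hp⟩ := hf
  obtain ⟨p', q', hp'⟩ := hg
  obtain ⟨p₀, q₀, hp₀⟩ := hc
  refine ⟨.cond p₀ p p', .X + (q₀ + (q + q')), fun v => ?_⟩
  have := (hp₀ v).cond (hp v) (hp' v)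
  rw [PMF.pure_bind] at this
  refine this.mono ?_
  simp only [Polynomial.eval_add, Polynomial.eval_X]
  omega

theorem pick (hh : IsPT h) : IsPPT fun v => pickElem (h v) :=
  comp (f := pickElem) ⟨.pick, .X, fun v => by simpa using Runs.pick v⟩ hh

end IsPPT

namespace IsPT

variable {c f g : Val → Val}

@[fun_prop]
theorem id : IsPT fun v => v := ⟨.ident, .X, fun v => by simpa using Runs.ident v⟩

@[fun_prop]
theorem comp (hf : IsPT f) (hg : IsPT g) : IsPT fun v => f (g v) :=
  IsPPT.comp (f := fun v => PMF.pure (f v)) hf hg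

@[fun_prop]
theorem hd (hf : IsPT f) : IsPT fun v => (f v).hd :=
  comp (f := Val.hd) ⟨.hd, .X, fun v => by simpa using Runs.hd v⟩ hf

@[fun_prop]
theorem tl (hf : IsPT f) : IsPT fun v => (f v).tl :=
  comp (f := Val.tl) ⟨.tl, .X, fun v => by simpa using Runs.tl v⟩ hf

@[fun_prop]
theorem node (hf : IsPT f) (hg : IsPT g) : IsPT fun v => .node (f v) (g v) := by
  obtain ⟨p, q, hp⟩ := hf
  obtain ⟨p', q', hp'⟩ := hg
  refine ⟨.pair p p', .X + (q + (q' + 0)), fun v => ?_⟩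
  simpa [PMF.pure_bind] using (hp v).pair (hp' v)

@[fun_prop]
theorem const (w : Val) : IsPT fun _ => w := by
  induction w with
  | nil => exact ⟨.empty, .X, fun v => by simpa using Runs.empty v⟩
  | node _ _ ha hb => exact ha.node hb

@[fun_prop]
theorem ite (hc : IsPT c) (hf : IsPT f) (hg : IsPT g) :
    IsPT fun v => if (c v).isTrue then f v else g v := by
  simpa only [IsPT, apply_ite PMF.pure] using IsPPT.ite hc hf hg

end IsPT

/-! ### Folds over lists -/

theorem foldlM_nil (s : Val → Val → PMF Val) (a : Val) : [].foldlM s a = PMF.pure a := rfl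

theorem foldlM_cons (s : Val → Val → PMF Val) (a x : Val) (l : List Val) :
    (x :: l).foldlM s a = (s a x).bind fun b => l.foldlM s b := rfl

-- The state of the loop is `node list (node accumulator environment)`.
theorem LoopRuns.foldlM {c b : Prog} {s : Val → Val → PMF Val} {v : Val} {I : Val → Val → Prop}
    {Q : ℕ} (h_size : ∀ xs a, I xs a → (Val.node xs (.node a v)).size ≤ Q)
    (hc : ∀ xs a, I xs a → Runs c (.node xs (.node a v)) (PMF.pure xs) Q)
    (hb : ∀ x xs a, I (.node x xs) a → Runs b (.node (.node x xs) (.node a v))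
      ((s a x).bind fun r => PMF.pure (.node xs (.node r v))) Q)
    (h_step : ∀ x xs a, I (.node x xs) a → ∀ r ∈ (s a x).support, I xs r)
    {xs a : Val} (h : I xs a) :
    LoopRuns c b (.node xs (.node a v))
      ((xs.toList.foldlM s a).map fun r => .node .nil (.node r v)) (xs.size * (3 * Q)) := by
  induction xs generalizing a with
  | nil =>
    have := h_size _ _ h
    rw [Val.toList, foldlM_nil, PMF.pure_map]
    refine (LoopRuns.halt (hc _ _ h) rfl).mono ?_
    simp only [Val.size] at *
    omega
  | node x xs _ ih =>
    have := h_size _ _ h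
    have h_rest : ∀ e ∈ ((s a x).bind fun r => PMF.pure (.node xs (.node r v))).support,
        LoopRuns c b e ((e.hd.toList.foldlM s e.tl.hd).map fun r => .node .nil (.node r v))
          (xs.size * (3 * Q)) := fun e he => by
      obtain ⟨r, hr, he⟩ := (PMF.mem_support_bind_iff _ _ _).1 he
      obtain rfl := (PMF.mem_support_pure_iff _ _).1 he
      exact ih (h_step _ _ _ h r hr)
    have h_loop := LoopRuns.step (hc _ _ h) rfl (hb _ _ _ h) h_rest
    simp only [PMF.bind_bind, PMF.pure_bind, Val.hd, Val.tl] at h_loop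
    rw [Val.toList, foldlM_cons, PMF.map_bind]
    refine h_loop.mono ?_
    simp only [Val.size] at *
    nlinarith [Nat.zero_le (x.size * Q)]

theorem IsPPT.foldlM_of_invariant {s : Val → Val → Val → PMF Val} {l a : Val → Val}
    (hs : IsPPT fun e => s e.hd e.tl.hd e.tl.tl) (hl : IsPT l) (ha : IsPT a)
    (I : Val → Val → Val → Prop) (N : Polynomial ℕ)
    (h_size : ∀ v xs a, I v xs a → (Val.node xs (.node a v)).size ≤ N.eval v.size)
    (h_init : ∀ v, I v (l v) (a v))
    (h_step : ∀ v x xs a, I v (.node x xs) a → ∀ r ∈ (s v a x).support, I v xs r) :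
    IsPPT fun v => (l v).toList.foldlM (s v) (a v) := by
  have h_body : IsPPT fun e => (s e.tl.tl e.tl.hd e.hd.hd).bind fun r =>
      PMF.pure (.node e.hd.tl (.node r e.tl.tl)) :=
    bind (comp (h := fun e => .node e.tl.tl (.node e.tl.hd e.hd.hd)) hs (by fun_prop))
      (show IsPT fun e => .node e.tl.hd.tl (.node e.hd e.tl.tl.tl) by fun_prop)
  obtain ⟨ql, hql⟩ := hl.exists_size_le
  obtain ⟨pc, qc, hpc⟩ : IsPT fun e => e.hd := by fun_prop
  obtain ⟨pb, qb, hpb⟩ := h_body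
  obtain ⟨pi, qi, hpi⟩ : IsPT fun v => .node (l v) (.node (a v) v) := by fun_prop
  let Q : Polynomial ℕ := N + qc.comp N + qb.comp N
  have h_loop (v : Val) := LoopRuns.foldlM (Q := Q.eval v.size)
    (fun xs w h => (h_size v xs w h).trans (by simp [Q]; omega))
    (fun xs w h => (hpc _).mono
      ((polynomial_eval_mono qc (h_size v xs w h)).trans (by simp [Q]; omega)))
    (fun x xs w h => (hpb _).mono
      ((polynomial_eval_mono qb (h_size v _ w h)).trans (by simp [Q])))
    (h_step v) (h_init v)
  have h_fold : IsPPT fun v => ((l v).toList.foldlM (s v) (a v)).map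
      fun r => .node .nil (.node r v) := by
    refine ⟨.seq pi (.loop pc pb), qi + ql * (3 * Q), fun v => ?_⟩
    simpa using (hpi v).seq_pure ((h_loop v).runs.mono (Nat.mul_le_mul_right _ (hql v)))
  simpa [PMF.bind_map, Function.comp_def, Val.hd, Val.tl] using
    h_fold.bind (κ := fun _ e => PMF.pure e.tl.hd) (show IsPT fun e => e.hd.tl.hd by fun_prop)

theorem IsPPT.foldlM {s : Val → Val → Val → PMF Val} {l a : Val → Val}
    (hs : IsPPT fun e => s e.hd e.tl.hd e.tl.tl) (hl : IsPT l) (ha : IsPT a)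
    (hB : ∃ B : Polynomial ℕ, ∀ v, ∀ x ∈ (l v).toList, ∀ a, ∀ w ∈ (s v a x).support,
      w.size ≤ a.size + B.eval v.size) :
    IsPPT fun v => (l v).toList.foldlM (s v) (a v) := by
  obtain ⟨B, hB⟩ := hB
  obtain ⟨ql, hql⟩ := hl.exists_size_le
  obtain ⟨qa, hqa⟩ := ha.exists_size_le
  -- The accumulator and what the rest of the list can add to it stay within the initial budget.
  refine foldlM_of_invariant hs hl ha (fun v xs w => (∀ x ∈ xs.toList, x ∈ (l v).toList) ∧
    xs.size ≤ ql.eval v.size ∧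
    w.size + xs.size * B.eval v.size ≤ qa.eval v.size + ql.eval v.size * B.eval v.size)
    (ql + qa + ql * B + .X + 2) ?_ ?_ ?_
  · rintro v xs w ⟨-, h_xs, h_w⟩
    simp only [Val.size, Polynomial.eval_add, Polynomial.eval_mul, Polynomial.eval_X,
      Polynomial.eval_ofNat]
    linarith [Nat.zero_le (xs.size * B.eval v.size)]
  · exact fun v => ⟨fun _ => id, hql v, add_le_add (hqa v) (Nat.mul_le_mul_right _ (hql v))⟩
  · rintro v x xs w ⟨h_mem, h_xs, h_w⟩ r hr
    have := hB v x (h_mem x (by simp [Val.toList])) w r hr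
    simp only [Val.size] at h_xs h_w
    exact ⟨fun y hy => h_mem y (List.mem_cons_of_mem _ hy), by omega,
      by nlinarith [Nat.zero_le (x.size * B.eval v.size)]⟩

theorem IsPT.foldl {s : Val → Val → Val → Val} {l a : Val → Val}
    (hs : IsPT fun e => s e.hd e.tl.hd e.tl.tl) (hl : IsPT l) (ha : IsPT a)
    (hB : ∃ B : Polynomial ℕ, ∀ v, ∀ x ∈ (l v).toList, ∀ a,
      (s v a x).size ≤ a.size + B.eval v.size) :
    IsPT fun v => (l v).toList.foldl (s v) (a v) := by
  obtain ⟨B, hB⟩ := hB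
  have h := IsPPT.foldlM (s := fun v a x => PMF.pure (s v a x)) hs hl ha
    ⟨B, fun v x hx a w hw => (PMF.mem_support_pure_iff _ _).1 hw ▸ hB v x hx a⟩
  have h_pure (v) : (l v).toList.foldlM (fun a x => PMF.pure (s v a x)) (a v) =
      PMF.pure ((l v).toList.foldl (s v) (a v)) := List.foldlM_pure
  simpa only [IsPT, h_pure] using h

/-! ### Lists -/

namespace Val

/-- Reversal of the list that a datum represents. -/
def reverse (v : Val) : Val := v.toList.foldl (fun a x => .node x a) .nil

/-- Concatenation of lists; for unary numbers this is addition. -/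
def append (a b : Val) : Val := a.toList.foldr .node b

/-- The image of a list under a function. -/
def map (f : Val → Val) (v : Val) : Val := v.toList.foldr (fun x a => .node (f x) a) .nil

/-- The concatenation of the lists that a function assigns to the elements of a list. -/
def flatMap (f : Val → Val) (v : Val) : Val := v.toList.foldr (fun x a => (f x).append a) .nil

/-- The list `v` without its first elements, as many as `n` has. -/
def drop (v n : Val) : Val := n.toList.foldl (fun a _ => a.tl) v

/-- The element of `v` at the position given by the length of `n`. -/
def get (v n : Val) : Val := (v.drop n).hd

/-- The length of a list, as a unary number. -/
def length (v : Val) : Val := v.map fun _ => .nil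

/-- The unary numbers below the length of a list. -/
def range (v : Val) : Val :=
  v.toList.foldr (fun _ a => .node (v.length.drop a).tl a) .nil

/-- The list of the values of a function at the unary numbers below the length of `n`. -/
def tabulate (n : Val) (f : Val → Val) : Val := n.range.map f

theorem toList_injective : Function.Injective toList := fun v => by
  induction v with
  | nil => rintro (_ | _) <;> simp [toList]
  | node x v _ ih =>
    intro w h
    cases w with
    | nil => simp [toList] at h
    | node y w =>
      simp only [toList, List.cons.injEq] at h
      rw [h.1, ih h.2]

@[simp]
theorem toList_reverse (v : Val) : v.reverse.toList = v.toList.reverse := by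
  have h (l : List Val) (a : Val) :
      (l.foldl (fun a x => node x a) a).toList = l.reverse ++ a.toList := by
    induction l generalizing a <;> simp_all [toList]
  simp [reverse, h, toList]

@[simp]
theorem toList_append (a b : Val) : (a.append b).toList = a.toList ++ b.toList := by
  unfold append
  induction a.toList <;> simp_all [toList]

@[simp]
theorem toList_map (f : Val → Val) (v : Val) : (v.map f).toList = v.toList.map f := by
  unfold map
  induction v.toList <;> simp_all [toList]

@[simp]
theorem toList_flatMap (f : Val → Val) (v : Val) :
    (v.flatMap f).toList = v.toList.flatMap fun x => (f x).toList := by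
  unfold flatMap
  induction v.toList <;> simp_all [toList]

@[simp]
theorem toList_drop (v n : Val) : (v.drop n).toList = v.toList.drop n.toList.length := by
  unfold drop
  induction n.toList generalizing v with
  | nil => simp
  | cons x l ih =>
    have h_tl : v.tl.toList = v.toList.tail := by cases v <;> rfl
    simp [ih, h_tl]

theorem size_append_le (a b : Val) : (a.append b).size ≤ a.size + b.size := by
  unfold append
  induction a with
  | nil => simp [toList]
  | node x a _ ih => simp only [toList, List.foldr_cons, size] at *; omega

end Val

/-! ### Encodings -/

@[simp]
theorem toList_encList {α : Type} (e : α → Val) (l : List α) :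
    (encList e l).toList = l.map e := by
  induction l <;> simp_all [encList, Val.toList]

@[simp]
theorem toList_encBits (l : List Bool) : (encBits l).toList = l.map encBool := toList_encList _ _

@[simp]
theorem toList_encSeq {α : Type} {n : ℕ} (e : α → Val) (f : Fin n → α) :
    (encSeq e f).toList = List.ofFn fun i => e (f i) := by
  simp [encSeq, List.map_ofFn, Function.comp_def]

@[simp]
theorem toList_encNat (n : ℕ) : (encNat n).toList = List.replicate n .nil := by
  induction n <;> simp_all [encNat, Val.toList, List.replicate_succ]

theorem size_encNat (n : ℕ) : (encNat n).size = 2 * n + 1 := by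
  induction n with
  | zero => rfl
  | succ n ih => simp only [encNat, Val.size, ih]; omega

theorem size_encList_le {α : Type} {e : α → Val} {l : List α} {B : ℕ}
    (h : ∀ x ∈ l, (e x).size ≤ B) : (encList e l).size ≤ 1 + l.length * (1 + B) := by
  induction l with
  | nil => simp [encList, Val.size]
  | cons x l ih =>
    have := h x (by simp)
    have := ih fun y hy => h y (by simp [hy])
    simp only [encList, Val.size, List.length_cons]
    nlinarith

theorem size_encBits_le (l : List Bool) : (encBits l).size ≤ 1 + l.length * 4 :=
  size_encList_le (B := 3) fun b _ => by cases b <;> simp [encBool, Val.size]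

theorem length_le_size_encBits (l : List Bool) : l.length ≤ (encBits l).size := by
  simpa using (encBits l).length_toList_le

theorem append_encBits (a b : List Bool) :
    (encBits a).append (encBits b) = encBits (a ++ b) :=
  Val.toList_injective (by simp)

theorem flatMap_encSeq {α : Type} {n : ℕ} (e : α → Val) (f : Fin n → α) {g : Val → Val}
    {h : α → List Bool} (hg : ∀ a, g (e a) = encBits (h a)) :
    (encSeq e f).flatMap g = encBits (List.ofFn fun i => h (f i)).flatten :=
  Val.toList_injective <| by
    simp [List.flatMap_def, List.map_ofFn, Function.comp_def, hg, List.map_flatten]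

namespace Val

theorem get_encSeq {α : Type} {n : ℕ} (e : α → Val) (f : Fin n → α) {v : Val} (i : Fin n)
    (hv : v.toList.length = i) : (encSeq e f).get v = e (f i) := by
  have h_hd (w : Val) : w.hd = w.toList.headD .nil := by cases w <;> rfl
  rw [get, h_hd, toList_drop, toList_encSeq, hv, List.headD_eq_head?_getD, List.head?_drop]
  simp

theorem length_eq (v : Val) : v.length = encNat v.toList.length :=
  toList_injective (by simp [length])

theorem drop_encNat (n : ℕ) (v : Val) : (encNat n).drop v = encNat (n - v.toList.length) :=
  toList_injective (by simp)

theorem range_eq (v : Val) : v.range = encList encNat (List.range v.toList.length) := by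
  have h (l : List Val) (hl : l.length ≤ v.toList.length) :
      l.foldr (fun _ a => .node (v.length.drop a).tl a) .nil =
        encList encNat (List.range' (v.toList.length - l.length) l.length) := by
    induction l with
    | nil => rfl
    | cons x l ih =>
      simp only [List.length_cons] at hl ⊢
      obtain ⟨m, hm⟩ := Nat.exists_eq_add_of_le hl
      rw [List.foldr_cons, ih (by omega), length_eq, drop_encNat, toList_encList,
        List.length_map, List.length_range', List.range'_succ, encList, hm,
        show l.length + 1 + m - l.length = m + 1 by omega,
        show l.length + 1 + m - (l.length + 1) = m by omega]
      rfl
  rw [range, h _ le_rfl, Nat.sub_self, List.range_eq_range']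

theorem tabulate_eq_encSeq {α : Type} {m : ℕ} {e : α → Val} {g : Fin m → α} {f : Val → Val}
    {n : Val} (hn : n.toList.length = m) (hf : ∀ i : Fin m, f (encNat i) = e (g i)) :
    n.tabulate f = encSeq e g :=
  toList_injective <| by
    rw [tabulate, range_eq, hn, toList_map, toList_encList, toList_encSeq, List.map_map,
      ← List.map_coe_finRange_eq_range, List.map_map, List.ofFn_eq_map]
    exact List.map_congr_left fun i _ => hf i

end Val

namespace IsPT

variable {f : Val → Val → Val} {a b l n : Val → Val}

theorem exists_mem_size_le (hl : IsPT l) :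
    ∃ q : Polynomial ℕ, ∀ v, ∀ x ∈ (l v).toList, x.size ≤ q.eval v.size := by
  obtain ⟨q, hq⟩ := hl.exists_size_le
  exact ⟨q, fun v x hx => (Val.size_le_of_mem_toList hx).trans (hq v)⟩

theorem exists_apply_size_le (hf : IsPT fun e => f e.hd e.tl) (hl : IsPT l) :
    ∃ q : Polynomial ℕ, ∀ v, ∀ x ∈ (l v).toList, (f v x).size ≤ q.eval v.size := by
  obtain ⟨q, hq⟩ := hl.exists_mem_size_le
  obtain ⟨qf, hqf⟩ := hf.exists_size_le
  refine ⟨qf.comp (1 + .X + q), fun v x hx => (hqf (.node v x)).trans ?_⟩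
  rw [Polynomial.eval_comp]
  refine polynomial_eval_mono qf ?_
  have := hq v x hx
  simp only [Val.size, Polynomial.eval_add, Polynomial.eval_one, Polynomial.eval_X]
  omega

@[fun_prop]
theorem reverse (hl : IsPT l) : IsPT fun v => (l v).reverse := by
  obtain ⟨q, hq⟩ := hl.exists_mem_size_le
  refine IsPT.foldl (s := fun _ a x => .node x a) (by fun_prop) hl (const .nil)
    ⟨q + 1, fun v x hx a => ?_⟩
  have := hq v x hx
  simp only [Val.size, Polynomial.eval_add, Polynomial.eval_one]
  omega

theorem foldr {s : Val → Val → Val → Val} (hs : IsPT fun e => s e.hd e.tl.hd e.tl.tl)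
    (hl : IsPT l) (ha : IsPT a)
    (hB : ∃ B : Polynomial ℕ, ∀ v, ∀ x ∈ (l v).toList, ∀ a,
      (s v x a).size ≤ a.size + B.eval v.size) :
    IsPT fun v => (l v).toList.foldr (s v) (a v) := by
  have h_swap : IsPT fun e => s e.hd e.tl.tl e.tl.hd :=
    comp (g := fun e => .node e.hd (.node e.tl.tl e.tl.hd)) hs (by fun_prop)
  simpa [List.foldl_reverse] using
    IsPT.foldl (s := fun v a x => s v x a) h_swap hl.reverse ha (by simpa using hB)

@[fun_prop]
theorem append (ha : IsPT a) (hb : IsPT b) : IsPT fun v => (a v).append (b v) := by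
  obtain ⟨q, hq⟩ := ha.exists_mem_size_le
  refine foldr (s := fun _ => .node) (by fun_prop) ha hb ⟨q + 1, fun v x hx a => ?_⟩
  have := hq v x hx
  simp only [Val.size, Polynomial.eval_add, Polynomial.eval_one]
  omega

theorem map (hf : IsPT fun e => f e.hd e.tl) (hl : IsPT l) : IsPT fun v => (l v).map (f v) := by
  obtain ⟨q, hq⟩ := hf.exists_apply_size_le hl
  have h_apply : IsPT fun e => f e.hd e.tl.hd :=
    comp (g := fun e => .node e.hd e.tl.hd) hf (by fun_prop)
  refine foldr (s := fun v x a => .node (f v x) a) (h_apply.node id.tl.tl) hl (const .nil)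
    ⟨q + 1, fun v x hx a => ?_⟩
  have := hq v x hx
  simp only [Val.size, Polynomial.eval_add, Polynomial.eval_one]
  omega

theorem flatMap (hf : IsPT fun e => f e.hd e.tl) (hl : IsPT l) :
    IsPT fun v => (l v).flatMap (f v) := by
  obtain ⟨q, hq⟩ := hf.exists_apply_size_le hl
  have h_apply : IsPT fun e => f e.hd e.tl.hd :=
    comp (g := fun e => .node e.hd e.tl.hd) hf (by fun_prop)
  refine foldr (s := fun v x a => (f v x).append a) (h_apply.append id.tl.tl) hl (const .nil)
    ⟨q, fun v x hx a => ?_⟩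
  have := hq v x hx
  have := Val.size_append_le (f v x) a
  omega

@[fun_prop]
theorem drop (ha : IsPT a) (hn : IsPT n) : IsPT fun v => (a v).drop (n v) :=
  IsPT.foldl (s := fun _ a _ => a.tl) (by fun_prop) hn ha
    ⟨0, fun _ _ _ a => by simpa using a.size_tl_le⟩

@[fun_prop]
theorem get (ha : IsPT a) (hn : IsPT n) : IsPT fun v => (a v).get (n v) := (ha.drop hn).hd

@[fun_prop]
theorem length (hl : IsPT l) : IsPT fun v => (l v).length := map (const _) hl

@[fun_prop]
theorem range (hl : IsPT l) : IsPT fun v => (l v).range := by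
  obtain ⟨q, hq⟩ := hl.length.exists_size_le
  have : IsPT fun e => l e.hd := hl.comp id.hd
  refine foldr (s := fun v _ a => .node ((l v).length.drop a).tl a) (by fun_prop) hl
    (const .nil) ⟨q + 1, fun v x _ a => ?_⟩
  have h_drop : ((l v).length.drop a).size ≤ (l v).length.size := by
    simp only [Val.length_eq, Val.drop_encNat, size_encNat]
    omega
  have := (Val.size_tl_le _).trans (h_drop.trans (hq v))
  simp only [Val.size, Polynomial.eval_add, Polynomial.eval_one]
  omega

theorem tabulate (hn : IsPT n) (hf : IsPT fun e => f e.hd e.tl) :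
    IsPT fun v => (n v).tabulate (f v) := map hf hn.range

end IsPT

/-! ### Linear algebra over the field with two elements -/

/-- The encoding of an element of `F_2` as a bit. -/
def encF₂ (a : ZMod 2) : Val := encBool (decide (a = 1))

namespace Val

/-- Addition in `F_2`. -/
def bitXor (a b : Val) : Val :=
  if a.isTrue then (if b.isTrue then .nil else .node .nil .nil)
  else (if b.isTrue then .node .nil .nil else .nil)

/-- Multiplication in `F_2`. -/
def bitAnd (a b : Val) : Val :=
  if a.isTrue then (if b.isTrue then .node .nil .nil else .nil) else .nil

/-- The sum of a list of elements of `F_2`. -/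
def parity (v : Val) : Val := v.toList.foldr bitXor .nil

/-- Addition of two vectors, over the coordinates of the first one. -/
def xor (a b : Val) : Val := a.tabulate fun i => (a.get i).bitXor (b.get i)

/-- The product of the matrix with the entries `M i j` and the vector `x`, where the rows are
indexed by the unary numbers below the length of `n`. -/
def mulVec (n : Val) (M : Val → Val → Val) (x : Val) : Val :=
  n.tabulate fun i => (x.tabulate fun j => (M i j).bitAnd (x.get j)).parity

/-- The cyclic shift of a vector. -/
def rot (a r : Val) : Val := a.tabulate fun i => (a.append a).get ((a.drop r).length.append i)

/-- The product of the matrix `[I A]`, where `A` is the circulant matrix of `a`, and the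
vector `u`. -/
def mulQC (a u : Val) : Val := (a.mulVec (fun i j => (a.rot j).get i) (u.drop a)).xor u

/-- The product of the square matrix with the list `m` of entries and the vector `x`. -/
def permute (m x : Val) : Val :=
  x.mulVec (fun i j => m.get ((i.flatMap fun _ => x).append j)) x

theorem bitXor_encF₂ (a b : ZMod 2) : (encF₂ a).bitXor (encF₂ b) = encF₂ (a + b) := by
  fin_cases a <;> fin_cases b <;> rfl

theorem bitAnd_encF₂ (a b : ZMod 2) : (encF₂ a).bitAnd (encF₂ b) = encF₂ (a * b) := by
  fin_cases a <;> fin_cases b <;> rfl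

theorem size_bitXor_le (a b : Val) : (a.bitXor b).size ≤ 3 := by
  unfold bitXor
  split <;> split <;> simp [size]

theorem parity_encSeq {n : ℕ} (x : Fin n → ZMod 2) :
    (encSeq encF₂ x).parity = encF₂ (∑ i, x i) := by
  have h (l : List (ZMod 2)) : (l.map encF₂).foldr bitXor .nil = encF₂ l.sum := by
    induction l with
    | nil => rfl
    | cons a l ih => rw [List.map_cons, List.foldr_cons, ih, bitXor_encF₂, List.sum_cons]
  rw [parity, encSeq, toList_encList, h, List.sum_ofFn]

theorem xor_encSeq {m n : ℕ} (h : m ≤ n) (x : Fin m → ZMod 2) (y : Fin n → ZMod 2) :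
    (encSeq encF₂ x).xor (encSeq encF₂ y) = encSeq encF₂ fun i => x i + y (i.castLE h) :=
  tabulate_eq_encSeq (by simp) fun i => by
    rw [get_encSeq _ _ i (by simp), get_encSeq _ _ (i.castLE h) (by simp), bitXor_encF₂]

theorem mulVec_encSeq {m n : ℕ} {v : Val} {M : Val → Val → Val}
    (A : Matrix (Fin m) (Fin n) (ZMod 2)) (x : Fin n → ZMod 2) (hv : v.toList.length = m)
    (hM : ∀ (i : Fin m) (j : Fin n), M (encNat i) (encNat j) = encF₂ (A i j)) :
    v.mulVec M (encSeq encF₂ x) = encSeq encF₂ (A.mulVec x) :=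
  tabulate_eq_encSeq hv fun i => by
    rw [tabulate_eq_encSeq (e := encF₂) (g := fun j => A i j * x j) (by simp) fun j => by
      rw [get_encSeq _ _ j (by simp), hM, bitAnd_encF₂], parity_encSeq]
    rfl

theorem append_encSeq {m n : ℕ} {α : Type} (e : α → Val) (x : Fin m → α) (y : Fin n → α) :
    (encSeq e x).append (encSeq e y) = encSeq e (Fin.append x y) :=
  toList_injective (by simp only [encSeq, toList_append, toList_encList, List.ofFn_fin_append,
    List.map_append])

theorem rot_encSeq {k : ℕ} (r : Fin k) (y : Vec k) :
    (encSeq encF₂ y).rot (encNat r) = encSeq encF₂ (QCStern.rot r y) :=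
  tabulate_eq_encSeq (by simp) fun i => by
    have h_lt : k - r + i < k + k := by omega
    rw [append_encSeq, get_encSeq _ _ ⟨k - r + i, h_lt⟩ (by simp [length_eq]), QCStern.rot]
    congr 1
    by_cases h : (k - r + i : ℕ) < k
    · exact (Fin.append_left y y ⟨_, h⟩).trans (congrArg y (Fin.ext (by
        simp [Fin.sub_def, Nat.mod_eq_of_lt h])))
    · obtain ⟨m, hm⟩ := Nat.exists_eq_add_of_le (not_lt.1 h)
      have h_lt : m < k := by omega
      have h_nat : (⟨k - r + i, by omega⟩ : Fin (k + k)) = Fin.natAdd k ⟨m, h_lt⟩ := Fin.ext hm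
      rw [h_nat, Fin.append_right]
      exact congrArg y (Fin.ext (by simp [Fin.sub_def, hm, Nat.mod_eq_of_lt h_lt]))

theorem drop_encSeq {m n : ℕ} {α : Type} (e : α → Val) (x : Fin m → α) (y : Fin n → α) (v : Val)
    (hv : v.toList.length = m) : ((encSeq e (Fin.append x y)).drop v) = encSeq e y :=
  toList_injective (by
    rw [← append_encSeq, toList_drop, toList_append, hv, List.drop_left' (by simp)])

end Val

theorem encBits_vecBits {k : ℕ} (y : Vec k) : encBits (vecBits y) = encSeq encF₂ y :=
  Val.toList_injective (by simp [vecBits, List.map_ofFn, Function.comp_def, encF₂])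

theorem comp_finSumFinEquiv_symm {α : Type} {m n : ℕ} (f : Fin m ⊕ Fin n → α) :
    f ∘ finSumFinEquiv.symm = Fin.append (fun i => f (.inl i)) fun i => f (.inr i) :=
  funext <| Fin.addCases (by simp) (by simp)

theorem encBits_vecBits₂ {k : ℕ} (x : Vec₂ k) :
    encBits (vecBits₂ x) = encSeq encF₂ (x ∘ finSumFinEquiv.symm) := by
  rw [comp_finSumFinEquiv_symm, ← Val.append_encSeq, vecBits₂, ← append_encBits,
    encBits_vecBits, encBits_vecBits]

theorem permBits_eq {k : ℕ} (π : Equiv.Perm (Pos k)) :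
    permBits π = List.ofFn fun m : Fin ((k + k) * (k + k)) =>
      decide (π (finSumFinEquiv.symm (finProdFinEquiv.symm m).2) =
        finSumFinEquiv.symm (finProdFinEquiv.symm m).1) := by
  have h_append {α : Type} (f : Pos k → α) : (List.ofFn fun i => f (.inl i)) ++
      (List.ofFn fun i => f (.inr i)) = List.ofFn fun i => f (finSumFinEquiv.symm i) := by
    rw [← List.ofFn_fin_append, ← comp_finSumFinEquiv_symm]
    rfl
  have h_index (i j : Fin (k + k)) (h : (i * (k + k) + j : ℕ) < (k + k) * (k + k)) :
      ⟨i * (k + k) + j, h⟩ = finProdFinEquiv (i, j) :=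
    Fin.ext (by simp [add_comm, mul_comm])
  simp only [permBits, List.ofFn_mul, h_index, Equiv.symm_apply_apply, ← List.flatten_append]
  have h_row (i : Pos k) := h_append fun j => decide (π j = i)
  simp only [h_row]
  rw [h_append fun i => List.ofFn fun j => decide (π (finSumFinEquiv.symm j) = i)]

theorem get_permBits {k : ℕ} (π : Equiv.Perm (Pos k)) (i j : Fin (k + k)) {v : Val}
    (hv : v.toList.length = i * (k + k) + j) : (encBits (permBits π)).get v =
      encBool (decide (π (finSumFinEquiv.symm j) = finSumFinEquiv.symm i)) := by
  rw [permBits_eq, encBits, ← encSeq, Val.get_encSeq _ _ (finProdFinEquiv (i, j))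
    (by simp [hv, add_comm, mul_comm]), Equiv.symm_apply_apply]

theorem xor_vecBits {k : ℕ} (y y' : Vec k) :
    (encBits (vecBits y)).xor (encBits (vecBits y')) = encBits (vecBits (y + y')) := by
  simp only [encBits_vecBits, Val.xor_encSeq le_rfl]
  rfl

theorem xor_vecBits₂ {k : ℕ} (x x' : Vec₂ k) :
    (encBits (vecBits₂ x)).xor (encBits (vecBits₂ x')) = encBits (vecBits₂ (x + x')) := by
  simp only [encBits_vecBits₂, Val.xor_encSeq le_rfl]
  rfl

theorem rot_vecBits {k : ℕ} (r : Fin k) (y : Vec k) :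
    (encBits (vecBits y)).rot (encNat r) = encBits (vecBits (rot r y)) := by
  simp only [encBits_vecBits, Val.rot_encSeq]

theorem mulQC_vecBits {k : ℕ} (a : Vec k) (u : Vec₂ k) :
    (encBits (vecBits a)).mulQC (encBits (vecBits₂ u)) =
      encBits (vecBits ((qcMatrix a).mulVec u)) := by
  have h_drop : (encBits (vecBits₂ u)).drop (encSeq encF₂ a) =
      encSeq encF₂ (u ∘ .inr) := by
    rw [encBits_vecBits₂, comp_finSumFinEquiv_symm, Val.drop_encSeq _ _ _ _ (by simp)]
    rfl
  have h_circulant : (encSeq encF₂ a).mulVec (fun i j => ((encSeq encF₂ a).rot j).get i)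
      (encSeq encF₂ (u ∘ .inr)) = encSeq encF₂ ((Matrix.circulant a).mulVec (u ∘ .inr)) :=
    Val.mulVec_encSeq _ _ (by simp) fun i j => by
      rw [Val.rot_encSeq, Val.get_encSeq _ _ i (by simp), Matrix.circulant_apply, rot]
  rw [encBits_vecBits, Val.mulQC, h_drop, h_circulant, encBits_vecBits₂,
    Val.xor_encSeq (Nat.le_add_right k k), encBits_vecBits, qcMatrix, Matrix.fromCols_mulVec,
    Matrix.one_mulVec]
  congr 1
  funext i
  rw [add_comm]
  exact congrArg (· + _) (congrArg u (finSumFinEquiv_symm_apply_castAdd i))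

theorem permute_permBits {k : ℕ} (π : Equiv.Perm (Pos k)) (x : Vec₂ k) :
    (encBits (permBits π)).permute (encBits (vecBits₂ x)) =
      encBits (vecBits₂ (permute π x)) := by
  let A : Matrix (Fin (k + k)) (Fin (k + k)) (ZMod 2) := Matrix.of fun i j =>
    if π (finSumFinEquiv.symm j) = finSumFinEquiv.symm i then 1 else 0
  rw [encBits_vecBits₂, Val.permute, Val.mulVec_encSeq A _ (by simp) fun i j => ?_,
    encBits_vecBits₂]
  · congr 1
    funext i
    simp only [A, Matrix.mulVec, dotProduct, Matrix.of_apply, ite_mul, one_mul, zero_mul]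
    rw [Finset.sum_eq_single (finSumFinEquiv (π.symm (finSumFinEquiv.symm i)))]
    · simp [permute]
    · intro j _ hj
      rw [if_neg]
      rintro h
      exact hj (by simp [← h])
    · simp
  · rw [get_permBits π i j (by simp [List.length_flatMap])]
    simp only [A, encF₂, Matrix.of_apply]
    split <;> simp_all

theorem length_vecBits {k : ℕ} (y : Vec k) : (vecBits y).length = k := by simp [vecBits]

theorem length_vecBits₂ {k : ℕ} (x : Vec₂ k) : (vecBits₂ x).length = k + k := by
  simp [vecBits₂, vecBits]

theorem length_permBits {k : ℕ} (π : Equiv.Perm (Pos k)) :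
    (permBits π).length = (k + k) * (k + k) := by
  simp [permBits_eq]

namespace IsPT

variable {a b f g : Val → Val}

@[fun_prop]
theorem bitXor (ha : IsPT a) (hb : IsPT b) : IsPT fun v => (a v).bitXor (b v) :=
  ha.ite (hb.ite (const _) (const _)) (hb.ite (const _) (const _))

@[fun_prop]
theorem bitAnd (ha : IsPT a) (hb : IsPT b) : IsPT fun v => (a v).bitAnd (b v) :=
  ha.ite (hb.ite (const _) (const _)) (const _)

@[fun_prop]
theorem parity (ha : IsPT a) : IsPT fun v => (a v).parity :=
  foldr (s := fun _ => .bitXor) (by fun_prop) ha (const .nil)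
    ⟨3, fun _ x _ a => (Val.size_bitXor_le x a).trans (by simp)⟩

@[fun_prop]
theorem xor (ha : IsPT a) (hb : IsPT b) : IsPT fun v => (a v).xor (b v) :=
  tabulate ha (((ha.comp id.hd).get id.tl).bitXor ((hb.comp id.hd).get id.tl))

theorem mulVec {M : Val → Val → Val → Val} (ha : IsPT a)
    (hM : IsPT fun e => M e.hd.hd e.hd.tl e.tl) (hb : IsPT b) :
    IsPT fun v => (a v).mulVec (M v) (b v) := by
  have hb₁ : IsPT fun e => b e.hd := hb.comp id.hd
  have hb₂ : IsPT fun e => b e.hd.hd := hb.comp id.hd.hd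
  exact tabulate ha (tabulate hb₁ (hM.bitAnd (hb₂.get id.tl))).parity

@[fun_prop]
theorem rot (ha : IsPT a) (hb : IsPT b) : IsPT fun v => (a v).rot (b v) := by
  have ha₁ : IsPT fun e => a e.hd := ha.comp id.hd
  have hb₁ : IsPT fun e => b e.hd := hb.comp id.hd
  exact tabulate ha ((ha₁.append ha₁).get ((ha₁.drop hb₁).length.append id.tl))

@[fun_prop]
theorem mulQC (ha : IsPT a) (hb : IsPT b) : IsPT fun v => (a v).mulQC (b v) :=
  (mulVec (M := fun v i j => ((a v).rot j).get i) ha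
    (((ha.comp id.hd.hd).rot id.tl).get id.hd.tl) (hb.drop ha)).xor hb

@[fun_prop]
theorem permute (ha : IsPT a) (hb : IsPT b) : IsPT fun v => (a v).permute (b v) := by
  have hb₃ : IsPT fun e => b e.hd.hd.hd := hb.comp id.hd.hd.hd
  have h_mul : IsPT fun e => e.hd.tl.flatMap fun _ => b e.hd.hd := flatMap hb₃ id.hd.tl
  exact mulVec hb ((ha.comp id.hd.hd).get (h_mul.append id.tl)) hb

end IsPT

/-! ### Asymptotics -/

theorem Negligible.of_le {f g : ℕ → ℝ} (hg : Negligible g) (hf : ∀ l, 0 ≤ f l)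
    (h : ∀ l, f l ≤ g l) : Negligible f :=
  Asymptotics.SuperpolynomialDecay.trans_abs_le hg fun l => by
    rw [abs_of_nonneg (hf l)]
    exact (h l).trans (le_abs_self _)

theorem Negligible.polyBounded_mul {n : ℕ → ℕ} {f : ℕ → ℝ} (hf : Negligible f)
    (hn : PolyBounded n) (h_nonneg : ∀ l, 0 ≤ f l) : Negligible fun l => n l * f l := by
  obtain ⟨q, hq⟩ := hn
  have h_poly : Negligible fun l => (q.map (Nat.castRingHom ℝ)).eval (l : ℝ) * f l :=
    Asymptotics.SuperpolynomialDecay.polynomial_mul hf _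
  refine h_poly.of_le (fun l => mul_nonneg (Nat.cast_nonneg _) (h_nonneg l)) fun l => ?_
  refine mul_le_mul_of_nonneg_right ?_ (h_nonneg l)
  simpa using (Nat.cast_le (α := ℝ)).2 (hq l)

namespace PolyBounded

variable {f g : ℕ → ℕ}

theorem mono (hg : PolyBounded g) (h : ∀ l, f l ≤ g l) : PolyBounded f := by
  obtain ⟨q, hq⟩ := hg
  exact ⟨q, fun l => (h l).trans (hq l)⟩

theorem const (c : ℕ) : PolyBounded fun _ => c := ⟨.C c, fun l => by simp⟩

theorem add (hf : PolyBounded f) (hg : PolyBounded g) : PolyBounded fun l => f l + g l := by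
  obtain ⟨q, hq⟩ := hf
  obtain ⟨r, hr⟩ := hg
  exact ⟨q + r, fun l => by simpa using add_le_add (hq l) (hr l)⟩

theorem mul (hf : PolyBounded f) (hg : PolyBounded g) : PolyBounded fun l => f l * g l := by
  obtain ⟨q, hq⟩ := hf
  obtain ⟨r, hr⟩ := hg
  exact ⟨q * r, fun l => by simpa using mul_le_mul' (hq l) (hr l)⟩

end PolyBounded

/-! ### Computational indistinguishability -/

theorem summable_toReal {α : Type} (μ : PMF α) : Summable fun a => (μ a).toReal :=
  ENNReal.summable_toReal (by simp [μ.tsum_coe])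

theorem tsum_toReal {α : Type} (μ : PMF α) : ∑' a, (μ a).toReal = 1 := by
  rw [← ENNReal.tsum_toReal_eq fun a => μ.apply_ne_top a, μ.tsum_coe, ENNReal.toReal_one]

theorem toReal_bind_apply {α β : Type} (μ : PMF α) (f : α → PMF β) (b : β) :
    (μ.bind f b).toReal = ∑' a, (μ a).toReal * (f a b).toReal := by
  rw [PMF.bind_apply, ENNReal.tsum_toReal_eq fun a =>
    ENNReal.mul_ne_top (μ.apply_ne_top a) ((f a).apply_ne_top b)]
  simp only [ENNReal.toReal_mul]

theorem exists_mem_support_tsum_le {α : Type} (μ : PMF α) {h : α → ℝ}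
    (hh : Summable fun a => (μ a).toReal * h a) :
    ∃ a ∈ μ.support, ∑' a, (μ a).toReal * h a ≤ h a := by
  by_contra! h_lt
  obtain ⟨a₀, ha₀⟩ := μ.support_nonempty
  set c := ∑' a, (μ a).toReal * h a
  have h_lt' : c < ∑' a, (μ a).toReal * c := by
    refine Summable.tsum_lt_tsum (i := a₀) (fun a => ?_) ?_ hh ((summable_toReal μ).mul_right c)
    · by_cases ha : a ∈ μ.support
      · exact mul_le_mul_of_nonneg_left (h_lt a ha).le ENNReal.toReal_nonneg
      · simp [(μ.apply_eq_zero_iff a).2 ha]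
    · exact mul_lt_mul_of_pos_left (h_lt a₀ ha₀)
        (ENNReal.toReal_pos ((μ.mem_support_iff a₀).1 ha₀) (μ.apply_ne_top a₀))
  rw [tsum_mul_right, tsum_toReal, one_mul] at h_lt'
  exact h_lt'.false

theorem exists_abs_tsum_sub_tsum_le {α : Type} (μ : PMF α) {f g : α → ℝ}
    (hf : ∀ a, f a ∈ Set.Icc 0 1) (hg : ∀ a, g a ∈ Set.Icc 0 1) :
    ∃ a ∈ μ.support,
      |∑' a, (μ a).toReal * f a - ∑' a, (μ a).toReal * g a| ≤ |f a - g a| := by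
  have h_summable {h : α → ℝ} (hh : ∀ a, |h a| ≤ 1) : Summable fun a => (μ a).toReal * h a := by
    refine Summable.of_norm_bounded (summable_toReal μ) fun a => ?_
    rw [norm_mul, Real.norm_of_nonneg ENNReal.toReal_nonneg]
    exact mul_le_of_le_one_right ENNReal.toReal_nonneg (hh a)
  have h_abs {h : α → ℝ} (hh : ∀ a, h a ∈ Set.Icc 0 1) (a) : |h a| ≤ 1 :=
    abs_le.2 ⟨by linarith [(hh a).1], (hh a).2⟩
  have h_diff : Summable fun a => (μ a).toReal * (f a - g a) := h_summable fun a =>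
    abs_le.2 ⟨by linarith [(hf a).1, (hg a).2], by linarith [(hf a).2, (hg a).1]⟩
  have h_norm (a) : ‖(μ a).toReal * (f a - g a)‖ = (μ a).toReal * |f a - g a| := by
    rw [norm_mul, Real.norm_of_nonneg ENNReal.toReal_nonneg, Real.norm_eq_abs]
  obtain ⟨a, ha, hle⟩ := exists_mem_support_tsum_le μ (h := fun a => |f a - g a|)
    (h_diff.norm.congr h_norm)
  refine ⟨a, ha, le_trans ?_ hle⟩
  rw [← (h_summable (h_abs hf)).tsum_sub (h_summable (h_abs hg)), ← tsum_congr h_norm]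
  simpa only [mul_sub, Real.norm_eq_abs] using norm_tsum_le_tsum_norm h_diff.norm

theorem acceptProb_mem_Icc (D : PPT) (l : ℕ) (z : Val) (X : PMF Val) :
    acceptProb D l z X ∈ Set.Icc 0 1 :=
  ⟨ENNReal.toReal_nonneg, ENNReal.toReal_le_of_le_ofReal zero_le_one
    ((PMF.coe_le_one _ _).trans_eq ENNReal.ofReal_one.symm)⟩

theorem acceptProb_bind {α : Type} (D : PPT) (l : ℕ) (z : Val) (W : PMF α) (X : α → PMF Val) :
    acceptProb D l z (W.bind X) = ∑' w, (W w).toReal * acceptProb D l z (X w) := by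
  rw [acceptProb, PMF.bind_bind, toReal_bind_apply]
  rfl

namespace CompIndist

variable {X Y Z : ℕ → PMF Val}

theorem symm (h : CompIndist X Y) : CompIndist Y X := fun D z hz => by
  simpa only [abs_sub_comm] using h D z hz

theorem trans (h : CompIndist X Y) (h' : CompIndist Y Z) : CompIndist X Z := fun D z hz =>
  Negligible.of_le (Asymptotics.SuperpolynomialDecay.add (h D z hz) (h' D z hz))
    (fun _ => abs_nonneg _) fun _ => abs_sub_le _ _ _

/-- The component on which a distinguisher for the mixtures is best serves as a fixed choice,
since indistinguishability is non-uniform. -/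
theorem bind {α : ℕ → Type} {W : ∀ l, PMF (α l)} {X Y : ∀ l, α l → PMF Val}
    (h : ∀ w : ∀ l, α l, (∀ l, w l ∈ (W l).support) →
      CompIndist (fun l => X l (w l)) fun l => Y l (w l)) :
    CompIndist (fun l => (W l).bind (X l)) fun l => (W l).bind (Y l) := by
  intro D z hz
  choose w hw hle using fun l => exists_abs_tsum_sub_tsum_le (W l)
    (fun a => acceptProb_mem_Icc D l (z l) (X l a))
    (fun a => acceptProb_mem_Icc D l (z l) (Y l a))
  refine Negligible.of_le (h w hw D z hz) (fun _ => abs_nonneg _) fun l => ?_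
  simpa only [acceptProb_bind] using hle l

theorem process (h : CompIndist X Y) {F : Val → PMF Val} (hF : IsPPT F) {z : ℕ → Val}
    (hz : PolyBounded fun l => (z l).size) :
    CompIndist (fun l => (X l).bind fun x => F (.node (encNat l) (.node (z l) x)))
      fun l => (Y l).bind fun x => F (.node (encNat l) (.node (z l) x)) := by
  intro D z' hz'
  have hD : IsPPT fun v => (F (.node v.hd (.node v.tl.hd.tl v.tl.tl))).bind fun y =>
      D.eval (.node v.hd (.node v.tl.hd.hd y)) :=
    (hF.comp (by fun_prop)).bind
      (IsPPT.comp (h := fun e => .node e.tl.hd (.node e.tl.tl.hd.hd e.hd)) D.isPPT (by fun_prop))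
  obtain ⟨A, hA⟩ := hD.exists_ppt
  have h_accept (l : ℕ) (W : PMF Val) : acceptProb A l (.node (z' l) (z l)) W =
      acceptProb D l (z' l) (W.bind fun x => F (.node (encNat l) (.node (z l) x))) := by
    simp only [acceptProb, PPT.guess, hA, Val.hd, Val.tl, PMF.bind_bind, PMF.map_bind]
  simp only [← h_accept]
  exact h A _ (((PolyBounded.const 1).add hz').add hz)

end CompIndist

/-- The distribution of commitments to the message `m`. -/
noncomputable def CommitmentScheme.commitment (COM : CommitmentScheme) (l : ℕ) (m : List Bool) :
    PMF Val :=
  (PMF.uniformOfFintype (COM.Coins l)).map fun ρ => encBits (COM.commit l m ρ)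

theorem CommitmentScheme.hidingExperiment_true (COM : CommitmentScheme) (A : PPT) (l : ℕ)
    (z : Val) (m₀ m₁ : List Bool) :
    (COM.hidingExperiment A l z m₀ m₁ true).toReal = 1 / 2 +
      (acceptProb A l z (COM.commitment l m₁) - acceptProb A l z (COM.commitment l m₀)) / 2 := by
  let G (m : List Bool) : PMF Bool :=
    (COM.commitment l m).bind fun c => A.guess (.node (encNat l) (.node z c))
  have h_experiment : COM.hidingExperiment A l z m₀ m₁ = (PMF.uniformOfFintype Bool).bind
      fun b => (G (if b then m₁ else m₀)).bind fun b' => PMF.pure (b == b') := by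
    simp only [G, commitment, PMF.bind_map, PMF.bind_bind]
    rfl
  have h_false (μ : PMF Bool) : (μ false).toReal = 1 - (μ true).toReal := by
    have := tsum_toReal μ
    rw [tsum_bool] at this
    linarith
  have h_accept (m : List Bool) : acceptProb A l z (COM.commitment l m) = (G m true).toReal := rfl
  rw [h_experiment, h_accept, h_accept]
  simp only [toReal_bind_apply, tsum_bool]
  simp [PMF.pure_apply, h_false (G m₀)]
  ring

theorem CommitmentScheme.Hiding.compIndist {COM : CommitmentScheme} (h : COM.Hiding)
    {m₀ m₁ : ℕ → List Bool} (hm : PolyBounded fun l => (m₀ l).length)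
    (h_length : ∀ l, (m₀ l).length = (m₁ l).length) :
    CompIndist (fun l => COM.commitment l (m₀ l)) fun l => COM.commitment l (m₁ l) := by
  intro D z hz
  refine (Asymptotics.SuperpolynomialDecay.mul_const (h D z m₀ m₁ hz hm h_length) 2).congr
    fun l => ?_
  rw [CommitmentScheme.hidingAdvantage, COM.hidingExperiment_true, add_sub_cancel_left, abs_div,
    abs_two, div_mul_cancel₀ _ two_ne_zero, abs_sub_comm]

/-! ### Independent samples -/

/-- A list of `n` independent samples. -/
noncomputable def iid {α : Type} (μ : PMF α) : ℕ → PMF (List α)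
  | 0 => PMF.pure []
  | n + 1 => μ.bind fun a => (iid μ n).map fun l => a :: l

section iid

variable {α : Type} (μ : PMF α)

theorem iid_succ_append (n : ℕ) :
    iid μ (n + 1) = (iid μ n).bind fun l => μ.map fun a => l ++ [a] := by
  induction n with
  | zero => simp [iid, PMF.pure_bind, PMF.map, Function.comp_def]
  | succ n ih =>
    conv_lhs => rw [iid, ih]
    simp only [iid, PMF.map_bind, PMF.map_comp, PMF.bind_bind, PMF.bind_map, Function.comp_def,
      List.cons_append]

theorem iid_map {β : Type} (f : α → β) (n : ℕ) : iid (μ.map f) n = (iid μ n).map (List.map f) := by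
  induction n with
  | zero => simp [iid, PMF.pure_map]
  | succ n ih =>
    simp only [iid, ih, PMF.bind_map, PMF.map_bind, PMF.map_comp, Function.comp_def,
      List.map_cons]

variable {μ}

theorem length_eq_and_forall_of_mem_support_iid {n : ℕ} {l : List α} (h : l ∈ (iid μ n).support) :
    l.length = n ∧ ∀ a ∈ l, a ∈ μ.support := by
  induction n generalizing l with
  | zero =>
    obtain rfl := (PMF.mem_support_pure_iff _ _).1 h
    simp
  | succ n ih =>
    simp only [iid, PMF.mem_support_bind_iff, PMF.mem_support_map_iff] at h
    obtain ⟨a, ha, l', hl', rfl⟩ := h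
    exact ⟨by simp [ih hl'], List.forall_mem_cons.2 ⟨ha, (ih hl').2⟩⟩

end iid

/-- All samples have polynomial size. -/
def PolySized (X : ℕ → PMF Val) : Prop :=
  ∃ B : ℕ → ℕ, PolyBounded B ∧ ∀ l, ∀ x ∈ (X l).support, x.size ≤ B l

/-- The encoded list of `i` samples of `μ` followed by `m` samples of `ν`. -/
noncomputable def hybrid (μ ν : PMF Val) (i m : ℕ) : PMF Val :=
  (iid μ i).bind fun p => (iid ν m).map fun s => encList id (p ++ s)

/-- The encoded list of `i` samples of `μ`, a sample of `ξ` and `m` samples of `ν`, seen as a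
mixture over all but the sample of `ξ`. -/
noncomputable def hybridAt (μ ν : PMF Val) (i m : ℕ) (ξ : PMF Val) : PMF Val :=
  ((iid μ i).bind fun p => (iid ν m).map fun s => (p, s)).bind fun c =>
    ξ.map fun x => encList id (c.1 ++ x :: c.2)

section hybrid

variable (μ ν : PMF Val) (n i m : ℕ)

theorem hybrid_zero_left : hybrid μ ν 0 n = (iid ν n).map (encList id) := by
  simp [hybrid, iid, PMF.pure_bind]

theorem hybrid_zero_right : hybrid μ ν n 0 = (iid μ n).map (encList id) := by
  simp [hybrid, iid, PMF.map, Function.comp_def]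

theorem hybrid_succ_right : hybrid μ ν i (m + 1) = hybridAt μ ν i m ν := by
  simp only [hybrid, hybridAt, iid, PMF.bind_bind, PMF.bind_map, PMF.map_bind, PMF.map_comp,
    Function.comp_def]
  exact congrArg (PMF.bind _) (funext fun p => PMF.bind_comm _ _ _)

theorem hybrid_succ_left : hybrid μ ν (i + 1) m = hybridAt μ ν i m μ := by
  simp only [hybrid, hybridAt, iid_succ_append, PMF.bind_bind, PMF.bind_map,
    Function.comp_def, List.append_assoc, List.singleton_append]
  exact congrArg (PMF.bind _) (funext fun p => PMF.bind_comm _ _ _)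

end hybrid

theorem size_encList_id_le_of_mem_support_iid {μ : PMF Val} {n B : ℕ} {l : List Val}
    (hμ : ∀ x ∈ μ.support, x.size ≤ B) (hl : l ∈ (iid μ n).support) :
    (encList id l).size ≤ 1 + n * (1 + B) := by
  obtain ⟨rfl, h_mem⟩ := length_eq_and_forall_of_mem_support_iid hl
  exact size_encList_le fun x hx => hμ x (h_mem x hx)

theorem exists_abs_sub_le_mul_abs_sub_succ (g : ℕ → ℝ) (n : ℕ) :
    ∃ i ≤ n - 1, |g 0 - g n| ≤ n * |g i - g (i + 1)| := by
  rcases n.eq_zero_or_pos with rfl | hn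
  · exact ⟨0, by simp⟩
  have h_sum : ∑ _i ∈ Finset.range n, |g 0 - g n| / n ≤
      ∑ i ∈ Finset.range n, |g i - g (i + 1)| := by
    rw [Finset.sum_const, Finset.card_range, nsmul_eq_mul,
      mul_div_cancel₀ _ (by positivity), ← Finset.sum_range_sub']
    exact Finset.abs_sum_le_sum_abs _ _
  obtain ⟨i, hi, hle⟩ := Finset.exists_le_of_sum_le (Finset.nonempty_range_iff.2 hn.ne') h_sum
  exact ⟨i, Nat.le_sub_one_of_lt (Finset.mem_range.1 hi), (div_le_iff₀' (by positivity)).1 hle⟩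

namespace CompIndist

variable {X Y : ℕ → PMF Val}

theorem hybridAt (h : CompIndist X Y) {μ ν : ℕ → PMF Val} (hμ : PolySized μ) (hν : PolySized ν)
    {i m : ℕ → ℕ} (hi : PolyBounded i) (hm : PolyBounded m) :
    CompIndist (fun l => hybridAt (μ l) (ν l) (i l) (m l) (X l))
      fun l => QCStern.hybridAt (μ l) (ν l) (i l) (m l) (Y l) := by
  obtain ⟨B, hB, hμB⟩ := hμ
  obtain ⟨C, hC, hνC⟩ := hν
  refine CompIndist.bind fun c hc => ?_
  have hF : IsPT fun v => v.tl.hd.hd.append (.node v.tl.tl v.tl.hd.tl) := by fun_prop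
  have hz : PolyBounded fun l =>
      (Val.node (encList id (c l).1) (encList id (c l).2)).size := by
    refine (((PolyBounded.const 1).add ((PolyBounded.const 1).add
      (hi.mul ((PolyBounded.const 1).add hB)))).add ((PolyBounded.const 1).add
      (hm.mul ((PolyBounded.const 1).add hC)))).mono fun l => ?_
    obtain ⟨p, hp, hps⟩ := (PMF.mem_support_bind_iff _ _ _).1 (hc l)
    obtain ⟨s, hs, hps⟩ := (PMF.mem_support_map_iff _ _ _).1 hps
    rw [← hps]
    exact add_le_add (add_le_add le_rfl (size_encList_id_le_of_mem_support_iid (hμB l) hp))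
      (size_encList_id_le_of_mem_support_iid (hνC l) hs)
  have h_append (p s : List Val) (x : Val) :
      (encList id p).append (.node x (encList id s)) = encList id (p ++ x :: s) :=
    Val.toList_injective (by simp [Val.toList])
  simpa only [Val.hd, Val.tl, h_append] using! h.process hF hz

theorem iid (h : CompIndist X Y) (hX : PolySized X) (hY : PolySized Y) {n : ℕ → ℕ}
    (hn : PolyBounded n) :
    CompIndist (fun l => (iid (X l) (n l)).map (encList id))
      fun l => (QCStern.iid (Y l) (n l)).map (encList id) := by
  intro D z hz
  choose i hi hle using fun l => exists_abs_sub_le_mul_abs_sub_succ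
    (fun i => acceptProb D l (z l) (hybrid (Y l) (X l) i (n l - i))) (n l)
  have h_step := h.hybridAt hY hX (hn.mono fun l => (hi l).trans (Nat.sub_le _ _))
    (hn.mono (f := fun l => n l - i l - 1) fun l => by omega) D z hz
  refine Negligible.of_le (h_step.polyBounded_mul hn fun _ => abs_nonneg _)
    (fun _ => abs_nonneg _) fun l => ?_
  have h_le := hle l
  rw [Nat.sub_zero, Nat.sub_self, hybrid_zero_left, hybrid_zero_right] at h_le
  rcases Nat.eq_zero_or_pos (n l) with h_zero | h_pos
  · simpa [h_zero] using h_le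
  · obtain ⟨m, hm⟩ : ∃ m, n l - i l = m + 1 := ⟨n l - i l - 1, by have := hi l; omega⟩
    rw [← Nat.sub_sub, hm, Nat.add_sub_cancel, hybrid_succ_right, hybrid_succ_left] at h_le
    simpa only [hm, Nat.add_sub_cancel] using h_le

end CompIndist

/-! ### Uniform distributions -/

section uniform

variable {A B : Type} [Fintype A] [Nonempty A] [Fintype B] [Nonempty B]

theorem uniform_map_equiv (e : A ≃ B) :
    (PMF.uniformOfFintype A).map e = PMF.uniformOfFintype B := by
  ext b
  rw [PMF.map_apply, tsum_eq_single (e.symm b)]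
  · simp [Fintype.card_congr e]
  · intro a ha
    exact if_neg fun h => ha (by simp [h])

variable (A B) in
theorem uniform_prod : PMF.uniformOfFintype (A × B) =
    (PMF.uniformOfFintype A).bind fun a => (PMF.uniformOfFintype B).map fun b => (a, b) := by
  ext ⟨a, b⟩
  rw [PMF.bind_apply, tsum_eq_single a, PMF.map_apply, tsum_eq_single b]
  · simp only [PMF.uniformOfFintype_apply, Fintype.card_prod, Nat.cast_mul, if_true]
    rw [ENNReal.mul_inv (by simp) (by simp)]
  · intro b' hb
    simp [hb.symm]
  · intro a' ha
    simp [PMF.map_apply, ha.symm]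

variable (A) in
theorem uniform_pi_map_ofFn (n : ℕ) :
    (PMF.uniformOfFintype (Fin n → A)).map List.ofFn = iid (PMF.uniformOfFintype A) n := by
  induction n with
  | zero =>
    have h_nil : (List.ofFn : (Fin 0 → A) → List A) = Function.const _ [] := by
      funext f
      simp
    rw [h_nil, PMF.map_const, iid]
  | succ n ih =>
    rw [iid, ← ih, ← uniform_map_equiv (Fin.consEquiv fun _ : Fin (n + 1) => A), uniform_prod]
    simp only [PMF.map_bind, PMF.map_comp, Function.comp_def]
    simp [Fin.consEquiv]

theorem iid_uniform_map_encList (e : A → Val) (n : ℕ) :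
    (iid ((PMF.uniformOfFintype A).map e) n).map (encList id) =
      (PMF.uniformOfFintype (Fin n → A)).map (encSeq e) := by
  rw [iid_map, ← uniform_pi_map_ofFn, PMF.map_comp, PMF.map_comp]
  congr 1
  funext a
  exact Val.toList_injective (by simp [Function.comp_def])

end uniform

theorem CompIndist.uniform_of_forall {α β γ : ℕ → Type} [∀ l, Finite (α l)]
    [∀ l, Nonempty (α l)] [∀ l, Fintype (β l)] [∀ l, Nonempty (β l)] [∀ l, Fintype (γ l)]
    [∀ l, Nonempty (γ l)] (e : ∀ l, α l × β l ≃ γ l) {X Y : ∀ l, γ l → Val}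
    (h : ∀ a : ∀ l, α l,
      CompIndist (fun l => (PMF.uniformOfFintype (β l)).map fun b => X l (e l (a l, b)))
        fun l => (PMF.uniformOfFintype (β l)).map fun b => Y l (e l (a l, b))) :
    CompIndist (fun l => (PMF.uniformOfFintype (γ l)).map (X l))
      fun l => (PMF.uniformOfFintype (γ l)).map (Y l) := by
  have (l : ℕ) : Fintype (α l) := .ofFinite _
  have h_split (Z : ∀ l, γ l → Val) (l : ℕ) : (PMF.uniformOfFintype (γ l)).map (Z l) =
      (PMF.uniformOfFintype (α l)).bind fun a =>
        (PMF.uniformOfFintype (β l)).map fun b => Z l (e l (a, b)) := by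
    rw [← uniform_map_equiv (e l), uniform_prod]
    simp only [PMF.map_bind, PMF.map_comp, Function.comp_def]
  simp only [h_split]
  exact CompIndist.bind fun a _ => h a

theorem CompIndist.of_forall_bool {X Y : ℕ → Bool → PMF Val}
    (h : ∀ b, CompIndist (fun l => X l b) fun l => Y l b) (b : ℕ → Bool) :
    CompIndist (fun l => X l (b l)) fun l => Y l (b l) := by
  intro D z hz
  refine Negligible.of_le (Asymptotics.SuperpolynomialDecay.add (h false D z hz) (h true D z hz))
    (fun _ => abs_nonneg _) fun l => ?_
  rcases hb : b l <;> simp [hb]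

/-! ### Sampling programs -/

theorem pickElem_encSeq {A : Type} {n : ℕ} [NeZero n] (e : A → Val) (g : Fin n → A) :
    pickElem (encSeq e g) = (PMF.uniformOfFintype (Fin n)).map (e ∘ g) := by
  have h_toList : (encSeq e g).toList = List.ofFn (e ∘ g) := by
    simp [Function.comp_def]
  cases h : encSeq e g with
  | nil => simp [h, Val.toList, NeZero.ne n] at h_toList
  | node a b =>
    rw [h, Val.toList] at h_toList
    have h_length : b.toList.length + 1 = n := by
      simpa using congrArg List.length h_toList
    rw [pickElem, ← uniform_map_equiv (finCongr h_length), PMF.map_comp]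
    congr 1
    funext i
    simp [List.getElem_of_eq h_toList]
    rfl

theorem uniform_fin_map_encNat (n : ℕ) [NeZero n] :
    (PMF.uniformOfFintype (Fin n)).map (fun i : Fin n => encNat (i : ℕ)) =
      pickElem (encNat n).range := by
  have h_range : (encNat n).range = encSeq (fun i : Fin n => encNat (i : ℕ)) id :=
    Val.toList_injective (List.ext_getElem (by simp [Val.range_eq]) (by simp [Val.range_eq]))
  rw [h_range, pickElem_encSeq]
  rfl

theorem uniform_bool_map_encBool :
    (PMF.uniformOfFintype Bool).map encBool = pickElem (encList encBool [false, true]) := by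
  have := pickElem_encSeq encBool finTwoEquiv
  rw [← PMF.map_comp, uniform_map_equiv] at this
  exact this.symm

theorem foldlM_eq_iid (μ : PMF Val) (l acc : List Val) :
    l.foldlM (fun a _ => μ.map fun b => .node b a) (encList id acc) =
      (iid μ l.length).map fun s => encList id (s ++ acc) := by
  induction l generalizing acc with
  | nil => rw [foldlM_nil, List.length_nil, iid, PMF.pure_map, List.nil_append]
  | cons x l ih =>
    have h_rest (b : Val) : l.foldlM (fun a _ => μ.map fun b => .node b a)
        (.node b (encList id acc)) = (iid μ l.length).map fun s => encList id (s ++ b :: acc) :=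
      ih (b :: acc)
    simp only [foldlM_cons, PMF.bind_map, Function.comp_def, h_rest, List.length_cons,
      iid_succ_append, PMF.map_bind, PMF.map_comp, List.append_assoc, List.singleton_append]
    exact PMF.bind_comm _ _ _

theorem IsPPT.iid {μ : Val → PMF Val} {n : Val → Val} (hμ : IsPPT μ) (hn : IsPT n) :
    IsPPT fun v => (iid (μ v) (n v).toList.length).map (encList id) := by
  obtain ⟨q, hq⟩ := hμ.exists_size_le
  have h_step : IsPPT fun e => (μ e.hd).bind fun b => PMF.pure (.node b e.tl.hd) :=
    (hμ.comp (by fun_prop)).bind (κ := fun e b => PMF.pure (.node b e.tl.hd))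
      (show IsPT fun e => .node e.hd e.tl.tl.hd by fun_prop)
  have h_fold := IsPPT.foldlM (s := fun v a _ => (μ v).map fun b => .node b a) (a := fun _ => .nil)
    h_step hn (IsPT.const _) ⟨q + 1, fun v x _ a w hw => by
      obtain ⟨b, hb, rfl⟩ := (PMF.mem_support_map_iff _ _ _).1 hw
      have := hq v b hb
      simp only [Val.size, Polynomial.eval_add, Polynomial.eval_one]
      omega⟩
  have h_iid (v : Val) := foldlM_eq_iid (μ v) (n v).toList []
  simp only [List.append_nil] at h_iid
  simpa only [← h_iid] using! h_fold

/-! ### Polynomial time classes of families -/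

/-- The random data `X i` are produced from the data `env i` in polynomial time. -/
def IsPPTOn {ι : Type} (env : ι → Val) (X : ι → PMF Val) : Prop :=
  ∃ f, IsPPT f ∧ ∀ i, f (env i) = X i

/-- A class of families of data that contains the constant families and is closed under pairing
and under deterministic polynomial time algorithms. It is used for the families computable from
the input of the simulator, those computable from a sample with advice, and those of polynomial
size. -/
structure PTClass (ι : Type) where
  Mem : (ι → Val) → Prop
  const_mem : ∀ w, Mem fun _ => w
  node_mem : ∀ {x y : ι → Val}, Mem x → Mem y → Mem fun i => .node (x i) (y i)
  eval_mem : ∀ {f : Val → PMF Val} {x y : ι → Val}, IsPPT f → (∀ i, f (x i) = PMF.pure (y i)) →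
    Mem x → Mem y

namespace PTClass

/-- The families of data that are computed from the data `env i` in polynomial time. -/
def ofEnv {ι : Type} (env : ι → Val) : PTClass ι where
  Mem x := IsPPTOn env fun i => PMF.pure (x i)
  const_mem w := ⟨_, IsPT.const w, fun _ => rfl⟩
  node_mem := by
    rintro x y ⟨f, hf, hfx⟩ ⟨g, hg, hgy⟩
    refine ⟨_, hf.bind (κ := fun v a => (g v).bind fun b => PMF.pure (.node a b))
      ((hg.comp (by fun_prop)).bind (κ := fun e b => PMF.pure (.node e.hd b))
        (show IsPT fun e => .node e.tl.hd e.hd by fun_prop)), fun i => ?_⟩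
    rw [hfx, PMF.pure_bind, hgy, PMF.pure_bind]
  eval_mem := by
    rintro g x y hg hgy ⟨f, hf, hfx⟩
    refine ⟨_, hf.bind (κ := fun _ => g) (hg.comp (by fun_prop)), fun i => ?_⟩
    rw [hfx, PMF.pure_bind, hgy]

theorem env_mem_ofEnv {ι : Type} (env : ι → Val) : (ofEnv env).Mem env :=
  ⟨_, IsPT.id, fun _ => rfl⟩

/-- The families of data whose size is polynomial in `l i`. -/
def polySized {ι : Type} (l : ι → ℕ) : PTClass ι where
  Mem x := ∃ q : Polynomial ℕ, ∀ i, (x i).size ≤ q.eval (l i)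
  const_mem w := ⟨.C w.size, fun i => by simp⟩
  node_mem := by
    rintro x y ⟨q, hq⟩ ⟨q', hq'⟩
    refine ⟨1 + q + q', fun i => ?_⟩
    simpa [Val.size] using add_le_add (Nat.add_le_add_left (hq i) 1) (hq' i)
  eval_mem := by
    rintro f x y hf hfy ⟨q, hq⟩
    obtain ⟨q', hq'⟩ := hf.exists_size_le
    refine ⟨q'.comp q, fun i => ?_⟩
    rw [Polynomial.eval_comp]
    exact (hq' (x i) (y i) (by simp [hfy])).trans (polynomial_eval_mono q' (hq i))

/-- The families of data that are computed in polynomial time from the data `e l a`, the security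
parameter `l` and an advice of polynomial size that depends on `l` only. -/
def withAdvice {α : ℕ → Type} (e : ∀ l, α l → Val) : PTClass (Σ l, α l) where
  Mem x := ∃ z : ℕ → Val, (polySized id).Mem z ∧
    (ofEnv fun i : Σ l, α l => .node (encNat i.1) (.node (z i.1) (e i.1 i.2))).Mem x
  const_mem w := ⟨_, const_mem _ .nil, const_mem _ w⟩
  node_mem := by
    rintro x y ⟨z, hz, f, hf, hfx⟩ ⟨z', hz', f', hf', hfy⟩
    refine ⟨_, node_mem _ hz hz', node_mem _
      ⟨_, hf.comp (h := fun v => .node v.hd (.node v.tl.hd.hd v.tl.tl)) (by fun_prop), hfx⟩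
      ⟨_, hf'.comp (h := fun v => .node v.hd (.node v.tl.hd.tl v.tl.tl)) (by fun_prop), hfy⟩⟩
  eval_mem := by
    rintro f x y hf hfy ⟨z, hz, hx⟩
    exact ⟨z, hz, eval_mem _ hf hfy hx⟩

section withAdvice

variable {α : ℕ → Type} (e : ∀ l, α l → Val)

theorem input_mem_withAdvice : (withAdvice e).Mem fun i => e i.1 i.2 :=
  ⟨_, const_mem _ .nil, _, show IsPT fun v => v.tl.tl by fun_prop, fun _ => rfl⟩

theorem encNat_mem_withAdvice : (withAdvice e).Mem fun i => encNat i.1 :=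
  ⟨_, const_mem _ .nil, _, show IsPT fun v => v.hd by fun_prop, fun _ => rfl⟩

theorem advice_mem_withAdvice {z : ℕ → Val} (hz : (polySized id).Mem z) :
    (withAdvice e).Mem fun i => z i.1 :=
  ⟨z, hz, _, show IsPT fun v => v.tl.hd by fun_prop, fun _ => rfl⟩

end withAdvice

namespace Mem

variable {ι : Type} {K : PTClass ι} {x : ι → Val}

theorem comp (hx : K.Mem x) {f : Val → Val} (hf : IsPT f) : K.Mem fun i => f (x i) :=
  K.eval_mem hf (fun _ => rfl) hx

theorem reindex {κ : Type} {env y : κ → Val} (hy : (ofEnv env).Mem y) (j : ι → κ)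
    (h_env : K.Mem fun i => env (j i)) : K.Mem fun i => y (j i) := by
  obtain ⟨f, hf, hfy⟩ := hy
  exact K.eval_mem hf (fun i => hfy (j i)) h_env

theorem hd (hx : K.Mem x) : K.Mem fun i => (x i).hd := hx.comp (by fun_prop)

theorem tl (hx : K.Mem x) : K.Mem fun i => (x i).tl := hx.comp (by fun_prop)

theorem comp₂ {y : ι → Val} (hx : K.Mem x) (hy : K.Mem y) {f : Val → Val → Val}
    (hf : IsPT fun e => f e.hd e.tl) : K.Mem fun i => f (x i) (y i) :=
  (K.node_mem hx hy).comp hf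

theorem append {a b : ι → List Bool} (ha : K.Mem fun i => encBits (a i))
    (hb : K.Mem fun i => encBits (b i)) : K.Mem fun i => encBits (a i ++ b i) := by
  simpa only [append_encBits] using ha.comp₂ hb (f := Val.append) (by fun_prop)

section vectors

variable {k : ι → ℕ} {y y' : ∀ i, Vec (k i)} {u u' : ∀ i, Vec₂ (k i)}

theorem vec_add (hy : K.Mem fun i => encBits (vecBits (y i)))
    (hy' : K.Mem fun i => encBits (vecBits (y' i))) :
    K.Mem fun i => encBits (vecBits (y i + y' i)) := by
  simpa only [xor_vecBits] using hy.comp₂ hy' (f := Val.xor) (by fun_prop)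

theorem vec₂_add (hu : K.Mem fun i => encBits (vecBits₂ (u i)))
    (hu' : K.Mem fun i => encBits (vecBits₂ (u' i))) :
    K.Mem fun i => encBits (vecBits₂ (u i + u' i)) := by
  simpa only [xor_vecBits₂] using hu.comp₂ hu' (f := Val.xor) (by fun_prop)

protected theorem rot (hy : K.Mem fun i => encBits (vecBits (y i))) {r : ∀ i, Fin (k i)}
    (hr : K.Mem fun i => encNat (r i)) : K.Mem fun i => encBits (vecBits (rot (r i) (y i))) := by
  simpa only [rot_vecBits] using hy.comp₂ hr (f := Val.rot) (by fun_prop)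

theorem qcMatrix_mulVec (hy : K.Mem fun i => encBits (vecBits (y i)))
    (hu : K.Mem fun i => encBits (vecBits₂ (u i))) :
    K.Mem fun i => encBits (vecBits ((qcMatrix (y i)).mulVec (u i))) := by
  simpa only [mulQC_vecBits] using hy.comp₂ hu (f := Val.mulQC) (by fun_prop)

protected theorem permute {π : ∀ i, Equiv.Perm (Pos (k i))}
    (hπ : K.Mem fun i => encBits (permBits (π i)))
    (hu : K.Mem fun i => encBits (vecBits₂ (u i))) :
    K.Mem fun i => encBits (vecBits₂ (permute (π i) (u i))) := by
  simpa only [permute_permBits] using hπ.comp₂ hu (f := Val.permute) (by fun_prop)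

end vectors

section sequences

variable {n : ι → ℕ} {A : ι → Type} {e : ∀ i, A i → Val} {a : ∀ i, Fin (n i) → A i}

theorem encSeq_apply (ha : K.Mem fun i => encSeq (e i) (a i)) {j : ∀ i, Fin (n i)}
    (hj : K.Mem fun i => encNat (j i)) : K.Mem fun i => e i (a i (j i)) := by
  have h_get (i : ι) := Val.get_encSeq (e i) (a i) (j i) (v := encNat (j i)) (by simp)
  simpa only [h_get] using ha.comp₂ hj (f := Val.get) (by fun_prop)

theorem encSeq_map (ha : K.Mem fun i => encSeq (e i) (a i)) {B : ι → Type} {e' : ∀ i, B i → Val}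
    {g : Val → Val} (hg : IsPT g) {f : ∀ i, A i → B i} (hgf : ∀ i a, g (e i a) = e' i (f i a)) :
    K.Mem fun i => encSeq (e' i) fun j => f i (a i j) := by
  have h_map (i : ι) : (encSeq (e i) (a i)).map g = encSeq (e' i) fun j => f i (a i j) :=
    Val.toList_injective (by simp [Function.comp_def, hgf])
  simpa only [h_map] using ha.comp (IsPT.map (f := fun _ => g) (hg.comp (by fun_prop)) IsPT.id)

theorem flatten_ofFn (ha : K.Mem fun i => encSeq (e i) (a i)) {g : Val → Val} (hg : IsPT g)
    {f : ∀ i, A i → List Bool} (hgf : ∀ i a, g (e i a) = encBits (f i a)) :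
    K.Mem fun i => encBits (List.ofFn fun j => f i (a i j)).flatten := by
  simpa only [flatMap_encSeq _ _ (hgf _)] using
    ha.comp (IsPT.flatMap (f := fun _ => g) (hg.comp (by fun_prop)) IsPT.id)

end sequences

end Mem

/-! ### Polynomial size -/

section polySized

variable {ι : Type} {l : ι → ℕ}

theorem encNat_mem_polySized : (polySized l).Mem fun i => encNat (l i) :=
  ⟨2 * .X + 1, fun i => by simp [size_encNat]⟩

theorem encBool_mem_polySized (b : ι → Bool) : (polySized l).Mem fun i => encBool (b i) := by
  have size_encBool_le : ∀ c, (encBool c).size ≤ 3 := by decide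
  exact ⟨3, fun i => by simpa using size_encBool_le (b i)⟩

theorem Mem.exists_le {n : ι → ℕ} (hn : (polySized l).Mem fun i => encNat (n i)) :
    ∃ q : Polynomial ℕ, ∀ i, n i ≤ q.eval (l i) := by
  obtain ⟨q, hq⟩ := hn
  exact ⟨q, fun i => le_trans (by rw [size_encNat]; omega) (hq i)⟩

theorem Mem.encNat_of_le {m n : ι → ℕ} (hn : (polySized l).Mem fun i => encNat (n i))
    (h : ∀ i, m i ≤ n i) : (polySized l).Mem fun i => encNat (m i) := by
  obtain ⟨q, hq⟩ := hn.exists_le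
  exact ⟨2 * q + 1, fun i => by simpa [size_encNat] using (h i).trans (hq i)⟩

theorem Mem.encBits_of_length_le {n : ι → ℕ} (hn : (polySized l).Mem fun i => encNat (n i))
    (q : Polynomial ℕ) {b : ι → List Bool} (hb : ∀ i, (b i).length ≤ q.eval (n i)) :
    (polySized l).Mem fun i => encBits (b i) := by
  obtain ⟨q', hq'⟩ := hn.exists_le
  refine ⟨1 + q.comp q' * 4, fun i => (size_encBits_le _).trans ?_⟩
  have := (hb i).trans (polynomial_eval_mono q (hq' i))
  simpa using this

protected theorem Mem.encFixed {n : ι → ℕ} (hn : (polySized l).Mem fun i => encNat (n i))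
    (b : ∀ i, Bits (n i)) : (polySized l).Mem fun i => encFixed (b i) :=
  hn.encBits_of_length_le .X (b := fun i => List.ofFn (b i)) fun i => by simp

protected theorem Mem.encSeq {n : ι → ℕ} (hn : (polySized l).Mem fun i => encNat (n i))
    {A : ι → Type} {e : ∀ i, A i → Val} {a : ∀ i, Fin (n i) → A i}
    (ha : (polySized fun i : Σ i, Fin (n i) => l i.1).Mem fun i => e i.1 (a i.1 i.2)) :
    (polySized l).Mem fun i => encSeq (e i) (a i) := by
  obtain ⟨q, hq⟩ := hn.exists_le
  obtain ⟨q', hq'⟩ := ha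
  refine ⟨1 + q * (1 + q'), fun i => (size_encList_le (B := q'.eval (l i)) fun x hx => ?_).trans ?_⟩
  · obtain ⟨j, rfl⟩ := List.mem_ofFn.1 hx
    exact hq' ⟨i, j⟩
  · simpa using hq i

section vectors

variable {k : ι → ℕ}

protected theorem Mem.vecBits (hk : (polySized l).Mem fun i => encNat (k i)) (y : ∀ i, Vec (k i)) :
    (polySized l).Mem fun i => encBits (vecBits (y i)) :=
  hk.encBits_of_length_le .X fun i => by simp [length_vecBits]

protected theorem Mem.vecBits₂ (hk : (polySized l).Mem fun i => encNat (k i))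
    (u : ∀ i, Vec₂ (k i)) :
    (polySized l).Mem fun i => encBits (vecBits₂ (u i)) :=
  hk.encBits_of_length_le (.X + .X) fun i => by simp [length_vecBits₂]

protected theorem Mem.permBits (hk : (polySized l).Mem fun i => encNat (k i))
    (π : ∀ i, Equiv.Perm (Pos (k i))) : (polySized l).Mem fun i => encBits (permBits (π i)) :=
  hk.encBits_of_length_le ((.X + .X) * (.X + .X)) fun i => by simp [length_permBits]

end vectors

theorem polySized_uniform_map {α : ℕ → Type} [∀ l, Fintype (α l)] [∀ l, Nonempty (α l)]
    {x : (Σ l, α l) → Val} (hx : (polySized Sigma.fst).Mem x) :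
    PolySized fun l => (PMF.uniformOfFintype (α l)).map fun a => x ⟨l, a⟩ := by
  obtain ⟨q, hq⟩ := hx
  refine ⟨fun l => q.eval l, ⟨q, fun _ => le_rfl⟩, fun l w hw => ?_⟩
  obtain ⟨a, -, rfl⟩ := (PMF.mem_support_map_iff _ _ _).1 hw
  exact hq ⟨l, a⟩

end polySized

end PTClass

theorem CompIndist.map {α : ℕ → Type} {e : ∀ l, α l → Val} {x : (Σ l, α l) → Val}
    {μ ν : ∀ l, PMF (α l)} (h : CompIndist (fun l => (μ l).map (e l)) fun l => (ν l).map (e l))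
    (hx : (PTClass.withAdvice e).Mem x) :
    CompIndist (fun l => (μ l).map fun a => x ⟨l, a⟩) fun l => (ν l).map fun a => x ⟨l, a⟩ := by
  obtain ⟨z, hz, f, hf, hfx⟩ := hx
  have h_map (l : ℕ) (μ : PMF (α l)) : μ.map (fun a => x ⟨l, a⟩) =
      (μ.map (e l)).bind fun v => f (.node (encNat l) (.node (z l) v)) := by
    rw [PMF.bind_map, ← PMF.bind_pure_comp]
    exact congrArg _ (funext fun a => (hfx ⟨l, a⟩).symm)
  simp only [h_map]
  exact h.process hf hz

namespace IsPPTOn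

variable {ι : Type} {env : ι → Val} {A B : ι → Type} {e : ∀ i, A i → Val} {e' : ∀ i, B i → Val}

theorem comp {μ : Val → PMF Val} (hμ : IsPPT μ) {x : ι → Val} (hx : (PTClass.ofEnv env).Mem x) :
    IsPPTOn env fun i => μ (x i) := by
  obtain ⟨f, hf, hfx⟩ := hx
  refine ⟨_, hf.bind (κ := fun _ => μ) (hμ.comp (by fun_prop)), fun i => ?_⟩
  rw [hfx, PMF.pure_bind]

theorem map {μ : ∀ i, PMF (A i)} (hμ : IsPPTOn env fun i => (μ i).map (e i)) {x : (Σ i, A i) → Val}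
    (hx : (PTClass.ofEnv fun i : Σ i, A i => .node (env i.1) (e i.1 i.2)).Mem x) :
    IsPPTOn env fun i => (μ i).map fun a => x ⟨i, a⟩ := by
  obtain ⟨f, hf, hfμ⟩ := hμ
  obtain ⟨g, hg, hgx⟩ := hx
  refine ⟨_, hf.bind (κ := fun v a => g (.node v a))
    (hg.comp (h := fun w => .node w.tl w.hd) (by fun_prop)), fun i => ?_⟩
  rw [hfμ, PMF.bind_map]
  exact congrArg (μ i).bind (funext fun a => hgx ⟨i, a⟩)

theorem uniform_bool : IsPPTOn env fun _ => (PMF.uniformOfFintype Bool).map encBool := by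
  simpa only [uniform_bool_map_encBool] using
    comp (IsPPT.pick IsPT.id) (PTClass.const_mem _ (encList encBool [false, true]))

theorem uniform_fin {n : ι → ℕ} [∀ i, NeZero (n i)]
    (hn : (PTClass.ofEnv env).Mem fun i => encNat (n i)) :
    IsPPTOn env fun i => (PMF.uniformOfFintype (Fin (n i))).map fun j : Fin (n i) =>
      encNat (j : ℕ) := by
  simpa only [uniform_fin_map_encNat] using comp (IsPPT.pick IsPT.id.range) hn

variable [∀ i, Fintype (A i)] [∀ i, Nonempty (A i)] [∀ i, Fintype (B i)] [∀ i, Nonempty (B i)]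

theorem uniform_prod (hA : IsPPTOn env fun i => (PMF.uniformOfFintype (A i)).map (e i))
    (hB : IsPPTOn env fun i => (PMF.uniformOfFintype (B i)).map (e' i)) :
    IsPPTOn env fun i => (PMF.uniformOfFintype (A i × B i)).map fun p =>
      .node (e i p.1) (e' i p.2) := by
  obtain ⟨f, hf, hfA⟩ := hA
  obtain ⟨g, hg, hgB⟩ := hB
  refine ⟨_, hf.bind (κ := fun v a => (g v).bind fun b => PMF.pure (.node a b))
    ((hg.comp (by fun_prop)).bind (κ := fun e b => PMF.pure (.node e.hd b))
      (show IsPT fun e => .node e.tl.hd e.hd by fun_prop)), fun i => ?_⟩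
  simp only [hfA, hgB, QCStern.uniform_prod, PMF.bind_map, PMF.map_bind, PMF.map_comp,
    Function.comp_def]
  rfl

theorem uniform_pi (hA : IsPPTOn env fun i => (PMF.uniformOfFintype (A i)).map (e i)) {n : ι → ℕ}
    (hn : (PTClass.ofEnv env).Mem fun i => encNat (n i)) :
    IsPPTOn env fun i => (PMF.uniformOfFintype (Fin (n i) → A i)).map (encSeq (e i)) := by
  obtain ⟨f, hf, hfA⟩ := hA
  have h_iid := IsPPT.iid (μ := fun v => f v.hd) (n := Val.tl) (hf.comp (by fun_prop))
    (by fun_prop)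
  have h := comp h_iid (PTClass.node_mem _ (PTClass.env_mem_ofEnv env) hn)
  simpa only [Val.hd, Val.tl, hfA, toList_encNat, List.length_replicate, iid_uniform_map_encList]
    using h

theorem uniform_bits {n : ι → ℕ} (hn : (PTClass.ofEnv env).Mem fun i => encNat (n i)) :
    IsPPTOn env fun i => (PMF.uniformOfFintype (Bits (n i))).map encFixed :=
  uniform_pi uniform_bool hn

end IsPPTOn

/-! ### Iterations of the protocol -/

/-- The input of the simulator. -/
def encInput (l : ℕ) {P : Params} (pk : PublicKey P) : Val :=
  .node (encNat l) (.node (encParams P) (encPublicKey pk))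

/-- What one iteration contributes to the transcript: its challenges, its three commitments and
its response. -/
structure Iteration (COM : CommitmentScheme) (l : ℕ) (P : Params) where
  ch₁ : Fin P.s × Fin P.k
  ch₂ : Bool
  com₁ : List Bool
  com₂ : List Bool
  com₃ : List Bool
  rsp : Response COM l P

/-- Encoding of the challenges of one iteration. -/
def encChallenge {P : Params} (c : (Fin P.s × Fin P.k) × Bool) : Val :=
  .node (.node (encNat c.1.1) (encNat c.1.2)) (encBool c.2)

/-- Encoding of an iteration. -/
def encIteration {COM : CommitmentScheme} {l : ℕ} {P : Params} (t : Iteration COM l P) : Val :=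
  .node (encChallenge (t.ch₁, t.ch₂)) (.node (encBits t.com₁) (.node (encBits t.com₂)
    (.node (encBits t.com₃) (encResponse t.rsp))))

/-- The iteration with a given response, in which the verifier computes the two commitments that
it can check; for the challenge `0`, it knows the syndrome of `u` from that of the
word `u + x'`. -/
def Iteration.ofResponse {COM : CommitmentScheme} (E : SeedSampler) {l : ℕ} {P : Params}
    (pk : PublicKey P) (c : (Fin P.s × Fin P.k) × Bool) (d : Response COM l P) :
    Iteration COM l P :=
  let syndrome := (qcMatrix (E.block l P pk.1)).mulVec d.word + rot c.1.2 (pk.2 c.1.1)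
  { ch₁ := c.1
    ch₂ := c.2
    com₁ := if c.2 then d.com else
      COM.commit l (permBits (E.perm l P d.seed) ++ vecBits syndrome) d.coinsA
    com₂ := if c.2 then COM.commit l (vecBits₂ (E.vec l P d.seed)) d.coinsA else d.com
    com₃ := COM.commit l (vecBits₂ (if c.2 then E.vec l P d.seed + d.word else
      permute (E.perm l P d.seed) d.word)) d.coinsB
    rsp := d }

/-- The transcript with given iterations, where `R₁` and `R₂` are the coins of `Cmt_1`
and `Cmt_2`. -/
def Transcript.ofIterations {COM : CommitmentScheme} (Z : Compressor COM) {l : ℕ} {P : Params}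
    (R₁ R₂ : COM.Coins l) (t : Fin P.δ → Iteration COM l P) : Transcript P where
  cmt₁ := COM.commit l (List.ofFn fun i => (t i).com₁ ++ (t i).com₂).flatten R₁
  ch₁ i := (t i).ch₁
  cmt₂ := COM.commit l (List.ofFn fun i => (t i).com₃).flatten R₂
  ch₂ i := (t i).ch₂
  rsp := Z.compress l P (fun i => (t i).ch₂) ⟨R₁, R₂, fun i => (t i).rsp⟩

namespace PTClass.Mem

variable {ι : Type} {K : PTClass ι} {l : ι → ℕ} {P : ι → Params}

theorem ite {b : ι → Bool} (hb : K.Mem fun i => encBool (b i)) {A : ι → Type}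
    {e : ∀ i, A i → Val} {x y : ∀ i, A i} (hx : K.Mem fun i => e i (x i))
    (hy : K.Mem fun i => e i (y i)) : K.Mem fun i => e i (if b i then x i else y i) := by
  have h := (K.node_mem hb (K.node_mem hx hy)).comp
    (f := fun v => if v.hd.isTrue then v.tl.hd else v.tl.tl) (by fun_prop)
  convert h using 2 with i
  cases b i <;> rfl

section params

variable (hP : K.Mem fun i => encParams (P i))
include hP

theorem k : K.Mem fun i => encNat (P i).k := hP.hd

theorem δ : K.Mem fun i => encNat (P i).δ := hP.tl.tl.hd

theorem s : K.Mem fun i => encNat (P i).s := hP.tl.tl.tl.hd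

theorem seedLen : K.Mem fun i => encNat (P i).seedLen := hP.tl.tl.tl.tl.hd

end params

section sampler

variable (E : SeedSampler) (hl : K.Mem fun i => encNat (l i))
  (hP : K.Mem fun i => encParams (P i)) {θ : ∀ i, Seed (P i)} (hθ : K.Mem fun i => encFixed (θ i))
include hl hP hθ

theorem perm : K.Mem fun i => encBits (permBits (E.perm (l i) (P i) (θ i))) := by
  obtain ⟨A, hA⟩ := E.perm_polyTime
  exact K.eval_mem A.isPPT (fun i => hA _ _ _) (K.node_mem hl (K.node_mem hP hθ))

theorem vec : K.Mem fun i => encBits (vecBits₂ (E.vec (l i) (P i) (θ i))) := by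
  obtain ⟨A, hA⟩ := E.vec_polyTime
  exact K.eval_mem A.isPPT (fun i => hA _ _ _) (K.node_mem hl (K.node_mem hP hθ))

theorem block : K.Mem fun i => encBits (vecBits (E.block (l i) (P i) (θ i))) := by
  obtain ⟨A, hA⟩ := E.block_polyTime
  exact K.eval_mem A.isPPT (fun i => hA _ _ _) (K.node_mem hl (K.node_mem hP hθ))

theorem secrets : K.Mem fun i => encSeq (fun x : WeightVec (P i) => encBits (vecBits₂ x.1))
    (E.secrets (l i) (P i) (θ i)) := by
  obtain ⟨A, hA⟩ := E.secrets_polyTime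
  exact K.eval_mem A.isPPT (fun i => hA _ _ _) (K.node_mem hl (K.node_mem hP hθ))

end sampler

section commitments

variable {COM : CommitmentScheme} (hl : K.Mem fun i => encNat (l i))
include hl

theorem coinLen (COM : CommitmentScheme) : K.Mem fun i => encNat (COM.coinLen (l i)) := by
  obtain ⟨A, hA⟩ := COM.coinLen_polyTime
  exact K.eval_mem A.isPPT (fun i => hA _) hl

theorem commit {m : ι → List Bool} (hm : K.Mem fun i => encBits (m i))
    {ρ : ∀ i, COM.Coins (l i)} (hρ : K.Mem fun i => encFixed (ρ i)) :
    K.Mem fun i => encBits (COM.commit (l i) (m i) (ρ i)) := by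
  obtain ⟨A, hA⟩ := COM.commit_polyTime
  exact K.eval_mem A.isPPT (fun i => hA ⟨l i, m i, ρ i⟩) (K.node_mem hl (K.node_mem hm hρ))

theorem compress (Z : Compressor COM) (hP : K.Mem fun i => encParams (P i))
    {b : ∀ i, Challenge₂ (P i)} (hb : K.Mem fun i => encFixed (b i))
    {o : ∀ i, Opening COM (l i) (P i)} (ho : K.Mem fun i => encOpening (o i)) :
    K.Mem fun i => Z.compress (l i) (P i) (b i) (o i) := by
  obtain ⟨A, hA⟩ := Z.compress_polyTime
  exact K.eval_mem A.isPPT (fun i => hA _ _ _ _)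
    (K.node_mem hl (K.node_mem hP (K.node_mem hb ho)))

end commitments

theorem response {COM : CommitmentScheme} {θ : ∀ i, Seed (P i)}
    (hθ : K.Mem fun i => encFixed (θ i)) {w : ∀ i, Vec₂ (P i).k}
    (hw : K.Mem fun i => encBits (vecBits₂ (w i))) {c : ι → List Bool}
    (hc : K.Mem fun i => encBits (c i)) {ρ ρ' : ∀ i, COM.Coins (l i)}
    (hρ : K.Mem fun i => encFixed (ρ i)) (hρ' : K.Mem fun i => encFixed (ρ' i)) :
    K.Mem fun i => encResponse (⟨θ i, w i, c i, ρ i, ρ' i⟩ : Response COM (l i) (P i)) :=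
  K.node_mem hθ (K.node_mem hw (K.node_mem hc (K.node_mem hρ hρ')))

theorem ofResponse {COM : CommitmentScheme} (E : SeedSampler) {pk : ∀ i, PublicKey (P i)}
    (h_input : K.Mem fun i => encInput (l i) (pk i)) {c : ∀ i, (Fin (P i).s × Fin (P i).k) × Bool}
    (hc : K.Mem fun i => encChallenge (c i)) {d : ∀ i, Response COM (l i) (P i)}
    (hd : K.Mem fun i => encResponse (d i)) :
    K.Mem fun i => encIteration (Iteration.ofResponse E (pk i) (c i) (d i)) := by
  have hl : K.Mem fun i => encNat (l i) := h_input.hd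
  have hP : K.Mem fun i => encParams (P i) := h_input.tl.hd
  have h_seed : K.Mem fun i => encFixed (d i).seed := hd.hd
  have h_word : K.Mem fun i => encBits (vecBits₂ (d i).word) := hd.tl.hd
  have h_com : K.Mem fun i => encBits (d i).com := hd.tl.tl.hd
  have h_coinsA : K.Mem fun i => encFixed (d i).coinsA := hd.tl.tl.tl.hd
  have h_coinsB : K.Mem fun i => encFixed (d i).coinsB := hd.tl.tl.tl.tl
  have h_bit : K.Mem fun i => encBool (c i).2 := hc.tl
  have h_index : K.Mem fun i => encNat (c i).1.1 := hc.hd.hd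
  have h_shift : K.Mem fun i => encNat (c i).1.2 := hc.hd.tl
  have h_syndromes : K.Mem fun i => encSeq (fun y => encBits (vecBits y)) (pk i).2 :=
    h_input.tl.tl.tl
  have h_syndrome := ((block E hl hP h_input.tl.tl.hd).qcMatrix_mulVec h_word).vec_add
    ((h_syndromes.encSeq_apply h_index).rot h_shift)
  have h_perm := perm E hl hP h_seed
  have h_vec := vec E hl hP h_seed
  refine K.node_mem hc (K.node_mem ?_ (K.node_mem ?_ (K.node_mem ?_ hd)))
  · exact h_bit.ite h_com (hl.commit (h_perm.append h_syndrome) h_coinsA)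
  · exact h_bit.ite (hl.commit h_vec h_coinsA) h_com
  · exact hl.commit (h_bit.ite (e := fun _ w => encBits (vecBits₂ w)) (h_vec.vec₂_add h_word)
      (h_perm.permute h_word)) h_coinsB

theorem ofIterations {COM : CommitmentScheme} (Z : Compressor COM)
    (hl : K.Mem fun i => encNat (l i)) (hP : K.Mem fun i => encParams (P i))
    {R₁ R₂ : ∀ i, COM.Coins (l i)} (hR₁ : K.Mem fun i => encFixed (R₁ i))
    (hR₂ : K.Mem fun i => encFixed (R₂ i)) {t : ∀ i, Fin (P i).δ → Iteration COM (l i) (P i)}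
    (ht : K.Mem fun i => encSeq encIteration (t i)) :
    K.Mem fun i => encTranscript (Transcript.ofIterations Z (R₁ i) (R₂ i) (t i)) := by
  have h_coms₁₂ : K.Mem fun i =>
      encBits (List.ofFn fun j => (t i j).com₁ ++ (t i j).com₂).flatten :=
    ht.flatten_ofFn (g := fun v => v.tl.hd.append v.tl.tl.hd) (by fun_prop)
      (f := fun _ a => a.com₁ ++ a.com₂) fun i a => append_encBits _ _
  have h_coms₃ : K.Mem fun i => encBits (List.ofFn fun j => (t i j).com₃).flatten :=
    ht.flatten_ofFn (g := fun v => v.tl.tl.tl.hd) (by fun_prop) fun i a => rfl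
  have h_ch₁ : K.Mem fun i => encSeq
      (fun c : Fin (P i).s × Fin (P i).k => .node (encNat c.1) (encNat c.2))
      fun j => (t i j).ch₁ :=
    ht.encSeq_map (g := fun v => v.hd.hd) (by fun_prop) fun i a => rfl
  have h_ch₂ : K.Mem fun i => encFixed fun j => (t i j).ch₂ :=
    ht.encSeq_map (e' := fun _ => encBool) (g := fun v => v.hd.tl) (by fun_prop) fun i a => rfl
  have h_rsp : K.Mem fun i => encSeq encResponse fun j => (t i j).rsp :=
    ht.encSeq_map (g := fun v => v.tl.tl.tl.tl) (by fun_prop) fun i a => rfl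
  have h_opening : K.Mem fun i => encOpening ⟨R₁ i, R₂ i, fun j => (t i j).rsp⟩ :=
    K.node_mem hR₁ (K.node_mem hR₂ h_rsp)
  exact K.node_mem (hl.commit h_coms₁₂ hR₁) (K.node_mem h_ch₁ (K.node_mem (hl.commit h_coms₃ hR₂)
    (K.node_mem h_ch₂ (compress hl Z hP h_ch₂ h_opening))))

end PTClass.Mem

section vectors

variable {k : ℕ}

theorem permute_add (π : Equiv.Perm (Pos k)) (x y : Vec₂ k) :
    permute π (x + y) = permute π x + permute π y := rfl

theorem permute_permute_symm (π : Equiv.Perm (Pos k)) (x : Vec₂ k) :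
    permute π (permute π.symm x) = x := by
  funext i
  simp [permute]

theorem rot_add (r : Fin k) (x y : Vec k) : rot r (x + y) = rot r x + rot r y := rfl

theorem qcMatrix_mulVec_rot₂ [NeZero k] (a : Vec k) (r : Fin k) (x : Vec₂ k) :
    (qcMatrix a).mulVec (rot₂ r x) = rot r ((qcMatrix a).mulVec x) := by
  simp only [qcMatrix, Matrix.fromCols_mulVec, Matrix.one_mulVec, rot_add]
  congr 1
  funext i
  simp only [Matrix.mulVec, dotProduct, Matrix.circulant_apply, Function.comp_apply, rot₂,
    Sum.elim_inr, rot]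
  refine Fintype.sum_equiv (Equiv.subRight r) _ _ fun j => ?_
  simp only [Equiv.subRight_apply, sub_sub_sub_cancel_right]

end vectors

section protocol

variable {COM : CommitmentScheme} {E : SeedSampler} {l : ℕ} {P : Params}

/-- The randomness `(θ, ξ, ρ₁, ρ₂, ρ₃)` of the prover in one iteration: two seeds and the coins of
the three commitments. -/
abbrev ProverCoins (COM : CommitmentScheme) (l : ℕ) (P : Params) : Type :=
  Seed P × Seed P × COM.Coins l × COM.Coins l × COM.Coins l

/-- The randomness of one iteration: the challenges and the randomness of the prover. -/
abbrev IterationCoins (COM : CommitmentScheme) (l : ℕ) (P : Params) : Type :=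
  ((Fin P.s × Fin P.k) × Bool) × ProverCoins COM l P

/-- Encoding of the randomness of the prover. -/
def encProverCoins (p : ProverCoins COM l P) : Val :=
  .node (encFixed p.1) (.node (encFixed p.2.1) (.node (encFixed p.2.2.1)
    (.node (encFixed p.2.2.2.1) (encFixed p.2.2.2.2))))

/-- Encoding of the randomness of an iteration. -/
def encIterationCoins (r : IterationCoins COM l P) : Val :=
  .node (encChallenge r.1) (encProverCoins r.2)

/-- The response of the honest prover to the challenges of one iteration. -/
def honestResponse (E : SeedSampler) (sk : SecretKey P) (pk : PublicKey P)
    (r : IterationCoins COM l P) : Response COM l P :=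
  let ⟨⟨⟨s, j⟩, b⟩, θ, ξ, ρ₁, ρ₂, ρ₃⟩ := r
  let π := E.perm l P θ
  let u := permute π.symm (E.vec l P ξ)
  let x := rot₂ j (E.secrets l P sk s).1
  if b then ⟨ξ, permute π x,
    COM.commit l (permBits π ++ vecBits ((qcMatrix (E.block l P pk.1)).mulVec u)) ρ₁, ρ₂, ρ₃⟩
  else ⟨θ, u + x, COM.commit l (vecBits₂ (permute π u)) ρ₂, ρ₁, ρ₃⟩

/-- The response of the simulator, which knows the second challenge in advance. For the
challenge `0` the word is a pseudorandom vector and for the challenge `1` a pseudorandom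
permutation of a fixed word of weight `w`. The commitment that is not opened contains a message
of the right length made from the public seed. -/
def simulatedResponse (E : SeedSampler) (pk : PublicKey P) (r : IterationCoins COM l P) :
    Response COM l P :=
  let ⟨⟨_, b⟩, θ, ξ, ρ₁, ρ₂, ρ₃⟩ := r
  if b then ⟨ξ, permute (E.perm l P θ) (E.secrets l P pk.1 0).1,
    COM.commit l (permBits (E.perm l P pk.1) ++ vecBits (E.block l P pk.1)) ρ₁, ρ₂, ρ₃⟩
  else ⟨θ, E.vec l P ξ, COM.commit l (vecBits₂ (E.vec l P pk.1)) ρ₂, ρ₁, ρ₃⟩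

/-- The iteration of the honest parties that results from the randomness `r`. -/
def honestIteration (E : SeedSampler) (sk : SecretKey P) (pk : PublicKey P)
    (r : IterationCoins COM l P) : Iteration COM l P :=
  .ofResponse E pk r.1 (honestResponse E sk pk r)

/-- The iteration of the simulator that results from the randomness `r`. -/
def simulatedIteration (E : SeedSampler) (pk : PublicKey P) (r : IterationCoins COM l P) :
    Iteration COM l P :=
  .ofResponse E pk r.1 (simulatedResponse E pk r)

/-- The transcript of a run of independent iterations with uniform randomness, where `f` says how
an iteration results from its randomness. -/
noncomputable def runIterations (Z : Compressor COM)
    (f : IterationCoins COM l P → Iteration COM l P) : PMF (Transcript P) :=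
  (PMF.uniformOfFintype (COM.Coins l × COM.Coins l × (Fin P.δ → IterationCoins COM l P))).map
    fun r => .ofIterations Z r.1 r.2.1 fun i => f (r.2.2 i)

-- The syndrome that the verifier computes for the challenge `0` is `H(u + x') + Hx' = Hu`.
theorem honestIteration_eq {sk : SecretKey P} {pk : PublicKey P}
    (hpk : ∀ i, pk.2 i = (qcMatrix (E.block l P pk.1)).mulVec (E.secrets l P sk i).1)
    (s : Fin P.s) (j : Fin P.k) (b : Bool) (θ ξ : Seed P) (ρ₁ ρ₂ ρ₃ : COM.Coins l) :
    let r : IterationCoins COM l P := (((s, j), b), θ, ξ, ρ₁, ρ₂, ρ₃)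
    let π := E.perm l P θ
    let u := permute π.symm (E.vec l P ξ)
    let x := rot₂ j (E.secrets l P sk s).1
    let c₁ := COM.commit l (permBits π ++ vecBits ((qcMatrix (E.block l P pk.1)).mulVec u)) ρ₁
    let c₂ := COM.commit l (vecBits₂ (permute π u)) ρ₂
    honestIteration E sk pk r =
      { ch₁ := (s, j)
        ch₂ := b
        com₁ := c₁
        com₂ := c₂
        com₃ := COM.commit l (vecBits₂ (permute π (u + x))) ρ₃
        rsp := if b = false then ⟨θ, u + x, c₂, ρ₁, ρ₃⟩
          else ⟨ξ, permute π x, c₁, ρ₂, ρ₃⟩ } := by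
  have add_self (y : Vec P.k) : y + y = 0 := funext fun i => CharTwo.add_self_eq_zero (y i)
  cases b <;>
    simp [honestIteration, Iteration.ofResponse, honestResponse, permute_add,
      permute_permute_symm, hpk,
      Matrix.mulVec_add, qcMatrix_mulVec_rot₂, add_assoc, add_self]

variable (COM l P) in
/-- The randomness of a run, sorted by iterations or by the order in which it is drawn. -/
def runCoinsEquiv : (Fin P.δ → Seed P) × (Fin P.δ → Seed P) × (Fin P.δ → COM.Coins l) ×
    (Fin P.δ → COM.Coins l) × COM.Coins l × Challenge₁ P × (Fin P.δ → COM.Coins l) ×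
    COM.Coins l × Challenge₂ P ≃
      COM.Coins l × COM.Coins l × (Fin P.δ → IterationCoins COM l P) where
  toFun := fun ⟨θ, ξ, ρ₁, ρ₂, R₁, ch₁, ρ₃, R₂, ch₂⟩ =>
    (R₁, R₂, fun i => ((ch₁ i, ch₂ i), θ i, ξ i, ρ₁ i, ρ₂ i, ρ₃ i))
  invFun := fun ⟨R₁, R₂, r⟩ =>
    (fun i => (r i).2.1, fun i => (r i).2.2.1, fun i => (r i).2.2.2.1, fun i => (r i).2.2.2.2.1,
      R₁, fun i => (r i).1.1, fun i => (r i).2.2.2.2.2, R₂, fun i => (r i).1.2)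
  left_inv _ := rfl
  right_inv _ := rfl

theorem honestTranscript_eq_runIterations (Z : Compressor COM) {sk : SecretKey P}
    {pk : PublicKey P}
    (hpk : ∀ i, pk.2 i = (qcMatrix (E.block l P pk.1)).mulVec (E.secrets l P sk i).1) :
    honestTranscript COM E Z l P sk pk =
      runIterations (l := l) Z (honestIteration E sk pk) := by
  rw [runIterations, ← uniform_map_equiv (runCoinsEquiv COM l P)]
  simp only [uniform_prod, PMF.map_bind, PMF.map_comp, Function.comp_def, runCoinsEquiv,
    Equiv.coe_fn_mk, honestIteration_eq hpk]
  simp only [← PMF.bind_pure_comp, Function.comp_def]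
  rfl

section simulator

variable {ι : Type} {l : ι → ℕ} {P : ι → Params} {pk : ∀ i, PublicKey (P i)}

theorem PTClass.Mem.simulatedResponse {K : PTClass ι} (E : SeedSampler)
    (h_input : K.Mem fun i => encInput (l i) (pk i)) {r : ∀ i, IterationCoins COM (l i) (P i)}
    (hr : K.Mem fun i => encIterationCoins (r i)) :
    K.Mem fun i => encResponse (simulatedResponse E (pk i) (r i)) := by
  have hl : K.Mem fun i => encNat (l i) := h_input.hd
  have hP : K.Mem fun i => encParams (P i) := h_input.tl.hd
  have h_public_seed : K.Mem fun i => encFixed (pk i).1 := h_input.tl.tl.hd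
  have h_bit : K.Mem fun i => encBool (r i).1.2 := hr.hd.tl
  have hθ : K.Mem fun i => encFixed (r i).2.1 := hr.tl.hd
  have hξ : K.Mem fun i => encFixed (r i).2.2.1 := hr.tl.tl.hd
  have hρ₁ : K.Mem fun i => encFixed (r i).2.2.2.1 := hr.tl.tl.tl.hd
  have hρ₂ : K.Mem fun i => encFixed (r i).2.2.2.2.1 := hr.tl.tl.tl.tl.hd
  have hρ₃ : K.Mem fun i => encFixed (r i).2.2.2.2.2 := hr.tl.tl.tl.tl.tl
  have h_secret : K.Mem fun i => encBits (vecBits₂ (E.secrets (l i) (P i) (pk i).1 0).1) :=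
    (hl.secrets E hP h_public_seed).encSeq_apply (j := fun _ => 0) (K.const_mem .nil)
  refine h_bit.ite (e := fun _ => encResponse) ?_ ?_
  · exact hξ.response ((hl.perm E hP hθ).permute h_secret)
      (hl.commit ((hl.perm E hP h_public_seed).append (hl.block E hP h_public_seed)) hρ₁) hρ₂ hρ₃
  · exact hθ.response (hl.vec E hP hξ) (hl.commit (hl.vec E hP h_public_seed) hρ₂) hρ₁ hρ₃

end simulator

theorem isPPTOn_uniform_iterationCoins {ι : Type} {env : ι → Val} {l : ι → ℕ} {P : ι → Params}
    (hl : (PTClass.ofEnv env).Mem fun i => encNat (l i))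
    (hP : (PTClass.ofEnv env).Mem fun i => encParams (P i)) :
    IsPPTOn env fun i =>
      (PMF.uniformOfFintype (IterationCoins COM (l i) (P i))).map encIterationCoins := by
  have h_seed := IsPPTOn.uniform_bits hP.seedLen
  have h_coins := IsPPTOn.uniform_bits (hl.coinLen COM)
  exact .uniform_prod (.uniform_prod (.uniform_prod (.uniform_fin hP.s) (.uniform_fin hP.k))
    .uniform_bool) (.uniform_prod h_seed (.uniform_prod h_seed (.uniform_prod h_coins
      (.uniform_prod h_coins h_coins))))

theorem encSeq_comp {A B : Type} (e : B → Val) (f : A → B) {n : ℕ} (a : Fin n → A) :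
    encSeq (fun x => e (f x)) a = encSeq e fun i => f (a i) :=
  Val.toList_injective (by simp)

theorem IsPPTOn.runIterations (Z : Compressor COM) {ι : Type} {env : ι → Val} {l : ι → ℕ}
    {P : ι → Params} (hl : (PTClass.ofEnv env).Mem fun i => encNat (l i))
    (hP : (PTClass.ofEnv env).Mem fun i => encParams (P i))
    {f : ∀ i, IterationCoins COM (l i) (P i) → Iteration COM (l i) (P i)}
    (hf : IsPPTOn env fun i =>
      (PMF.uniformOfFintype (IterationCoins COM (l i) (P i))).map (encIteration ∘ f i)) :
    IsPPTOn env fun i => (runIterations Z (f i)).map encTranscript := by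
  have h_coins := IsPPTOn.uniform_bits (hl.coinLen COM)
  have h_run := h_coins.uniform_prod (h_coins.uniform_prod (hf.uniform_pi hP.δ))
  let env' (j : Σ i, COM.Coins (l i) × COM.Coins (l i) × (Fin (P i).δ →
      IterationCoins COM (l i) (P i))) : Val :=
    .node (env j.1) (.node (encFixed j.2.1) (.node (encFixed j.2.2.1)
      (encSeq (encIteration ∘ f j.1) j.2.2.2)))
  have h_env : (PTClass.ofEnv env').Mem env' := PTClass.env_mem_ofEnv env'
  have h_iterations : (PTClass.ofEnv env').Mem fun j =>
      encSeq encIteration fun i => f j.1 (j.2.2.2 i) := by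
    simpa only [← encSeq_comp] using! h_env.tl.tl.tl
  simpa only [QCStern.runIterations, PMF.map_comp] using! h_run.map
    (.ofIterations Z (hl.reindex Sigma.fst h_env.hd) (hP.reindex Sigma.fst h_env.hd)
      h_env.tl.hd h_env.tl.tl.hd h_iterations)

theorem isPPTOn_runIterations_simulatedIteration (E : SeedSampler) (Z : Compressor COM) :
    IsPPTOn (fun i : Σ _ : ℕ, Σ P, PublicKey P => encInput i.1 i.2.2) fun i =>
      (runIterations Z (simulatedIteration (l := i.1) E i.2.2)).map encTranscript := by
  set env := fun i : Σ _ : ℕ, Σ P, PublicKey P => encInput i.1 i.2.2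
  have h_env : (PTClass.ofEnv env).Mem env := PTClass.env_mem_ofEnv env
  have hl : (PTClass.ofEnv env).Mem fun i => encNat i.1 := h_env.hd
  have hP : (PTClass.ofEnv env).Mem fun i => encParams i.2.1 := h_env.tl.hd
  have h_node := PTClass.env_mem_ofEnv fun j : Σ i, IterationCoins COM i.1 i.2.1 =>
    .node (env j.1) (encIterationCoins j.2)
  exact .runIterations Z hl hP ((isPPTOn_uniform_iterationCoins hl hP).map
    (h_node.hd.ofResponse E h_node.tl.hd (h_node.hd.simulatedResponse E h_node.tl)))

end protocol

section vectors

variable {k : ℕ}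

theorem exists_permute_eq {x y : Vec₂ k} (h : hammingNorm x = hammingNorm y) :
    ∃ σ : Equiv.Perm (Pos k), permute σ x = y := by
  have h_card : Fintype.card {i // x i ≠ 0} = Fintype.card {i // y i ≠ 0} := by
    simpa [hammingNorm, Fintype.card_subtype] using h
  set e := Fintype.equivOfCardEq h_card
  have eq_of_ne_zero_iff : ∀ a b : ZMod 2, (a ≠ 0 ↔ b ≠ 0) → a = b := by decide
  refine ⟨e.extendSubtype, funext fun i => ?_⟩
  obtain ⟨j, rfl⟩ := e.extendSubtype.surjective i
  simp only [permute, Equiv.symm_apply_apply]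
  exact eq_of_ne_zero_iff _ _ ⟨e.extendSubtype_mem j,
    fun hj => of_not_not fun hx => e.extendSubtype_not_mem j hx hj⟩

theorem hammingNorm_rot₂ (r : Fin k) (x : Vec₂ k) : hammingNorm (rot₂ r x) = hammingNorm x := by
  have : NeZero k := ⟨(Fin.pos r).ne'⟩
  refine Finset.card_equiv ((Equiv.subRight r).sumCongr (Equiv.subRight r)) fun i => ?_
  rw [Finset.mem_filter_univ, Finset.mem_filter_univ]
  cases i <;> rfl

theorem uniform_map_permute_add (σ : Equiv.Perm (Pos k)) (x : Vec₂ k) :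
    (PMF.uniformOfFintype (Vec₂ k)).map (fun v => permute σ v + x) =
      PMF.uniformOfFintype (Vec₂ k) :=
  uniform_map_equiv ((σ.arrowCongr (Equiv.refl (ZMod 2))).trans (Equiv.addRight x))

theorem uniform_map_permute_eq {x y : Vec₂ k} (h : hammingNorm x = hammingNorm y) :
    (PMF.uniformOfFintype (Equiv.Perm (Pos k))).map (fun π => permute π x) =
      (PMF.uniformOfFintype (Equiv.Perm (Pos k))).map fun π => permute π y := by
  obtain ⟨σ, rfl⟩ := exists_permute_eq h
  nth_rw 1 [← uniform_map_equiv (Equiv.mulRight σ)]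
  rw [PMF.map_comp]
  rfl

end vectors

/-! ### Indistinguishability of one iteration -/

namespace PTClass

variable {ι : Type} {l : ι → ℕ}

theorem Mem.polySized_reindex {x : ι → Val} (hx : (polySized l).Mem x) {κ : Type} (j : κ → ι) :
    (polySized fun i => l (j i)).Mem fun i => x (j i) := by
  obtain ⟨q, hq⟩ := hx
  exact ⟨q, fun i => hq (j i)⟩

section protocol

variable {COM : CommitmentScheme} {P : ι → Params}
  (hP : (polySized l).Mem fun i => encParams (P i))
include hP

protected theorem Mem.encInput (pk : ∀ i, PublicKey (P i)) :
    (polySized l).Mem fun i => encInput (l i) (pk i) :=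
  node_mem _ encNat_mem_polySized (node_mem _ hP (node_mem _ (hP.seedLen.encFixed _)
    (hP.s.encSeq ((hP.k.polySized_reindex Sigma.fst).vecBits _))))

protected theorem Mem.encChallenge (c : ∀ i, (Fin (P i).s × Fin (P i).k) × Bool) :
    (polySized l).Mem fun i => encChallenge (c i) :=
  node_mem _ (node_mem _ (hP.s.encNat_of_le fun i => (c i).1.1.2.le)
    (hP.k.encNat_of_le fun i => (c i).1.2.2.le)) <|
      encBool_mem_polySized _

protected theorem Mem.encIterationCoins (r : ∀ i, IterationCoins COM (l i) (P i)) :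
    (polySized l).Mem fun i => encIterationCoins (r i) := by
  have h_seed := hP.seedLen
  have h_coins := (encNat_mem_polySized (l := l)).coinLen COM
  exact node_mem _ (hP.encChallenge _) (node_mem _ (h_seed.encFixed _) (node_mem _
    (h_seed.encFixed _) (node_mem _ (h_coins.encFixed _) (node_mem _ (h_coins.encFixed _)
      (h_coins.encFixed _)))))

theorem Mem.encResponse_honestResponse (E : SeedSampler) (sk : ∀ i, SecretKey (P i))
    (pk : ∀ i, PublicKey (P i)) (r : ∀ i, IterationCoins COM (l i) (P i)) :
    (polySized l).Mem fun i => encResponse (honestResponse E (sk i) (pk i) (r i)) := by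
  have hl : (polySized l).Mem fun i => encNat (l i) := encNat_mem_polySized
  have h_seed (θ : ∀ i, Seed (P i)) := hP.seedLen.encFixed θ
  have h_coins (ρ : ∀ i, COM.Coins (l i)) := (hl.coinLen COM).encFixed ρ
  refine (encBool_mem_polySized fun i => (r i).1.2).ite (e := fun _ => encResponse) ?_ ?_
  · exact (h_seed _).response (hP.k.vecBits₂ _)
      (hl.commit ((hP.k.permBits _).append (hP.k.vecBits _)) (h_coins _)) (h_coins _) (h_coins _)
  · exact (h_seed _).response (hP.k.vecBits₂ _) (hl.commit (hP.k.vecBits₂ _) (h_coins _))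
      (h_coins _) (h_coins _)

end protocol

end PTClass

namespace CompIndist

variable {COM : CommitmentScheme}

section node

variable {X Y : ℕ → PMF Val} (h : CompIndist X Y) {z : ℕ → Val} (hz : (PTClass.polySized id).Mem z)
include h hz

theorem node_left : CompIndist (fun l => (X l).map fun v => .node (z l) v)
    fun l => (Y l).map fun v => .node (z l) v := by
  simpa only [← PMF.bind_pure_comp] using! h.process
    (F := fun v => PMF.pure (.node v.tl.hd v.tl.tl))
    (show IsPT fun v => .node v.tl.hd v.tl.tl by fun_prop) hz

theorem node_right : CompIndist (fun l => (X l).map fun v => .node v (z l))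
    fun l => (Y l).map fun v => .node v (z l) := by
  simpa only [← PMF.bind_pure_comp] using! h.process
    (F := fun v => PMF.pure (.node v.tl.tl v.tl.hd))
    (show IsPT fun v => .node v.tl.tl v.tl.hd by fun_prop) hz

end node

-- First the commitment is changed with the word fixed, then the word with the coins fixed.
theorem node_commit (hCOM : COM.Hiding) {α : ℕ → Type} [∀ l, Fintype (α l)] [∀ l, Nonempty (α l)]
    {X Y : ∀ l, α l → Val}
    (h : CompIndist (fun l => (PMF.uniformOfFintype (α l)).map (X l))
      fun l => (PMF.uniformOfFintype (α l)).map (Y l))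
    (hX : (PTClass.polySized Sigma.fst).Mem fun i : Σ l, α l => X i.1 i.2)
    {m : ∀ l, α l → List Bool} {m' : ℕ → List Bool}
    (hm' : (PTClass.polySized id).Mem fun l => encBits (m' l))
    (h_length : ∀ l a, (m l a).length = (m' l).length) :
    CompIndist (fun l => (PMF.uniformOfFintype (α l × COM.Coins l)).map fun p =>
        .node (X l p.1) (encBits (COM.commit l (m l p.1) p.2)))
      fun l => (PMF.uniformOfFintype (α l × COM.Coins l)).map fun p =>
        .node (Y l p.1) (encBits (COM.commit l (m' l) p.2)) := by
  have h_commit : CompIndist (fun l => (PMF.uniformOfFintype (α l × COM.Coins l)).map fun p =>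
        .node (X l p.1) (encBits (COM.commit l (m l p.1) p.2)))
      fun l => (PMF.uniformOfFintype (α l × COM.Coins l)).map fun p =>
        .node (X l p.1) (encBits (COM.commit l (m' l) p.2)) := by
    refine uniform_of_forall (fun _ => Equiv.refl _) fun a => ?_
    have hm : PolyBounded fun l => (m l (a l)).length := by
      simpa only [h_length] using PolyBounded.mono hm' fun l => length_le_size_encBits (m' l)
    simpa only [CommitmentScheme.commitment, PMF.map_comp] using!
      (hCOM.compIndist hm fun l => h_length l (a l)).node_left
        (hX.polySized_reindex fun l => ⟨l, a l⟩)
  have hl : (PTClass.polySized id).Mem encNat := PTClass.encNat_mem_polySized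
  refine h_commit.trans (uniform_of_forall (fun _ => Equiv.prodComm _ _) fun ρ => ?_)
  simpa only [PMF.map_comp] using! h.node_right (hl.commit hm' ((hl.coinLen COM).encFixed ρ))

variable {E : SeedSampler} {P : ℕ → Params} {pk : ∀ l, PublicKey (P l)}

theorem vecBits₂_permute_add
    (hE : CompIndist
      (fun l => (PMF.uniformOfFintype (Seed (P l))).map fun ξ =>
        encBits (vecBits₂ (E.vec l (P l) ξ)))
      fun l => (PMF.uniformOfFintype (Vec₂ (P l).k)).map fun v => encBits (vecBits₂ v))
    {σ : ∀ l, Equiv.Perm (Pos (P l).k)} (x : ∀ l, Vec₂ (P l).k)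
    (hσ : (PTClass.polySized id).Mem fun l => encBits (permBits (σ l)))
    (hx : (PTClass.polySized id).Mem fun l => encBits (vecBits₂ (x l))) :
    CompIndist (fun l => (PMF.uniformOfFintype (Seed (P l))).map fun ξ =>
        encBits (vecBits₂ (permute (σ l) (E.vec l (P l) ξ) + x l)))
      fun l => (PMF.uniformOfFintype (Seed (P l))).map fun ξ =>
        encBits (vecBits₂ (E.vec l (P l) ξ)) := by
  have h_map : CompIndist
      (fun l => ((PMF.uniformOfFintype (Seed (P l))).map (E.vec l (P l))).map fun v =>
        encBits (vecBits₂ v))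
      fun l => (PMF.uniformOfFintype (Vec₂ (P l).k)).map fun v => encBits (vecBits₂ v) := by
    simpa only [PMF.map_comp] using! hE
  have h_uniform (l : ℕ) : (PMF.uniformOfFintype (Vec₂ (P l).k)).map
        (fun v => encBits (vecBits₂ (permute (σ l) v + x l))) =
      (PMF.uniformOfFintype (Vec₂ (P l).k)).map fun v => encBits (vecBits₂ v) := by
    nth_rw 2 [← uniform_map_permute_add (σ l) (x l)]
    rw [PMF.map_comp]
    rfl
  let K := PTClass.withAdvice fun l (v : Vec₂ (P l).k) => encBits (vecBits₂ v)
  have h_input : K.Mem fun i => encBits (vecBits₂ i.2) := PTClass.input_mem_withAdvice _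
  have h_perm : K.Mem fun i => encBits (permBits (σ i.1)) := PTClass.advice_mem_withAdvice _ hσ
  have h_word : K.Mem fun i => encBits (vecBits₂ (x i.1)) := PTClass.advice_mem_withAdvice _ hx
  have h := h_map.map ((h_perm.permute h_input).vec₂_add h_word)
  simp only [h_uniform, PMF.map_comp] at h
  exact h.trans hE.symm

theorem vecBits₂_permute
    (hE : CompIndist
      (fun l => (PMF.uniformOfFintype (Seed (P l))).map fun θ =>
        encBits (permBits (E.perm l (P l) θ)))
      fun l => (PMF.uniformOfFintype (Equiv.Perm (Pos (P l).k))).map fun π => encBits (permBits π))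
    {x y : ∀ l, Vec₂ (P l).k} (hx : (PTClass.polySized id).Mem fun l => encBits (vecBits₂ (x l)))
    (hy : (PTClass.polySized id).Mem fun l => encBits (vecBits₂ (y l)))
    (hxy : ∀ l, hammingNorm (x l) = hammingNorm (y l)) :
    CompIndist (fun l => (PMF.uniformOfFintype (Seed (P l))).map fun θ =>
        encBits (vecBits₂ (permute (E.perm l (P l) θ) (x l))))
      fun l => (PMF.uniformOfFintype (Seed (P l))).map fun θ =>
        encBits (vecBits₂ (permute (E.perm l (P l) θ) (y l))) := by
  have h_map : CompIndist
      (fun l => ((PMF.uniformOfFintype (Seed (P l))).map (E.perm l (P l))).map fun π =>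
        encBits (permBits π))
      fun l => (PMF.uniformOfFintype (Equiv.Perm (Pos (P l).k))).map fun π =>
        encBits (permBits π) := by
    simpa only [PMF.map_comp] using! hE
  let K := PTClass.withAdvice fun l (π : Equiv.Perm (Pos (P l).k)) => encBits (permBits π)
  have h_input : K.Mem fun i => encBits (permBits i.2) := PTClass.input_mem_withAdvice _
  have h_permute {x : ∀ l, Vec₂ (P l).k}
      (hx : (PTClass.polySized id).Mem fun l => encBits (vecBits₂ (x l))) :=
    have h_word : K.Mem fun i => encBits (vecBits₂ (x i.1)) := PTClass.advice_mem_withAdvice _ hx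
    h_map.map (h_input.permute h_word)
  have h_uniform (l : ℕ) : (PMF.uniformOfFintype (Equiv.Perm (Pos (P l).k))).map
        (fun π => encBits (vecBits₂ (permute π (x l)))) =
      (PMF.uniformOfFintype (Equiv.Perm (Pos (P l).k))).map
        fun π => encBits (vecBits₂ (permute π (y l))) := by
    have h := congrArg (PMF.map fun v => encBits (vecBits₂ v)) (uniform_map_permute_eq (hxy l))
    rwa [PMF.map_comp, PMF.map_comp] at h
  have h := h_permute hx
  simp only [h_uniform] at h
  simpa only [PMF.map_comp] using! h.trans (h_permute hy).symm

section iteration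

variable {COM : CommitmentScheme} (hCOM : COM.Hiding) {E : SeedSampler} {P : ℕ → Params}
  (hP : (PTClass.polySized id).Mem fun l => encParams (P l)) (pk : ∀ l, PublicKey (P l))

section ofResponse

variable (E) (c : ∀ l, (Fin (P l).s × Fin (P l).k) × Bool) (θ : ∀ l, Seed (P l))
  (ρ ρ' : ∀ l, COM.Coins l)
include hP

theorem map_ofResponse {μ ν : ∀ l, PMF (Vec₂ (P l).k × List Bool)}
    (h : CompIndist
      (fun l => (μ l).map fun a => .node (encBits (vecBits₂ a.1)) (encBits a.2))
      fun l => (ν l).map fun a => .node (encBits (vecBits₂ a.1)) (encBits a.2)) :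
    CompIndist
      (fun l => (μ l).map fun a =>
        encIteration (.ofResponse E (pk l) (c l) ⟨θ l, a.1, a.2, ρ l, ρ' l⟩))
      fun l => (ν l).map fun a =>
        encIteration (.ofResponse E (pk l) (c l) ⟨θ l, a.1, a.2, ρ l, ρ' l⟩) := by
  let K := PTClass.withAdvice fun l (a : Vec₂ (P l).k × List Bool) =>
    .node (encBits (vecBits₂ a.1)) (encBits a.2)
  have h_advice {z : ℕ → Val} (hz : (PTClass.polySized id).Mem z) : K.Mem fun i => z i.1 :=
    PTClass.advice_mem_withAdvice _ hz
  have h_answer : K.Mem fun i => .node (encBits (vecBits₂ i.2.1)) (encBits i.2.2) :=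
    PTClass.input_mem_withAdvice _
  have h_input : K.Mem fun i => encInput i.1 (pk i.1) := h_advice (hP.encInput pk)
  have h_challenge : K.Mem fun i => encChallenge (c i.1) := h_advice (hP.encChallenge c)
  have h_seed : K.Mem fun i => encFixed (θ i.1) := h_advice (hP.seedLen.encFixed θ)
  have h_coins (ρ : ∀ l, COM.Coins l) : K.Mem fun i => encFixed (ρ i.1) :=
    h_advice ((PTClass.encNat_mem_polySized.coinLen COM).encFixed ρ)
  have h_map := h.map (h_input.ofResponse E h_challenge
    (.response h_seed h_answer.hd h_answer.tl (h_coins ρ) (h_coins ρ')))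
  exact h_map

include hCOM

theorem ofResponse_commit {x y : ∀ l, Seed (P l) → Vec₂ (P l).k}
    (h : CompIndist (fun l => (PMF.uniformOfFintype (Seed (P l))).map fun a =>
        encBits (vecBits₂ (x l a)))
      fun l => (PMF.uniformOfFintype (Seed (P l))).map fun a => encBits (vecBits₂ (y l a)))
    {m : ∀ l, Seed (P l) → List Bool} {m' : ℕ → List Bool}
    (hm' : (PTClass.polySized id).Mem fun l => encBits (m' l))
    (h_length : ∀ l a, (m l a).length = (m' l).length) :
    CompIndist (fun l => (PMF.uniformOfFintype (Seed (P l) × COM.Coins l)).map fun a =>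
        encIteration (.ofResponse E (pk l) (c l)
          ⟨θ l, x l a.1, COM.commit l (m l a.1) a.2, ρ l, ρ' l⟩))
      fun l => (PMF.uniformOfFintype (Seed (P l) × COM.Coins l)).map fun a =>
        encIteration (.ofResponse E (pk l) (c l)
          ⟨θ l, y l a.1, COM.commit l (m' l) a.2, ρ l, ρ' l⟩) := by
  have h_answer := node_commit hCOM h
    ((hP.k.polySized_reindex Sigma.fst).vecBits₂ fun i : Σ l, Seed (P l) => x i.1 i.2) hm' h_length
  have h_iteration := map_ofResponse E hP pk c θ ρ ρ'
    (μ := fun l => (PMF.uniformOfFintype (Seed (P l) × COM.Coins l)).map fun a =>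
      (x l a.1, COM.commit l (m l a.1) a.2))
    (ν := fun l => (PMF.uniformOfFintype (Seed (P l) × COM.Coins l)).map fun a =>
      (y l a.1, COM.commit l (m' l) a.2))
    (by simpa only [PMF.map_comp] using! h_answer)
  simpa only [PMF.map_comp] using! h_iteration

end ofResponse

section proverCoins

variable (sk : ∀ l, SecretKey (P l)) (c : ∀ l, Fin (P l).s × Fin (P l).k)
include hCOM hP

theorem honestIteration_false
    (hE : CompIndist
      (fun l => (PMF.uniformOfFintype (Seed (P l))).map fun ξ =>
        encBits (vecBits₂ (E.vec l (P l) ξ)))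
      fun l => (PMF.uniformOfFintype (Vec₂ (P l).k)).map fun v => encBits (vecBits₂ v)) :
    CompIndist
      (fun l => (PMF.uniformOfFintype (ProverCoins COM l (P l))).map fun p =>
        encIteration (honestIteration E (sk l) (pk l) ((c l, false), p)))
      fun l => (PMF.uniformOfFintype (ProverCoins COM l (P l))).map fun p =>
        encIteration (simulatedIteration E (pk l) ((c l, false), p)) := by
  let e (l : ℕ) : (Seed (P l) × COM.Coins l × COM.Coins l) × Seed (P l) × COM.Coins l ≃
      ProverCoins COM l (P l) :=
    ⟨fun ⟨⟨θ, ρ₁, ρ₃⟩, ξ, ρ₂⟩ => (θ, ξ, ρ₁, ρ₂, ρ₃), fun ⟨θ, ξ, ρ₁, ρ₂, ρ₃⟩ => ((θ, ρ₁, ρ₃), ξ, ρ₂),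
      fun _ => rfl, fun _ => rfl⟩
  refine uniform_of_forall e fun a => ?_
  have h_word := vecBits₂_permute_add hE
    (fun l => rot₂ (c l).2 (E.secrets l (P l) (sk l) (c l).1).1)
    (hP.k.permBits fun l => (E.perm l (P l) (a l).1).symm) (hP.k.vecBits₂ _)
  have h_iteration := ofResponse_commit hCOM E hP pk (fun l => (c l, false)) (fun l => (a l).1)
    (fun l => (a l).2.1) (fun l => (a l).2.2) h_word
    (m := fun l ξ => vecBits₂ (permute (E.perm l (P l) (a l).1)
      (permute (E.perm l (P l) (a l).1).symm (E.vec l (P l) ξ))))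
    (hP.k.vecBits₂ fun l => E.vec l (P l) (pk l).1)
    fun l ξ => by rw [length_vecBits₂, length_vecBits₂]
  exact h_iteration

theorem honestIteration_true
    (hE : CompIndist
      (fun l => (PMF.uniformOfFintype (Seed (P l))).map fun θ =>
        encBits (permBits (E.perm l (P l) θ)))
      fun l => (PMF.uniformOfFintype (Equiv.Perm (Pos (P l).k))).map fun π =>
        encBits (permBits π)) :
    CompIndist
      (fun l => (PMF.uniformOfFintype (ProverCoins COM l (P l))).map fun p =>
        encIteration (honestIteration E (sk l) (pk l) ((c l, true), p)))
      fun l => (PMF.uniformOfFintype (ProverCoins COM l (P l))).map fun p =>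
        encIteration (simulatedIteration E (pk l) ((c l, true), p)) := by
  let e (l : ℕ) : (Seed (P l) × COM.Coins l × COM.Coins l) × Seed (P l) × COM.Coins l ≃
      ProverCoins COM l (P l) :=
    ⟨fun ⟨⟨ξ, ρ₂, ρ₃⟩, θ, ρ₁⟩ => (θ, ξ, ρ₁, ρ₂, ρ₃), fun ⟨θ, ξ, ρ₁, ρ₂, ρ₃⟩ => ((ξ, ρ₂, ρ₃), θ, ρ₁),
      fun _ => rfl, fun _ => rfl⟩
  refine uniform_of_forall e fun a => ?_
  have h_word := vecBits₂_permute hE (hP.k.vecBits₂ _)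
    (hP.k.vecBits₂ fun l => (E.secrets l (P l) (pk l).1 0).1)
    (x := fun l => rot₂ (c l).2 (E.secrets l (P l) (sk l) (c l).1).1) fun l => by
      rw [hammingNorm_rot₂, (E.secrets _ _ _ _).2, (E.secrets _ _ _ _).2]
  have h_iteration := ofResponse_commit hCOM E hP pk (fun l => (c l, true)) (fun l => (a l).1)
    (fun l => (a l).2.1) (fun l => (a l).2.2) h_word
    (m := fun l θ => permBits (E.perm l (P l) θ) ++
      vecBits ((qcMatrix (E.block l (P l) (pk l).1)).mulVec
        (permute (E.perm l (P l) θ).symm (E.vec l (P l) (a l).1))))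
    ((hP.k.permBits fun l => E.perm l (P l) (pk l).1).append
      (hP.k.vecBits fun l => E.block l (P l) (pk l).1))
    fun l θ => by
      simp only [List.length_append, length_permBits, length_vecBits]
  exact h_iteration

end proverCoins

end iteration

end CompIndist

/-! ### Indistinguishability of transcripts -/

section transcripts

variable {COM : CommitmentScheme} {E : SeedSampler} {P : ℕ → Params}

theorem CompIndist.honestIteration (hCOM : COM.Hiding)
    (hP : (PTClass.polySized id).Mem fun l => encParams (P l))
    (h_perm : CompIndist
      (fun l => (PMF.uniformOfFintype (Seed (P l))).map fun θ =>
        encBits (permBits (E.perm l (P l) θ)))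
      fun l => (PMF.uniformOfFintype (Equiv.Perm (Pos (P l).k))).map fun π =>
        encBits (permBits π))
    (h_vec : CompIndist
      (fun l => (PMF.uniformOfFintype (Seed (P l))).map fun ξ =>
        encBits (vecBits₂ (E.vec l (P l) ξ)))
      fun l => (PMF.uniformOfFintype (Vec₂ (P l).k)).map fun v => encBits (vecBits₂ v))
    (sk : ∀ l, SecretKey (P l)) (pk : ∀ l, PublicKey (P l)) :
    CompIndist
      (fun l => (PMF.uniformOfFintype (IterationCoins COM l (P l))).map fun r =>
        encIteration (QCStern.honestIteration E (sk l) (pk l) r))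
      fun l => (PMF.uniformOfFintype (IterationCoins COM l (P l))).map fun r =>
        encIteration (simulatedIteration E (pk l) r) :=
  uniform_of_forall (fun _ => Equiv.refl _) fun c =>
    of_forall_bool
      (X := fun l b => (PMF.uniformOfFintype (ProverCoins COM l (P l))).map fun p =>
        encIteration (QCStern.honestIteration E (sk l) (pk l) (((c l).1, b), p)))
      (Y := fun l b => (PMF.uniformOfFintype (ProverCoins COM l (P l))).map fun p =>
        encIteration (simulatedIteration E (pk l) (((c l).1, b), p)))
      (Bool.rec (honestIteration_false hCOM hP pk sk _ h_vec)
        (honestIteration_true hCOM hP pk sk _ h_perm)) fun l => (c l).2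

theorem CompIndist.map_ofIterations (Z : Compressor COM)
    (hP : (PTClass.polySized id).Mem fun l => encParams (P l)) (R₁ R₂ : ∀ l, COM.Coins l)
    {μ ν : ∀ l, PMF (Fin (P l).δ → Iteration COM l (P l))}
    (h : CompIndist (fun l => (μ l).map (encSeq encIteration))
      fun l => (ν l).map (encSeq encIteration)) :
    CompIndist
      (fun l => (μ l).map fun t => encTranscript (.ofIterations Z (R₁ l) (R₂ l) t))
      fun l => (ν l).map fun t => encTranscript (.ofIterations Z (R₁ l) (R₂ l) t) := by
  let K := PTClass.withAdvice fun l (t : Fin (P l).δ → Iteration COM l (P l)) =>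
    encSeq encIteration t
  have h_params : K.Mem fun i => encParams (P i.1) := PTClass.advice_mem_withAdvice _ hP
  have h_coins (ρ : ∀ l, COM.Coins l) : K.Mem fun i => encFixed (ρ i.1) :=
    PTClass.advice_mem_withAdvice _ ((PTClass.encNat_mem_polySized.coinLen COM).encFixed ρ)
  have h_iterations : K.Mem fun i => encSeq encIteration i.2 := PTClass.input_mem_withAdvice _
  have h_map := h.map (.ofIterations Z (PTClass.encNat_mem_withAdvice _) h_params (h_coins R₁)
    (h_coins R₂) h_iterations)
  exact h_map

theorem CompIndist.runIterations (Z : Compressor COM)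
    (hP : (PTClass.polySized id).Mem fun l => encParams (P l))
    {f g : ∀ l, IterationCoins COM l (P l) → Iteration COM l (P l)}
    (hf : (PTClass.polySized Sigma.fst).Mem
      fun i : Σ l, IterationCoins COM l (P l) => encIteration (f i.1 i.2))
    (hg : (PTClass.polySized Sigma.fst).Mem
      fun i : Σ l, IterationCoins COM l (P l) => encIteration (g i.1 i.2))
    (h : CompIndist
      (fun l => (PMF.uniformOfFintype (IterationCoins COM l (P l))).map fun r =>
        encIteration (f l r))
      fun l => (PMF.uniformOfFintype (IterationCoins COM l (P l))).map fun r =>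
        encIteration (g l r)) :
    CompIndist (fun l => (QCStern.runIterations Z (f l)).map encTranscript)
      fun l => (QCStern.runIterations Z (g l)).map encTranscript := by
  have h_iid := h.iid (PTClass.polySized_uniform_map hf) (PTClass.polySized_uniform_map hg)
    (n := fun l => (P l).δ) hP.δ.exists_le
  have h_seq (l : ℕ) (f : IterationCoins COM l (P l) → Iteration COM l (P l)) :
      (QCStern.iid ((PMF.uniformOfFintype (IterationCoins COM l (P l))).map fun r =>
        encIteration (f r)) (P l).δ).map (encList id) =
      ((PMF.uniformOfFintype (Fin (P l).δ → IterationCoins COM l (P l))).map fun r i =>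
        f (r i)).map (encSeq encIteration) := by
    rw [iid_uniform_map_encList, PMF.map_comp]
    exact congrArg (PMF.map · _) (funext (encSeq_comp encIteration f))
  simp only [h_seq] at h_iid
  simp only [QCStern.runIterations, PMF.map_comp]
  refine uniform_of_forall (fun l => Equiv.prodAssoc (COM.Coins l) (COM.Coins l) _) fun R => ?_
  have h_transcript := h_iid.map_ofIterations Z hP (fun l => (R l).1) fun l => (R l).2
  simp only [PMF.map_comp] at h_transcript
  exact h_transcript

theorem CompIndist.runIterations_honestIteration (Z : Compressor COM) (hCOM : COM.Hiding)
    (hP : (PTClass.polySized id).Mem fun l => encParams (P l))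
    (h_perm : CompIndist
      (fun l => (PMF.uniformOfFintype (Seed (P l))).map fun θ =>
        encBits (permBits (E.perm l (P l) θ)))
      fun l => (PMF.uniformOfFintype (Equiv.Perm (Pos (P l).k))).map fun π =>
        encBits (permBits π))
    (h_vec : CompIndist
      (fun l => (PMF.uniformOfFintype (Seed (P l))).map fun ξ =>
        encBits (vecBits₂ (E.vec l (P l) ξ)))
      fun l => (PMF.uniformOfFintype (Vec₂ (P l).k)).map fun v => encBits (vecBits₂ v))
    (sk : ∀ l, SecretKey (P l)) (pk : ∀ l, PublicKey (P l)) :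
    CompIndist
      (fun l => (QCStern.runIterations (l := l) Z (QCStern.honestIteration E (sk l) (pk l))).map
        encTranscript)
      fun l => (QCStern.runIterations (l := l) Z (simulatedIteration E (pk l))).map
        encTranscript := by
  have hP' := hP.polySized_reindex fun i : Σ l, IterationCoins COM l (P l) => i.1
  have h_input := hP'.encInput fun i => pk i.1
  have h_coins := hP'.encIterationCoins (COM := COM) fun i => i.2
  have h_challenge := hP'.encChallenge fun i => i.2.1
  exact .runIterations Z hP
    (h_input.ofResponse E h_challenge
      (hP'.encResponse_honestResponse E (fun i => sk i.1) (fun i => pk i.1) fun i => i.2))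
    (h_input.ofResponse E h_challenge (h_input.simulatedResponse E h_coins))
    (.honestIteration hCOM hP h_perm h_vec sk pk)

theorem eq_of_mem_support_keyGen {l : ℕ} {P : Params} {key : SecretKey P × PublicKey P}
    (h : key ∈ (keyGen E l P).support) (i : Fin P.s) :
    key.2.2 i = (qcMatrix (E.block l P key.2.1)).mulVec (E.secrets l P key.1 i).1 := by
  have bind_eq {α β : Type} (μ : PMF α) (f : α → PMF β) : μ >>= f = μ.bind f := rfl
  have pure_eq {α : Type} (a : α) : (pure a : PMF α) = PMF.pure a := rfl
  simp only [keyGen, bind_eq, pure_eq, PMF.mem_support_bind_iff, PMF.mem_support_pure_iff] at h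
  obtain ⟨φ₁, -, φ₂, -, rfl⟩ := h
  rfl

theorem Setup.PolyBounded.encParams_mem_polySized {setup : Setup} (h : setup.PolyBounded)
    (hP : ∀ l, P l ∈ (setup l).support) :
    (PTClass.polySized id).Mem fun l => encParams (P l) := by
  obtain ⟨q, hq⟩ := h
  have h_nat (n : ℕ → ℕ) (hn : ∀ l, n l ≤ (2 * q).eval l) :
      (PTClass.polySized id).Mem fun l => encNat (n l) :=
    ⟨2 * (2 * q) + 1, fun l => by simpa [size_encNat] using hn l⟩
  have h_bounds (l : ℕ) := hq l (P l) (hP l)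
  have h_eval (l : ℕ) : (2 * q).eval l = 2 * q.eval l := by simp
  simp only [h_eval] at h_nat
  refine PTClass.node_mem _ (h_nat _ fun l => ?_) (PTClass.node_mem _ (h_nat _ fun l => ?_)
    (PTClass.node_mem _ (h_nat _ fun l => ?_) (PTClass.node_mem _ (h_nat _ fun l => ?_)
      (PTClass.node_mem _ (h_nat _ fun l => ?_) (PTClass.const_mem _ .nil)))))
  all_goals have := h_bounds l; have := (P l).w_le; omega

end transcripts

end QCStern

theorem theorem4 (setup : QCStern.Setup) (hsetup : setup.PolyBounded)
    (COM : QCStern.CommitmentScheme) (E : QCStern.SeedSampler) (Z : QCStern.Compressor COM)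
    (hE : E.Pseudorandom setup) (hCOM : COM.Hiding) :
    QCStern.HonestVerifierZK setup COM E Z := by
  obtain ⟨f, hf, hf_eq⟩ := QCStern.isPPTOn_runIterations_simulatedIteration E Z
  obtain ⟨S, rfl⟩ := hf.exists_ppt
  refine ⟨S, fun par hpar key hkey => ?_⟩
  have h_honest (l : ℕ) := QCStern.honestTranscript_eq_runIterations Z
    (QCStern.eq_of_mem_support_keyGen (hkey l))
  have h_simulated (l : ℕ) := hf_eq ⟨l, par l, (key l).2⟩
  simp only [QCStern.encInput] at h_simulated
  simp only [h_honest, h_simulated]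
  exact .runIterations_honestIteration Z hCOM (hsetup.encParams_mem_polySized hpar)
    (hE par hpar).1 (hE par hpar).2 (fun l => (key l).1) fun l => (key l).2
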